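/- Let $\hbar>0$. For $N\ge 0$, $y=(y_1,\dots,y_N)\in\mathbb C^N$, $\varepsilon\in\mathbb C$ and $x=(x_1,\dots,x_{N+1})\in\mathbb R^{N+1}$ define $\Psi_{y,\varepsilon}(x)$ recursively. For $N=0$, $\Psi_{\emptyset,\varepsilon}(x)=e^{i\varepsilon x/\hbar}$. For $N\ge1$ choose $r\in\{1,\dots,N\}$ and $\alpha>\max_k|\operatorname{Im}y_k|$ ($\alpha$ may depend on $y$) and put, with $\bar y=\sum_k y_k$ (similarly $\bar z$), $$\Psi_{y,\varepsilon}(x)=\int_{(\mathbb R-i\alpha)^{r-1}\times(\mathbb R+i\alpha)^{N-r}}\Psi_{w,\bar y-\bar z}(x_1,\dots,x_r)\,\Psi_{z,\varepsilon-\bar y+\bar z}(x_{r+1},\dots,x_{N+1})\,\varpi(w,z\mid y)\,d^{r-1}w\,d^{N-r}z,$$ where $w=(w_1,\dots,w_{r-1})$, $z=(z_r,\dots,z_{N-1})$ and $$\varpi(w,z\mid y)=\frac{(2\pi\hbar)^{1-N}}{(r-1)!\,(N-r)!}\cdot\frac{\prod_{a=1}^{r-1}\prod_{b=1}^{N}\Gamma\big(\frac{y_b-w_a}{i\hbar}\big)\hbar^{\frac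 i\hbar(w_a-y_b)}\;\prod_{a=r}^{N-1}\prod_{b=1}^{N}\Gamma\big(\frac{z_a-y_b}{i\hbar}\big)\hbar^{\frac i\hbar(y_b-z_a)}}{\prod_{a\ne b}\Gamma\big(\frac{w_a-w_b}{i\hbar}\big)\;\prod_{a\ne b}\Gamma\big(\frac{z_a-z_b}{i\hbar}\big)\;\prod_{a=1}^{r-1}\prod_{b=r}^{N-1}\Gamma\big(\frac{z_b-w_a}{i\hbar}\big)\hbar^{\frac i\hbar(w_a-z_b)}} .$$ The two functions $\Psi$ under the integral are built in the same way, each with its own choices of splittings and contours; all the choices together are called a chain of splittings. Write $\|v\|=\sum_a|v_a|$. Then, for every $N\ge0$: 1. For every $\eta>0$ there are constants $C_1,C_2,M$, depending only on $N,\hbar,\eta$ and not on the chain of splittings, such that for every chain of splittings, every $x\in\mathbb R^{N+1}$, and all $y,\varepsilon$ with $|\operatorname{Im}y_k|<\eta$ ($k=1,\dots,N$) and $|\operatorname{Im}\varepsilon|<\eta$, $$\big|\Psi_{y,\varepsilon}(x)\big|\le C_1e^{C_2\|x\|}\,(1+\|y\|)^{M}\exp\Big\{-\frac{\pi}{2\hbar}\sum_{1\le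 a<b\le N}|\operatorname{Re}(y_a-y_b)|\Big\}.$$ 2. For every chain of splittings and all $y\in\mathbb C^N$, $\varepsilon\in\mathbb C$, $x\in\mathbb R^{N+1}$, the multiple integral defining $\Psi_{y,\varepsilon}(x)$ converges absolutely. 3. For every chain of splittings, $\Psi_{y,\varepsilon}(x)$ is entire in $(y,\varepsilon,x)$: there is an entire function on $\mathbb C^N\times\mathbb C\times\mathbb C^{N+1}$ that equals $\Psi_{y,\varepsilon}(x)$ at all $y\in\mathbb C^N$, $\varepsilon\in\mathbb C$, $x\in\mathbb R^{N+1}$. -/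

import Mathlib

open MeasureTheory

noncomputable section

namespace Toda

/-- A chain of splittings for the construction of `Ψ_{y,ε}(x)` with `N` spectral variables `y` and
`N + 1` positions `x`.  For `N = 0` there is nothing to choose.  For `N = m + n + 1` one chooses the
splitting `r = m + 1` (so that `r - 1 = m` and `N - r = n`), the height `α` of the integration
contour, which may be any number larger than `max_k |Im y_k|`, and chains of splittings for the two
functions, of `m` and `n` spectral variables, that enter the integral. -/
inductive Chain : ℕ → Type
  | leaf : Chain 0
  | node {m n : ℕ} (α : (Fin (m + n + 1) → ℂ) → ℝ) (hα : ∀ y k, |(y k).im| < α y)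
      (left : Chain m) (right : Chain n) : Chain (m + n + 1)

/-- The weight `ϖ(w, z | y)`. -/
def weight (ħ : ℝ) {m n : ℕ} (w : Fin m → ℂ) (z : Fin n → ℂ) (y : Fin (m + n + 1) → ℂ) : ℂ :=
  ((2 * Real.pi * ħ : ℂ) ^ (m + n))⁻¹ / ((m.factorial : ℂ) * (n.factorial : ℂ)) *
    (((∏ a, ∏ b, Complex.Gamma ((y b - w a) / (Complex.I * ħ)) *
          (ħ : ℂ) ^ (Complex.I / ħ * (w a - y b))) *
        ∏ a, ∏ b, Complex.Gamma ((z a - y b) / (Complex.I * ħ)) *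
          (ħ : ℂ) ^ (Complex.I / ħ * (y b - z a))) /
      ((∏ p ∈ (Finset.univ : Finset (Fin m)).offDiag,
          Complex.Gamma ((w p.1 - w p.2) / (Complex.I * ħ))) *
        (∏ p ∈ (Finset.univ : Finset (Fin n)).offDiag,
          Complex.Gamma ((z p.1 - z p.2) / (Complex.I * ħ))) *
        ∏ a, ∏ b, Complex.Gamma ((z b - w a) / (Complex.I * ħ)) *
          (ħ : ℂ) ^ (Complex.I / ħ * (w a - z b))))

/-- The first `m + 1` of `m + n + 2` positions. -/
def headPos {m n : ℕ} (x : Fin (m + n + 1 + 1) → ℝ) : Fin (m + 1) → ℝ :=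
  fun i => x ⟨i, by omega⟩

/-- The last `n + 1` of `m + n + 2` positions. -/
def tailPos {m n : ℕ} (x : Fin (m + n + 1 + 1) → ℝ) : Fin (n + 1) → ℝ :=
  fun j => x ⟨m + 1 + j, by omega⟩

/-- The integrand of the Mellin-Barnes integral, built from two functions `Φ₁`, `Φ₂` of `m` and `n`
spectral variables, on the contour `(ℝ - iα)^m × (ℝ + iα)^n` parametrised by `ℝ^m × ℝ^n`. -/
def integrand (ħ : ℝ) {m n : ℕ}
    (Φ₁ : (Fin m → ℂ) → ℂ → (Fin (m + 1) → ℝ) → ℂ)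
    (Φ₂ : (Fin n → ℂ) → ℂ → (Fin (n + 1) → ℝ) → ℂ)
    (α : ℝ) (y : Fin (m + n + 1) → ℂ) (ε : ℂ) (x : Fin (m + n + 1 + 1) → ℝ)
    (p : (Fin m → ℝ) × (Fin n → ℝ)) : ℂ :=
  let w : Fin m → ℂ := fun a => (p.1 a : ℂ) - Complex.I * α
  let z : Fin n → ℂ := fun b => (p.2 b : ℂ) + Complex.I * α
  Φ₁ w (∑ k, y k - ∑ b, z b) (headPos x) * Φ₂ z (ε - ∑ k, y k + ∑ b, z b) (tailPos x) *
    weight ħ w z y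

/-- The function `Ψ_{y,ε}(x)` built along a chain of splittings. -/
def Psi (ħ : ℝ) : {N : ℕ} → Chain N → (Fin N → ℂ) → ℂ → (Fin (N + 1) → ℝ) → ℂ
  | _, .leaf => fun _ ε x => Complex.exp (Complex.I * (ε / ħ) * x 0)
  | _, .node α _ left right => fun y ε x =>
      ∫ p, integrand ħ (Psi ħ left) (Psi ħ right) (α y) y ε x p

/-- Absolute convergence of the multiple integral that defines `Ψ_{y,ε}(x)`
(for `N = 0` there is no integral). -/
def Converges (ħ : ℝ) : {N : ℕ} → Chain N → (Fin N → ℂ) → ℂ → (Fin (N + 1) → ℝ) → Prop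
  | _, .leaf => fun _ _ _ => True
  | _, .node α _ left right => fun y ε x =>
      Integrable (integrand ħ (Psi ħ left) (Psi ħ right) (α y) y ε x)

end Toda

end

noncomputable section

namespace Toda

open Filter Topology

theorem norm_betaIntegral_le {s : ℂ} (hs : 0 < s.re) {b : ℝ} (hb : 0 < b) :
    ‖Complex.betaIntegral s b‖ ≤ ‖Complex.betaIntegral s.re b‖ := by
  have hconv := Complex.betaIntegral_convergent (u := (s.re : ℂ)) (v := (b : ℂ)) (by simpa) (by simpa)
  have key : Complex.betaIntegral s.re b =
      ((∫ x : ℝ in (0 : ℝ)..1, ‖(x : ℂ) ^ (s - 1) * (1 - (x : ℂ)) ^ ((b : ℂ) - 1)‖ : ℝ) : ℂ) := by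
    rw [Complex.betaIntegral, ← intervalIntegral.integral_ofReal]
    refine intervalIntegral.integral_congr_ae ?_
    have h1 : ∀ᵐ x : ℝ, x ≠ 1 := by simp [ae_iff]
    filter_upwards [h1] with x hx1 hx
    rw [Set.uIoc_of_le zero_le_one] at hx
    have hx1' : x < 1 := lt_of_le_of_ne hx.2 hx1
    have e : (1 - (x : ℂ)) = ((1 - x : ℝ) : ℂ) := by push_cast; ring
    rw [norm_mul, e, Complex.norm_cpow_eq_rpow_re_of_pos hx.1,
      Complex.norm_cpow_eq_rpow_re_of_pos (by linarith)]
    push_cast [Complex.ofReal_cpow hx.1.le, Complex.ofReal_cpow (by linarith : (0:ℝ) ≤ 1 - x)]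
    simp
  rw [key, Complex.norm_real, Real.norm_eq_abs]
  exact (intervalIntegral.norm_integral_le_integral_norm zero_le_one).trans (le_abs_self _)

theorem norm_Gamma_mul_le {s : ℂ} (hs : 0 < s.re) {b : ℝ} (hb : 0 < b) :
    ‖Complex.Gamma s‖ * Real.Gamma (s.re + b) ≤ ‖Complex.Gamma (s + b)‖ * Real.Gamma s.re := by
  have h1 := Complex.Gamma_mul_Gamma_eq_betaIntegral hs (t := (b : ℂ)) (by simpa)
  have h2 := Complex.Gamma_mul_Gamma_eq_betaIntegral (s := (s.re : ℂ)) (by simpa) (t := (b : ℂ))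
    (by simpa)
  have h3 : ((s.re : ℂ) + b) = ((s.re + b : ℝ) : ℂ) := by push_cast; ring
  rw [h3, Complex.Gamma_ofReal, Complex.Gamma_ofReal, Complex.Gamma_ofReal] at h2
  rw [Complex.Gamma_ofReal] at h1
  have n1 := congrArg norm h1
  have n2 := congrArg norm h2
  have g1 := Real.Gamma_pos_of_pos hb
  have g2 := Real.Gamma_pos_of_pos hs
  have g3 := Real.Gamma_pos_of_pos (add_pos hs hb)
  simp only [norm_mul, Complex.norm_real, Real.norm_eq_abs, abs_of_pos g1, abs_of_pos g2,
    abs_of_pos g3] at n1 n2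
  have hb' := norm_betaIntegral_le hs hb
  have : (‖Complex.Gamma s‖ * Real.Gamma (s.re + b)) * Real.Gamma b ≤
      (‖Complex.Gamma (s + b)‖ * Real.Gamma s.re) * Real.Gamma b := by
    calc _ = ‖Complex.Gamma (s + b)‖ * ‖Complex.betaIntegral s b‖ * Real.Gamma (s.re + b) := by
          rw [← n1]; ring
      _ ≤ ‖Complex.Gamma (s + b)‖ * ‖Complex.betaIntegral s.re b‖ * Real.Gamma (s.re + b) := by
          gcongr
      _ = ‖Complex.Gamma (s + b)‖ * (Real.Gamma (s.re + b) * ‖Complex.betaIntegral s.re b‖) := by ring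
      _ = _ := by rw [← n2]; ring
  exact le_of_mul_le_mul_right this g1

theorem norm_Gamma_one_add_sq (t : ℝ) (ht : t ≠ 0) :
    ‖Complex.Gamma (1 + t * Complex.I)‖ ^ 2 = Real.pi * |t| / Real.sinh (Real.pi * |t|) := by
  have htI : (t : ℂ) * Complex.I ≠ 0 := by simp [ht]
  have h1 : Complex.Gamma (1 + t * Complex.I) = t * Complex.I * Complex.Gamma (t * Complex.I) := by
    rw [add_comm, Complex.Gamma_add_one _ htI]
  have h2 := Complex.Gamma_mul_Gamma_one_sub (t * Complex.I)
  have h3 : (1 : ℂ) - t * Complex.I = (starRingEnd ℂ) (1 + t * Complex.I) := by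
    simp [sub_eq_add_neg]
  have h4 : ‖Complex.Gamma (1 - t * Complex.I)‖ = ‖Complex.Gamma (1 + t * Complex.I)‖ := by
    rw [h3, Complex.Gamma_conj, RCLike.norm_conj]
  have h5 := congrArg norm h2
  have e : (Real.pi : ℂ) * (t * Complex.I) = ((Real.pi * t : ℝ) : ℂ) * Complex.I := by push_cast; ring
  rw [norm_mul, h4, norm_div, e, Complex.sin_mul_I, norm_mul, Complex.norm_I, mul_one,
    ← Complex.ofReal_sinh, Complex.norm_real, Complex.norm_real, Real.norm_eq_abs, Real.norm_eq_abs,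
    abs_of_pos Real.pi_pos] at h5
  have h6 : |Real.sinh (Real.pi * t)| = Real.sinh (Real.pi * |t|) := by
    rw [Real.abs_sinh, abs_mul, abs_of_pos Real.pi_pos]
  rw [h6] at h5
  have h7 := congrArg norm h1
  rw [norm_mul, norm_mul, Complex.norm_I, mul_one, Complex.norm_real, Real.norm_eq_abs] at h7
  rw [pow_two]
  nth_rw 1 [h7]
  rw [mul_assoc, h5]; ring

theorem norm_Gamma_one_add_le (t : ℝ) :
    ‖Complex.Gamma (1 + t * Complex.I)‖ ≤ 7 * (1 + |t|) * Real.exp (-(Real.pi / 2) * |t|) := by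
  rcases eq_or_ne t 0 with rfl | ht
  · simp
  have h := norm_Gamma_one_add_sq t ht
  have hx : 0 < Real.pi * |t| := by positivity
  have hpi := Real.pi_le_four
  have hp3 := Real.pi_lt_d2
  set x := Real.pi * |t| with hxd
  have hs : 0 < Real.sinh x := Real.sinh_pos_iff.2 hx
  have hsinh : Real.exp x * x ≤ (1 + 2 * x) * Real.sinh x := by
    rw [Real.sinh_eq]
    have h1 : 1 + 2 * x ≤ Real.exp (2 * x) := by linarith [Real.add_one_le_exp (2 * x)]
    have h2 : Real.exp (2 * x) * Real.exp (-x) = Real.exp x := by rw [← Real.exp_add]; ring_nf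
    have h3 : (1 + 2 * x) * Real.exp (-x) ≤ Real.exp x := by
      rw [← h2]; gcongr
    nlinarith
  have h2 : x / Real.sinh x ≤ (1 + 2 * x) * Real.exp (-x) := by
    rw [div_le_iff₀ hs, Real.exp_neg]
    have := Real.exp_pos x
    field_simp
    linarith
  refine le_of_sq_le_sq ?_ (by positivity)
  rw [h]
  refine h2.trans ?_
  have e : (7 * (1 + |t|) * Real.exp (-(Real.pi / 2) * |t|)) ^ 2 =
      (7 * (1 + |t|)) ^ 2 * Real.exp (-x) := by
    rw [mul_pow, ← Real.exp_nat_mul]; congr 2; push_cast; rw [hxd]; ring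
  rw [e]
  gcongr
  have : |t| > 0 := by positivity
  nlinarith

theorem le_norm_Gamma_one_add (t : ℝ) :
    Real.exp (-(Real.pi / 2) * |t|) ≤ ‖Complex.Gamma (1 + t * Complex.I)‖ := by
  rcases eq_or_ne t 0 with rfl | ht
  · simp
  have h := norm_Gamma_one_add_sq t ht
  have hx : 0 < Real.pi * |t| := by positivity
  set x := Real.pi * |t| with hxd
  have hs : 0 < Real.sinh x := Real.sinh_pos_iff.2 hx
  refine le_of_sq_le_sq ?_ (by positivity)
  have e : Real.exp (-(Real.pi / 2) * |t|) ^ 2 = Real.exp (-x) := by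
    rw [← Real.exp_nat_mul]; congr 1; push_cast; rw [hxd]; ring
  rw [h, e, le_div_iff₀ hs, Real.sinh_eq]
  have h1 : 1 - 2 * x ≤ Real.exp (-(2 * x)) := by linarith [Real.add_one_le_exp (-(2 * x))]
  have h2 : Real.exp (-x) * Real.exp x = 1 := by rw [← Real.exp_add]; simp
  have h3 : Real.exp (-x) * Real.exp (-x) = Real.exp (-(2 * x)) := by
    rw [← Real.exp_add]; ring_nf
  nlinarith

theorem norm_inv_Gamma_le_shift (s : ℂ) (k : ℕ) :
    ‖(Complex.Gamma s)⁻¹‖ ≤ (‖s‖ + k) ^ k * ‖(Complex.Gamma (s + k))⁻¹‖ := by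
  have : ∀ j : ℕ, j ≤ k →
      ‖(Complex.Gamma s)⁻¹‖ ≤ (‖s‖ + k) ^ j * ‖(Complex.Gamma (s + j))⁻¹‖ := by
    intro j
    induction j with
    | zero => simp
    | succ j ih =>
      intro hj
      refine (ih (by omega)).trans ?_
      have := Complex.one_div_Gamma_eq_self_mul_one_div_Gamma_add_one (s + j)
      rw [this, norm_mul, pow_succ, ← mul_assoc]
      have e : s + j + 1 = s + ((j + 1 : ℕ) : ℂ) := by push_cast; ring
      rw [e]
      gcongr
      refine (norm_add_le _ _).trans ?_
      simp only [Complex.norm_natCast]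
      gcongr; omega
  exact this k le_rfl

theorem norm_Gamma_le_shift {s : ℂ} (hs : 0 < s.re) (k : ℕ) :
    ‖Complex.Gamma (s + k)‖ ≤ (‖s‖ + k) ^ k * ‖Complex.Gamma s‖ := by
  have : ∀ j : ℕ, j ≤ k →
      ‖Complex.Gamma (s + j)‖ ≤ (‖s‖ + k) ^ j * ‖Complex.Gamma s‖ := by
    intro j
    induction j with
    | zero => simp
    | succ j ih =>
      intro hj
      have e : s + ((j + 1 : ℕ) : ℂ) = s + j + 1 := by push_cast; ring
      have hne : s + j ≠ 0 := by
        intro h0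
        have := congrArg Complex.re h0
        simp at this
        have : (0:ℝ) ≤ j := by positivity
        linarith
      rw [e, Complex.Gamma_add_one _ hne, norm_mul, pow_succ']
      rw [mul_assoc]
      gcongr
      · refine (norm_add_le _ _).trans ?_
        simp only [Complex.norm_natCast]
        gcongr; omega
      · exact ih (by omega)
  exact this k le_rfl

theorem le_Gamma_real {σ ρ : ℝ} (hσ : 1 ≤ σ) (hρ : 0 < ρ) :
    Real.exp ((σ - 1) * Real.log ρ - ρ - 1) ≤ Real.Gamma σ := by
  rw [Real.Gamma_eq_integral (by linarith)]
  have hint := Real.GammaIntegral_convergent (s := σ) (by linarith)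
  have hsub : Set.Ioc ρ (ρ + 1) ⊆ Set.Ioi 0 := fun x hx => hρ.trans hx.1
  calc Real.exp ((σ - 1) * Real.log ρ - ρ - 1)
      = ∫ x in Set.Ioc ρ (ρ + 1), Real.exp ((σ - 1) * Real.log ρ - ρ - 1) := by simp
    _ ≤ ∫ x in Set.Ioc ρ (ρ + 1), Real.exp (-x) * x ^ (σ - 1) := by
        refine setIntegral_mono_on (by simp) (hint.mono_set hsub) measurableSet_Ioc ?_
        intro x hx
        have hx0 : 0 < x := hρ.trans hx.1
        rw [Real.rpow_def_of_pos hx0, ← Real.exp_add]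
        refine Real.exp_le_exp.2 ?_
        have : Real.log ρ ≤ Real.log x := Real.log_le_log hρ hx.1.le
        nlinarith [hx.2, mul_le_mul_of_nonneg_left this (by linarith : 0 ≤ σ - 1)]
    _ ≤ _ := by
        refine setIntegral_mono_set hint ?_ (Filter.Eventually.of_forall hsub)
        filter_upwards [ae_restrict_mem measurableSet_Ioi] with x hx
        have : 0 < x := hx
        positivity

theorem le_norm_Gamma {s : ℂ} (hs : 1 ≤ s.re) {ρ : ℝ} (hρ : 0 < ρ) :
    Real.exp ((s.re - 1) * Real.log ρ - ρ - 1 - Real.pi / 2 * |s.im|) ≤ ‖Complex.Gamma s‖ := by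
  have h1 := le_Gamma_real hs hρ
  have h2 := le_norm_Gamma_one_add s.im
  have h3 : Real.Gamma s.re * ‖Complex.Gamma (1 + s.im * Complex.I)‖ ≤ ‖Complex.Gamma s‖ := by
    rcases hs.eq_or_lt with h | h
    · have : s = 1 + s.im * Complex.I := by apply Complex.ext <;> simp [← h]
      rw [← this, ← h]; simp
    · have := norm_Gamma_mul_le (s := 1 + s.im * Complex.I) (by simp) (b := s.re - 1) (by linarith)
      have e : 1 + s.im * Complex.I + ((s.re - 1 : ℝ) : ℂ) = s := by apply Complex.ext <;> simp
      rw [e] at this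
      simp at this
      linarith
  refine le_trans ?_ h3
  have : Real.exp ((s.re - 1) * Real.log ρ - ρ - 1 - Real.pi / 2 * |s.im|) =
      Real.exp ((s.re - 1) * Real.log ρ - ρ - 1) * Real.exp (-(Real.pi / 2) * |s.im|) := by
    rw [← Real.exp_add]; ring_nf
  rw [this]
  gcongr

theorem exists_norm_Gamma_le_strip {δ : ℝ} (hδ : 0 < δ) (A : ℝ) : ∃ C : ℝ, ∃ M : ℕ, 1 ≤ C ∧
    ∀ s : ℂ, δ ≤ s.re → s.re ≤ A →
      ‖Complex.Gamma s‖ ≤ C * (1 + |s.im|) ^ M * Real.exp (-(Real.pi / 2) * |s.im|) := by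
  obtain ⟨n, hn⟩ := exists_nat_ge A
  have hcont : ContinuousOn Real.Gamma (Set.Icc δ A) := by
    intro x hx
    refine (Real.differentiableAt_Gamma ?_).continuousAt.continuousWithinAt
    intro m
    have : (0:ℝ) ≤ m := by positivity
    linarith [hx.1]
  obtain ⟨B, hB⟩ := isCompact_Icc.bddAbove_image hcont
  refine ⟨max 1 (B * (7 * (1 + n) ^ n)), n + 1, le_max_left _ _, fun s h1 h2 => ?_⟩
  have hB' : Real.Gamma s.re ≤ B := hB ⟨s.re, ⟨h1, h2⟩, rfl⟩
  have hs : 0 < s.re := by linarith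
  have hg := Real.Gamma_pos_of_pos hs
  have hm := norm_Gamma_mul_le hs (b := n + 1 - s.re) (by linarith)
  have e1 : s.re + (n + 1 - s.re) = (n:ℝ) + 1 := by ring
  have e2 : s + ((n + 1 - s.re : ℝ) : ℂ) = (1 + s.im * Complex.I) + (n : ℂ) := by
    apply Complex.ext <;> simp; ring
  rw [e1, e2, Real.Gamma_nat_eq_factorial] at hm
  have hf : (1 : ℝ) ≤ (n.factorial : ℝ) := by exact_mod_cast Nat.one_le_iff_ne_zero.2 n.factorial_ne_zero
  have h3 : ‖Complex.Gamma s‖ ≤ ‖Complex.Gamma (1 + s.im * Complex.I + n)‖ * Real.Gamma s.re := by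
    refine le_trans ?_ hm
    exact le_mul_of_one_le_right (norm_nonneg _) hf
  have h4 := norm_Gamma_le_shift (s := 1 + s.im * Complex.I) (by simp) n
  have h5 := norm_Gamma_one_add_le s.im
  have h6 : ‖(1 : ℂ) + s.im * Complex.I‖ ≤ 1 + |s.im| := by
    refine (norm_add_le _ _).trans ?_; simp
  have h7 : ‖(1 : ℂ) + s.im * Complex.I‖ + n ≤ (1 + n) * (1 + |s.im|) := by
    have : (0:ℝ) ≤ n := by positivity
    nlinarith [abs_nonneg s.im]
  calc ‖Complex.Gamma s‖ ≤ _ := h3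
    _ ≤ ((((1 + n) * (1 + |s.im|)) ^ n) * (7 * (1 + |s.im|) * Real.exp (-(Real.pi / 2) * |s.im|))) * B := by
        gcongr
        exact h4.trans (by gcongr)
    _ = (B * (7 * (1 + n) ^ n)) * (1 + |s.im|) ^ (n + 1) * Real.exp (-(Real.pi / 2) * |s.im|) := by
        rw [mul_pow]; ring
    _ ≤ _ := by gcongr; exact le_max_right _ _

theorem exists_norm_inv_Gamma_le_strip (A : ℝ) : ∃ C : ℝ, ∃ M : ℕ, 1 ≤ C ∧
    ∀ s : ℂ, |s.re| ≤ A →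
      ‖(Complex.Gamma s)⁻¹‖ ≤ C * (1 + |s.im|) ^ M * Real.exp (Real.pi / 2 * |s.im|) := by
  obtain ⟨k, hk⟩ := exists_nat_ge (A + 1)
  refine ⟨max 1 ((|A| + 1 + k) ^ k * Real.exp 2), k, le_max_left _ _, fun s hs => ?_⟩
  have h0 := abs_le.1 hs
  have h1 := norm_inv_Gamma_le_shift s k
  have h2 := le_norm_Gamma (s := s + k) (by simp; linarith) one_pos
  have h3 : ‖(Complex.Gamma (s + k))⁻¹‖ ≤ Real.exp 2 * Real.exp (Real.pi / 2 * |s.im|) := by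
    rw [norm_inv, ← Real.exp_add]
    refine inv_le_of_inv_le₀ (by positivity) ?_
    rw [← Real.exp_neg]
    refine le_trans (Real.exp_le_exp.2 ?_) h2
    simp; linarith
  have h4 : ‖s‖ + k ≤ (|A| + 1 + k) * (1 + |s.im|) := by
    have := Complex.norm_le_abs_re_add_abs_im s
    have hk0 : (0:ℝ) ≤ k := by positivity
    nlinarith [abs_nonneg s.im, abs_nonneg A, le_abs_self A]
  calc _ ≤ _ := h1
    _ ≤ ((|A| + 1 + k) * (1 + |s.im|)) ^ k * (Real.exp 2 * Real.exp (Real.pi / 2 * |s.im|)) := by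
        gcongr
    _ = ((|A| + 1 + k) ^ k * Real.exp 2) * (1 + |s.im|) ^ k * Real.exp (Real.pi / 2 * |s.im|) := by
        rw [mul_pow]; ring
    _ ≤ _ := by gcongr; exact le_max_right _ _

theorem exists_norm_inv_Gamma_le {K : ℝ} (hK : 0 ≤ K) : ∃ C : ℝ, 0 ≤ C ∧ ∀ ρ : ℝ, 2 ≤ ρ → ∀ s : ℂ,
    ‖s‖ ≤ K * ρ → ‖(Complex.Gamma s)⁻¹‖ ≤ Real.exp (-s.re * Real.log ρ + C * ρ) := by
  refine ⟨1 + (1 + K) * Real.log (2 * K + 1) + 2 + Real.pi / 2 * K, ?_, fun ρ hρ s hs => ?_⟩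
  · have := Real.log_nonneg (by linarith : 1 ≤ 2 * K + 1)
    have := Real.pi_pos
    positivity
  have hρ0 : 0 < ρ := by linarith
  set k := ⌈max 0 (1 - s.re)⌉₊ with hkd
  have hk1 : 1 - s.re ≤ k := (le_max_right _ _).trans (Nat.le_ceil _)
  have hre := (Complex.abs_re_le_norm s).trans hs
  have him := (Complex.abs_im_le_norm s).trans hs
  have hk2 : (k : ℝ) ≤ 2 + K * ρ := by
    have h1 := Nat.ceil_lt_add_one (le_max_left 0 (1 - s.re))
    have h2 : max 0 (1 - s.re) ≤ 1 + K * ρ := by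
      refine max_le (by positivity) ?_
      linarith [neg_abs_le s.re]
    rw [← hkd] at h1; linarith
  have h1 := norm_inv_Gamma_le_shift s k
  have h2 := le_norm_Gamma (s := s + k) (by simp; linarith) hρ0
  simp only [Complex.add_re, Complex.natCast_re, Complex.add_im, Complex.natCast_im, add_zero] at h2
  have h3 : ‖(Complex.Gamma (s + k))⁻¹‖ ≤
      Real.exp (-((s.re + k - 1) * Real.log ρ - ρ - 1 - Real.pi / 2 * |s.im|)) := by
    rw [norm_inv, Real.exp_neg]
    exact inv_anti₀ (Real.exp_pos _) h2
  have h4 : ‖s‖ + k ≤ (2 * K + 1) * ρ := by linarith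
  have h5 : (‖s‖ + k) ^ k ≤ Real.exp (k * (Real.log (2 * K + 1) + Real.log ρ)) := by
    rw [← Real.log_mul (by positivity) (by positivity), Real.exp_nat_mul, Real.exp_log (by positivity)]
    gcongr
  refine h1.trans ((mul_le_mul h5 h3 (norm_nonneg _) (Real.exp_pos _).le).trans ?_)
  rw [← Real.exp_add]
  refine Real.exp_le_exp.2 ?_
  have l1 : Real.log ρ ≤ ρ := (Real.log_le_sub_one_of_pos hρ0).trans (by linarith)
  have l2 : 0 ≤ Real.log (2 * K + 1) := Real.log_nonneg (by linarith)
  have l3 : (k : ℝ) * Real.log (2 * K + 1) ≤ (2 + K * ρ) * Real.log (2 * K + 1) := by gcongr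
  have l4 : Real.pi / 2 * |s.im| ≤ Real.pi / 2 * (K * ρ) := by
    have := Real.pi_pos; gcongr
  nlinarith [mul_nonneg l2 (by linarith : 0 ≤ ρ - 2)]

theorem le_norm_sin (z : ℂ) : |z.im| ≤ ‖Complex.sin z‖ := by
  have h1 : |z.im| ≤ |Real.sinh z.im| := by
    rw [Real.abs_sinh]; exact Real.self_le_sinh_iff.2 (abs_nonneg _)
  refine h1.trans ?_
  refine abs_le_of_sq_le_sq ?_ (norm_nonneg _)
  rw [← Complex.normSq_eq_norm_sq, Complex.normSq_apply]
  have e : Complex.sin z = (Real.sin z.re * Real.cosh z.im : ℝ) + (Real.cos z.re * Real.sinh z.im : ℝ) * Complex.I := by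
    rw [Complex.sin_eq]; push_cast; ring
  rw [e]
  simp only [Complex.add_re, Complex.ofReal_re, Complex.mul_re, Complex.I_re, Complex.ofReal_im,
    Complex.I_im, Complex.add_im, Complex.mul_im]
  have := Real.cosh_sq z.im
  have := Real.sin_sq_add_cos_sq z.re
  nlinarith [sq_nonneg (Real.sin z.re)]

theorem exists_norm_Gamma_le {K δ : ℝ} (hK : 0 ≤ K) (hδ : 0 < δ) : ∃ C : ℝ, 0 ≤ C ∧ ∀ ρ : ℝ, 2 ≤ ρ →
    ∀ s : ℂ, ‖s‖ ≤ K * ρ → (δ ≤ s.re ∨ δ ≤ |s.im|) →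
      ‖Complex.Gamma s‖ ≤ Real.exp (s.re * Real.log ρ + C * ρ) := by
  obtain ⟨C, hC0, hC⟩ := exists_norm_inv_Gamma_le (K := K + 1) (by linarith)
  have claim : ∀ d : ℝ, 0 < d → ∀ ρ : ℝ, 2 ≤ ρ → ∀ s : ℂ, ‖s‖ ≤ (K + 1 / 2) * ρ → d ≤ |s.im| →
      ‖Complex.Gamma s‖ ≤ d⁻¹ * Real.exp (s.re * Real.log ρ + C * ρ) := by
    intro d hd ρ hρ s hs him
    have hpi := Real.pi_pos
    have h1 := congrArg norm (Complex.Gamma_mul_Gamma_one_sub s)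
    have h2 := hC ρ hρ (1 - s) (by
      refine (norm_sub_le _ _).trans ?_
      rw [norm_one]; linarith)
    have h3 : Complex.Gamma (1 - s) ≠ 0 := by
      refine Complex.Gamma_ne_zero ?_
      intro m hm
      have := congrArg Complex.im hm
      simp at this
      rw [this] at him; simp at him; linarith
    have h4 : Real.pi * d ≤ ‖Complex.sin (Real.pi * s)‖ := by
      refine le_trans ?_ (le_norm_sin _)
      simp only [Complex.im_ofReal_mul, abs_mul, abs_of_pos hpi]
      gcongr
    rw [norm_mul, norm_div, Complex.norm_real, Real.norm_of_nonneg hpi.le] at h1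
    have h5 : ‖Complex.Gamma s‖ = Real.pi / ‖Complex.sin (Real.pi * s)‖ * ‖(Complex.Gamma (1 - s))⁻¹‖ := by
      rw [← h1, norm_inv, mul_assoc, mul_inv_cancel₀ (norm_ne_zero_iff.2 h3), mul_one]
    rw [h5]
    have h6 : Real.pi / ‖Complex.sin (Real.pi * s)‖ ≤ d⁻¹ := by
      rw [div_le_iff₀ (lt_of_lt_of_le (by positivity) h4)]
      calc Real.pi = d⁻¹ * (Real.pi * d) := by field_simp
        _ ≤ _ := by gcongr
    gcongr
    refine h2.trans (Real.exp_le_exp.2 ?_)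
    simp
    have := Real.log_nonneg (by linarith : 1 ≤ ρ)
    linarith
  have hGd : Complex.Gamma (δ + Complex.I) ≠ 0 := Complex.Gamma_ne_zero_of_re_pos (by simpa)
  set D := Real.Gamma δ / ‖Complex.Gamma (δ + Complex.I)‖ with hD
  have hDpos : 0 < D := by
    have := Real.Gamma_pos_of_pos hδ
    have := norm_pos_iff.2 hGd
    positivity
  refine ⟨C + |Real.log δ⁻¹| + |Real.log D|, by positivity, fun ρ hρ s hs hor => ?_⟩
  by_cases him : δ ≤ |s.im|
  · refine (claim δ hδ ρ hρ s (hs.trans (by linarith)) him).trans ?_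
    rw [← Real.exp_log (inv_pos.2 hδ), ← Real.exp_add]
    refine Real.exp_le_exp.2 ?_
    rw [Real.exp_log (inv_pos.2 hδ)]
    nlinarith [le_abs_self (Real.log δ⁻¹), abs_nonneg (Real.log δ⁻¹), abs_nonneg (Real.log D)]
  · have hre : δ ≤ s.re := by tauto
    have hs0 : 0 < s.re := by linarith
    have h1 : ‖Complex.Gamma s‖ ≤ Real.Gamma s.re := by
      have := Complex.Gamma_eq_integral hs0
      rw [this, Real.Gamma_eq_integral hs0, Complex.GammaIntegral]
      refine (norm_integral_le_integral_norm _).trans_eq ?_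
      refine setIntegral_congr_fun measurableSet_Ioi fun x hx => ?_
      have hx' : 0 < x := hx
      simp only [norm_mul, Complex.norm_cpow_eq_rpow_re_of_pos hx', Complex.sub_re, Complex.one_re]
      rw [Complex.norm_real, Real.norm_of_nonneg (Real.exp_pos _).le]
    have h2 : Real.Gamma s.re ≤ D * ‖Complex.Gamma (s.re + Complex.I)‖ := by
      rcases hre.eq_or_lt with h | h
      · rw [← h, hD, div_mul_cancel₀ _ (norm_ne_zero_iff.2 hGd)]
      · have := norm_Gamma_mul_le (s := δ + Complex.I) (by simpa) (b := s.re - δ) (by linarith)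
        have e : (δ : ℂ) + Complex.I + ((s.re - δ : ℝ) : ℂ) = s.re + Complex.I := by push_cast; ring
        rw [e] at this
        simp at this
        rw [hD, div_mul_eq_mul_div, le_div_iff₀ (norm_pos_iff.2 hGd)]
        linarith
    have h3 := claim 1 one_pos ρ hρ (s.re + Complex.I) (by
      refine (norm_add_le _ _).trans ?_
      have := Complex.abs_re_le_norm s
      simp
      linarith) (by simp)
    refine (h1.trans h2).trans ?_
    refine (mul_le_mul_of_nonneg_left h3 hDpos.le).trans ?_
    rw [inv_one, one_mul]
    nth_rw 1 [← Real.exp_log hDpos]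
    rw [← Real.exp_add]
    refine Real.exp_le_exp.2 ?_
    simp
    nlinarith [le_abs_self (Real.log D), abs_nonneg (Real.log δ), abs_nonneg (Real.log D)]

theorem inv_Gamma_mul_inv_Gamma_neg (s : ℂ) :
    (Complex.Gamma s)⁻¹ * (Complex.Gamma (-s))⁻¹ = -s * Complex.sin (Real.pi * s) / Real.pi := by
  rcases eq_or_ne s 0 with rfl | hs
  · simp
  have h1 := Complex.Gamma_mul_Gamma_one_sub s
  have h2 := Complex.Gamma_add_one (-s) (by simpa)
  have e : 1 - s = -s + 1 := by ring
  rw [e, h2] at h1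
  have h3 := congrArg Inv.inv h1
  rw [inv_div] at h3
  rw [mul_div_assoc, ← h3, mul_inv, mul_inv]
  field_simp

theorem Gamma_mul_sin {s : ℂ} (hs : 0 < s.re ∨ s.im ≠ 0) :
    Complex.Gamma s * Complex.sin (Real.pi * s) = Real.pi * (Complex.Gamma (1 - s))⁻¹ := by
  have h1 := Complex.Gamma_mul_Gamma_one_sub s
  have hG : Complex.Gamma s ≠ 0 := by
    refine Complex.Gamma_ne_zero fun m hm => ?_
    rcases hs with h | h
    · rw [hm] at h; simp at h; have : (0:ℝ) ≤ m := by positivity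
      linarith
    · rw [hm] at h; simp at h
  by_cases hsin : Complex.sin (Real.pi * s) = 0
  · rw [hsin, div_zero] at h1
    have : Complex.Gamma (1 - s) = 0 := by
      rcases mul_eq_zero.1 h1 with h | h
      · exact absurd h hG
      · exact h
    rw [hsin, this]; simp
  · have h3 : Complex.Gamma (1 - s) ≠ 0 := by
      intro h0
      rw [h0, mul_zero, eq_comm, div_eq_zero_iff] at h1
      rcases h1 with h | h
      · exact Real.pi_ne_zero (by exact_mod_cast h)
      · exact hsin h
    field_simp
    rw [eq_div_iff hsin] at h1
    linear_combination h1

theorem abs_sub_eq_integral (s t : ℝ) :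
    Integrable (fun τ : ℝ => ((if τ < s then (1:ℝ) else 0) - if τ < t then 1 else 0) ^ 2) ∧
    |s - t| = ∫ τ : ℝ, ((if τ < s then (1:ℝ) else 0) - if τ < t then 1 else 0) ^ 2 := by
  have e : (fun τ : ℝ => ((if τ < s then (1:ℝ) else 0) - if τ < t then 1 else 0) ^ 2) =
      (Set.Ico (min s t) (max s t)).indicator (fun _ => (1:ℝ)) := by
    funext τ
    rw [Set.indicator_apply]
    simp only [Set.mem_Ico, min_le_iff, lt_max_iff]
    by_cases h1 : τ < s <;> by_cases h2 : τ < t <;> simp [h1, h2, not_le.2, not_lt.1]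
  rw [e]
  refine ⟨(integrable_indicator_iff measurableSet_Ico).2 (by simp), ?_⟩
  rw [integral_indicator measurableSet_Ico]
  simp [max_sub_min_eq_abs']

theorem sum_sum_sq {ι κ : Type*} [Fintype ι] [Fintype κ] (f : ι → ℝ) (g : κ → ℝ)
    (hf : ∀ i, f i ^ 2 = f i) (hg : ∀ i, g i ^ 2 = g i) :
    ∑ i, ∑ j, (f i - g j) ^ 2 = Fintype.card κ * (∑ i, f i) + Fintype.card ι * (∑ j, g j) -
      2 * (∑ i, f i) * ∑ j, g j := by
  have : ∀ i j, (f i - g j) ^ 2 = f i + g j - 2 * (f i * g j) := by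
    intro i j; rw [sub_sq, hf, hg]; ring
  simp only [this, Finset.sum_sub_distrib, Finset.sum_add_distrib, Finset.sum_const,
    Finset.card_univ, nsmul_eq_mul, ← Finset.mul_sum]
  rw [← Finset.sum_mul]
  ring

theorem sum_abs_sub_eq_integral {α β : Type*} [Fintype α] [Fintype β] (p : α → ℝ) (q : β → ℝ) :
    Integrable (fun τ : ℝ => ∑ i, ∑ j, ((if τ < p i then (1:ℝ) else 0) - if τ < q j then 1 else 0) ^ 2) ∧
    ∑ i, ∑ j, |p i - q j| =
      ∫ τ : ℝ, ∑ i, ∑ j, ((if τ < p i then (1:ℝ) else 0) - if τ < q j then 1 else 0) ^ 2 := by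
  refine ⟨integrable_finsetSum _ fun i _ => integrable_finsetSum _ fun j _ =>
    (abs_sub_eq_integral _ _).1, ?_⟩
  rw [integral_finsetSum _ fun i _ => integrable_finsetSum _ fun j _ =>
    (abs_sub_eq_integral _ _).1]
  refine Finset.sum_congr rfl fun i _ => ?_
  rw [integral_finsetSum _ fun j _ => (abs_sub_eq_integral _ _).1]
  exact Finset.sum_congr rfl fun j _ => (abs_sub_eq_integral _ _).2

theorem sum_abs_sub_interlace {ι κ : Type*} [Fintype ι] [Fintype κ]
    (hc : Fintype.card κ = Fintype.card ι + 1) (p : ι → ℝ) (y : κ → ℝ) :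
    ∑ i, ∑ j, |p i - p j| + ∑ a, ∑ b, |y a - y b| ≤ 2 * ∑ i, ∑ b, |p i - y b| := by
  obtain ⟨i1, e1⟩ := sum_abs_sub_eq_integral p p
  obtain ⟨i2, e2⟩ := sum_abs_sub_eq_integral y y
  obtain ⟨i3, e3⟩ := sum_abs_sub_eq_integral p y
  rw [e1, e2, e3, ← integral_add i1 i2, ← integral_const_mul]
  refine integral_mono (i1.add i2) (i3.const_mul _) fun τ => ?_
  have hsq : ∀ s : ℝ, (if τ < s then (1:ℝ) else 0) ^ 2 = if τ < s then 1 else 0 := by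
    intro s; split_ifs <;> simp
  simp only
  rw [sum_sum_sq _ _ (fun i => hsq (p i)) (fun i => hsq (p i)),
    sum_sum_sq _ _ (fun i => hsq (y i)) (fun i => hsq (y i)),
    sum_sum_sq _ _ (fun i => hsq (p i)) (fun i => hsq (y i)), hc]
  obtain ⟨A, hA⟩ : ∃ A : ℤ, ∑ i, (if τ < p i then (1:ℝ) else 0) = A :=
    ⟨∑ i, (if τ < p i then (1:ℤ) else 0), by push_cast; rfl⟩
  obtain ⟨B, hB⟩ : ∃ B : ℤ, ∑ i, (if τ < y i then (1:ℝ) else 0) = B :=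
    ⟨∑ i, (if τ < y i then (1:ℤ) else 0), by push_cast; rfl⟩
  rw [hA, hB]
  have h : 0 ≤ (A - B) * (A - B + 1) := by
    rcases le_or_gt 0 (A - B) with h | h
    · positivity
    · nlinarith
  have h' : (0:ℝ) ≤ (A - B) * (A - B + 1) := by exact_mod_cast h
  push_cast
  nlinarith

theorem sum_abs_sub_interlace_excess {ι κ : Type*} [Fintype ι] [Fintype κ]
    (hc : Fintype.card κ = Fintype.card ι + 1) (p : ι → ℝ) (y : κ → ℝ) {A : ℝ}
    (hA : ∀ b, |y b| ≤ A) :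
    ∑ i, ∑ j, |p i - p j| + ∑ a, ∑ b, |y a - y b| + 4 * ∑ i, max 0 (|p i| - A) ≤
      2 * ∑ i, ∑ b, |p i - y b| := by
  classical
  obtain ⟨b0⟩ : Nonempty κ := Fintype.card_pos_iff.1 (by omega)
  have hA0 : 0 ≤ A := (abs_nonneg _).trans (hA b0)
  set q : ι → ℝ := fun i => max (-A) (min A (p i)) with hq
  set e : ι → ℝ := fun i => max 0 (|p i| - A) with he
  have hpq : ∀ i, |p i - q i| ≤ e i := by
    intro i
    simp only [hq, he]
    rcases max_cases 0 (|p i| - A) with h | h <;> rcases max_cases (-A) (min A (p i)) with h' | h' <;>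
    rcases min_cases A (p i) with h'' | h'' <;> rcases abs_cases (p i) with h3 | h3 <;>
    rcases abs_cases (p i - max (-A) (min A (p i))) with h4 | h4 <;> linarith
  have h1 : ∀ i b, |q i - y b| + e i ≤ |p i - y b| := by
    intro i b
    have := abs_le.1 (hA b)
    simp only [hq, he]
    rcases max_cases 0 (|p i| - A) with h | h <;> rcases max_cases (-A) (min A (p i)) with h' | h' <;>
    rcases min_cases A (p i) with h'' | h'' <;> rcases abs_cases (p i) with h3 | h3 <;>
    rcases abs_cases (p i - y b) with h4 | h4 <;>
    rcases abs_cases (max (-A) (min A (p i)) - y b) with h5 | h5 <;> linarith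
  have h2 : ∀ i j, |p i - p j| ≤ |q i - q j| + e i + e j - if i = j then 2 * e i else 0 := by
    intro i j
    split_ifs with h
    · subst h; simp; try linarith
    · have := abs_add_three (p i - q i) (q i - q j) (q j - p j)
      have h3 := hpq i
      have h4 := hpq j
      rw [abs_sub_comm] at h4
      have e3 : p i - q i + (q i - q j) + (q j - p j) = p i - p j := by ring
      rw [e3] at this
      linarith
  have h3 := sum_abs_sub_interlace hc q y
  have h4 : ∑ i, ∑ b, |q i - y b| + (Fintype.card ι + 1) * ∑ i, e i ≤ ∑ i, ∑ b, |p i - y b| := by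
    have := Finset.sum_le_sum fun i (_ : i ∈ Finset.univ) =>
      Finset.sum_le_sum fun b (_ : b ∈ Finset.univ) => h1 i b
    simp only [Finset.sum_add_distrib, Finset.sum_const, Finset.card_univ, nsmul_eq_mul, hc,
      ← Finset.mul_sum] at this
    push_cast at this
    linarith
  have h5 : ∑ i, ∑ j, |p i - p j| ≤ ∑ i, ∑ j, |q i - q j| + (2 * Fintype.card ι - 2) * ∑ i, e i := by
    have := Finset.sum_le_sum fun i (_ : i ∈ Finset.univ) =>
      Finset.sum_le_sum fun b (_ : b ∈ Finset.univ) => h2 i b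
    simp only [Finset.sum_add_distrib, Finset.sum_sub_distrib, Finset.sum_const, Finset.card_univ,
      nsmul_eq_mul, ← Finset.mul_sum, Finset.sum_ite_eq, Finset.mem_univ, if_true] at this
    linarith
  linarith

theorem sum_Ioi_eq_half {N : ℕ} (f : Fin N → Fin N → ℝ) (hs : ∀ a b, f a b = f b a)
    (hd : ∀ a, f a a = 0) : ∑ a, ∑ b ∈ Finset.Ioi a, f a b = (∑ a, ∑ b, f a b) / 2 := by
  have h1 : ∑ a, ∑ b ∈ Finset.Ioi a, f a b = ∑ a, ∑ b, if a < b then f a b else 0 := by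
    refine Finset.sum_congr rfl fun a _ => ?_
    rw [← Finset.sum_filter]
    congr 1; ext; simp
  have h2 : ∑ a, ∑ b ∈ Finset.Ioi a, f a b = ∑ a, ∑ b, if b < a then f a b else 0 := by
    rw [h1, Finset.sum_comm]
    exact Finset.sum_congr rfl fun a _ => Finset.sum_congr rfl fun b _ => by rw [hs b a]
  have h3 : ∑ a, ∑ b, f a b = ∑ a, ∑ b, (if a < b then f a b else 0) + ∑ a, ∑ b, if b < a then f a b else 0 := by
    simp only [← Finset.sum_add_distrib]
    refine Finset.sum_congr rfl fun a _ => Finset.sum_congr rfl fun b _ => ?_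
    rcases lt_trichotomy a b with h | h | h
    · simp [h, h.le]
    · subst h; simp [hd]
    · simp [h, h.le]
  rw [h3, ← h1, ← h2]; ring

theorem differentiableOn_integral {E T : Type*} [NormedAddCommGroup E] [NormedSpace ℂ E]
    [FiniteDimensional ℂ E] [MeasurableSpace T] {μ : Measure T} {f : E → T → ℂ} {U : Set E}
    (hU : IsOpen U) (hf : ∀ t, DifferentiableOn ℂ (fun e => f e t) U)
    (hm : ∀ e ∈ U, AEStronglyMeasurable (f e) μ)
    (hb : ∀ e₀ ∈ U, ∃ g : T → ℝ, Integrable g μ ∧ ∀ᶠ e in 𝓝 e₀, ∀ t, ‖f e t‖ ≤ g t) :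
    DifferentiableOn ℂ (fun e => ∫ t, f e t ∂μ) U := by
  intro e₀ he₀
  obtain ⟨g, hg, hev⟩ := hb e₀ he₀
  obtain ⟨r, hr, hball⟩ := Metric.eventually_nhds_iff_ball.1 (hev.and (hU.mem_nhds he₀))
  have hfd : ∀ t, HasFDerivAt (fun e => f e t) (fderiv ℂ (fun e => f e t) e₀) e₀ := fun t =>
    ((hf t).differentiableAt (hU.mem_nhds he₀)).hasFDerivAt
  have hmeas : AEStronglyMeasurable (fun t => fderiv ℂ (fun e => f e t) e₀) μ := by
    have hv : ∀ v : E, AEStronglyMeasurable (fun t => fderiv ℂ (fun e => f e t) e₀ v) μ := by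
      intro v
      have hlim : ∀ t, Tendsto (fun n : ℕ => ((n : ℂ) + 1) * (f (e₀ + ((n : ℂ) + 1)⁻¹ • v) t - f e₀ t)) atTop
          (𝓝 (fderiv ℂ (fun e => f e t) e₀ v)) := by
        intro t
        have h1 := (hfd t).lim v (c := fun n : ℕ => ((n : ℂ) + 1)) (l := atTop)
        have hn : Tendsto (fun n : ℕ => ‖((n : ℂ) + 1)‖) atTop atTop := by
          have : ∀ n : ℕ, ‖((n : ℂ) + 1)‖ = (n : ℝ) + 1 := fun n => by
            have := Complex.norm_natCast (n + 1); push_cast at this; exact this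
          simp only [this]
          exact tendsto_atTop_add_const_right _ _ tendsto_natCast_atTop_atTop
        have := h1 hn
        simpa using this
      have hmem : ∀ᶠ n : ℕ in atTop, e₀ + ((n : ℂ) + 1)⁻¹ • v ∈ U := by
        have : Tendsto (fun n : ℕ => e₀ + ((n : ℂ) + 1)⁻¹ • v) atTop (𝓝 (e₀ + (0:ℂ) • v)) := by
          refine tendsto_const_nhds.add (Tendsto.smul_const ?_ _)
          have := tendsto_one_div_add_atTop_nhds_zero_nat (𝕜 := ℂ)
          simpa using this
        rw [zero_smul, add_zero] at this
        exact this.eventually (hU.mem_nhds he₀)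
      obtain ⟨n0, hn0⟩ := eventually_atTop.1 hmem
      refine aestronglyMeasurable_of_tendsto_ae (u := atTop)
        (f := fun (n : ℕ) t => (((n + n0 : ℕ) : ℂ) + 1) * (f (e₀ + (((n + n0 : ℕ) : ℂ) + 1)⁻¹ • v) t - f e₀ t)) ?_ ?_
      · intro n
        exact ((hm _ (hn0 _ (by omega))).sub (hm _ he₀)).const_mul _
      · exact Eventually.of_forall fun t => (hlim t).comp (tendsto_add_atTop_nat n0)
    let b := Module.finBasis ℂ E
    have e : (fun t => fderiv ℂ (fun e => f e t) e₀) = fun t => ∑ i,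
        (fderiv ℂ (fun e => f e t) e₀ (b i)) • (LinearMap.toContinuousLinearMap (b.coord i)) := by
      funext t
      ext v
      conv_lhs => rw [← b.sum_repr v]
      rw [map_sum]
      simp [mul_comm]
    rw [e]
    have := Finset.aestronglyMeasurable_sum (μ := μ) Finset.univ (f := fun i t =>
      (fderiv ℂ (fun e => f e t) e₀ (b i)) • (LinearMap.toContinuousLinearMap (b.coord i)))
      (fun i _ => (hv (b i)).smul_const _)
    convert this using 1
    funext t; simp
  have hint : Integrable (f e₀) μ := by
    refine hg.mono' (hm _ he₀) (Eventually.of_forall fun t => ?_)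
    exact (hball e₀ (Metric.mem_ball_self hr)).1 t
  have key := hasFDerivAt_integral_of_dominated_loc_of_lip' (𝕜 := ℂ) (F := f) (x₀ := e₀)
    (bound := fun t => 4 * g t / r) (Metric.ball_mem_nhds e₀ hr)
    (fun x hx => hm x (hball x hx).2) hint hmeas ?_ ?_ (Eventually.of_forall hfd)
  · exact key.2.differentiableAt.differentiableWithinAt
  · refine Eventually.of_forall fun t x hx => ?_
    have hgt : 0 ≤ g t := (norm_nonneg _).trans ((hball e₀ (Metric.mem_ball_self hr)).1 t)
    have hd : DifferentiableOn ℂ (fun e => f e t) (Metric.ball e₀ r) :=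
      (hf t).mono fun x hx => (hball x hx).2
    have hmap : Set.MapsTo (fun e => f e t) (Metric.ball e₀ r) (Metric.closedBall (f e₀ t) (2 * g t)) := by
      intro z hz
      rw [mem_closedBall_iff_norm]
      have h1 := (hball z hz).1 t
      have h2 := (hball e₀ (Metric.mem_ball_self hr)).1 t
      exact (norm_sub_le _ _).trans (by linarith)
    have := Complex.dist_le_div_mul_dist_of_mapsTo_ball hd hmap hx
    rw [dist_eq_norm, dist_eq_norm] at this
    refine this.trans ?_
    gcongr
    linarith
  · exact (hg.const_mul 4).div_const r

/-- An integrable majorant on `ℝ^ι`. -/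
def cauchyWeight {ι : Type*} [Fintype ι] (t : ι → ℝ) : ℝ := ∏ i, (1 + t i ^ 2)⁻¹

theorem cauchyWeight_pos {ι : Type*} [Fintype ι] (t : ι → ℝ) : 0 < cauchyWeight t :=
  Finset.prod_pos fun i _ => by positivity

theorem integrable_cauchyWeight {ι : Type*} [Fintype ι] :
    Integrable (cauchyWeight : (ι → ℝ) → ℝ) :=
  Integrable.fintype_prod (f := fun (_ : ι) (x : ℝ) => (1 + x ^ 2)⁻¹)
    fun _ => integrable_inv_one_add_sq

theorem cauchyWeight_add_le {ι : Type*} [Fintype ι] (t x : ι → ℝ) :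
    cauchyWeight (t + x) ≤ (∏ i, 2 * (1 + x i ^ 2)) * cauchyWeight t := by
  rw [cauchyWeight, cauchyWeight, ← Finset.prod_mul_distrib]
  refine Finset.prod_le_prod (fun i _ => by positivity) fun i _ => ?_
  rw [Pi.add_apply, inv_le_iff_one_le_mul₀ (by positivity)]
  have : 1 + t i ^ 2 ≤ 2 * (1 + x i ^ 2) * (1 + (t i + x i) ^ 2) := by
    nlinarith [sq_nonneg (t i + 2 * x i), mul_nonneg (sq_nonneg (x i)) (sq_nonneg (t i + x i))]
  have h0 : 0 < 1 + t i ^ 2 := by positivity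
  calc (1:ℝ) = (1 + t i ^ 2) * (1 + t i ^ 2)⁻¹ := by field_simp
    _ ≤ (2 * (1 + x i ^ 2) * (1 + (t i + x i) ^ 2)) * (1 + t i ^ 2)⁻¹ := by gcongr
    _ = _ := by ring

/-- Shifting the contour `ℝ^ι` in an imaginary direction. -/
theorem integral_shift {ι : Type*} [Fintype ι] (v : ι → ℝ) {a b : ℝ} (hab : a ≤ b)
    (f : (ι → ℂ) → ℂ) (C : ℝ)
    (hd : ∀ t : ι → ℝ, ∀ τ ∈ Set.Icc a b,
      DifferentiableAt ℂ f (fun i => (t i : ℂ) + ((τ * v i : ℝ) : ℂ) * Complex.I))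
    (hb : ∀ t : ι → ℝ, ∀ τ ∈ Set.Icc a b,
      ‖f (fun i => (t i : ℂ) + ((τ * v i : ℝ) : ℂ) * Complex.I)‖ ≤ C * cauchyWeight t) :
    ∫ t : ι → ℝ, f (fun i => (t i : ℂ) + ((a * v i : ℝ) : ℂ) * Complex.I) =
      ∫ t : ι → ℝ, f (fun i => (t i : ℂ) + ((b * v i : ℝ) : ℂ) * Complex.I) := by
  set g : ℂ → (ι → ℝ) → ℂ := fun ζ t => f (fun i => (t i : ℂ) + ζ * v i) with hg
  set Φ : ℂ → ℂ := fun ζ => ∫ t, g ζ t with hΦ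
  have hval : ∀ (ζ : ℂ) t, (fun i => (t i : ℂ) + ζ * v i) =
      fun i => (((t + ζ.re • v) i : ℝ) : ℂ) + ((ζ.im * v i : ℝ) : ℂ) * Complex.I := by
    intro ζ t; funext i
    apply Complex.ext <;> simp
  have hgt : ∀ (ζ : ℂ) t, g ζ t = g (ζ.im * Complex.I) (t + ζ.re • v) := by
    intro ζ t
    simp only [hg]
    rw [hval]
    congr 1; funext i; push_cast; ring
  have hval' : ∀ τ : ℝ, ∀ t, g (τ * Complex.I) t =
      f (fun i => (t i : ℂ) + ((τ * v i : ℝ) : ℂ) * Complex.I) := by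
    intro τ t; simp only [hg]; congr 1; funext i; push_cast; ring
  have htrans : ∀ ζ, Φ ζ = Φ (ζ.im * Complex.I) := by
    intro ζ
    simp only [hΦ, hgt ζ]
    exact integral_add_right_eq_self (fun t => g (ζ.im * Complex.I) t) _
  have hgb : ∀ ζ : ℂ, ζ.im ∈ Set.Icc a b → ∀ t, ‖g ζ t‖ ≤ C * cauchyWeight (t + ζ.re • v) := by
    intro ζ hζ t
    simp only [hg]
    rw [hval]
    exact hb _ _ hζ
  have hC : 0 ≤ C := by
    have h := (norm_nonneg _).trans (hb 0 a ⟨le_rfl, hab⟩)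
    exact nonneg_of_mul_nonneg_left h (cauchyWeight_pos _)
  have hcont : ∀ ζ : ℂ, ζ.im ∈ Set.Icc a b → Continuous (g ζ) := by
    intro ζ hζ
    refine continuous_iff_continuousAt.2 fun t => ?_
    have h1 := hd (t + ζ.re • v) _ hζ
    rw [← hval] at h1
    exact h1.continuousAt.comp (f := fun t : ι → ℝ => fun i => (t i : ℂ) + ζ * v i)
      (continuous_pi fun i =>
        (Complex.continuous_ofReal.comp (continuous_apply i)).add continuous_const).continuousAt
  have hdiff : DifferentiableOn ℂ Φ (Complex.im ⁻¹' Set.Ioo a b) := by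
    refine differentiableOn_integral (isOpen_Ioo.preimage Complex.continuous_im) ?_ ?_ ?_
    · intro t ζ hζ
      have h1 := hd (t + ζ.re • v) _ (Set.Ioo_subset_Icc_self hζ)
      rw [← hval] at h1
      refine DifferentiableAt.differentiableWithinAt ?_
      exact DifferentiableAt.comp (f := fun ζ : ℂ => fun i => (t i : ℂ) + ζ * v i) ζ h1 (by fun_prop)
    · intro ζ hζ
      exact (hcont ζ (Set.Ioo_subset_Icc_self hζ)).aestronglyMeasurable
    · intro ζ hζ
      refine ⟨fun t => C * ((∏ i, 2 * (1 + (|ζ.re| + 1) ^ 2 * v i ^ 2)) * cauchyWeight t),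
        (integrable_cauchyWeight.const_mul _).const_mul _, ?_⟩
      have h1 : ∀ᶠ e : ℂ in 𝓝 ζ, e.im ∈ Set.Ioo a b :=
        Complex.continuous_im.continuousAt.eventually (isOpen_Ioo.mem_nhds hζ)
      have h2 : ∀ᶠ e : ℂ in 𝓝 ζ, |e.re| < |ζ.re| + 1 :=
        (Complex.continuous_re.abs.continuousAt (x := ζ)).eventually (gt_mem_nhds (by linarith))
      filter_upwards [h1, h2] with e he1 he2 t
      refine (hgb e (Set.Ioo_subset_Icc_self he1) t).trans ?_
      refine mul_le_mul_of_nonneg_left ((cauchyWeight_add_le _ _).trans ?_) hC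
      refine mul_le_mul_of_nonneg_right ?_ (cauchyWeight_pos _).le
      refine Finset.prod_le_prod (fun i _ => by positivity) fun i _ => ?_
      simp only [Pi.smul_apply, smul_eq_mul, mul_pow]
      have : e.re ^ 2 ≤ (|ζ.re| + 1) ^ 2 := by
        rw [← sq_abs]; gcongr
      gcongr
  have hder : ∀ τ ∈ Set.Ioo a b, HasDerivAt (fun s : ℝ => Φ (s * Complex.I)) 0 τ := by
    intro τ hτ
    have hmem : ((τ : ℂ) * Complex.I) ∈ Complex.im ⁻¹' Set.Ioo a b := by simpa using hτ
    have h1 := (hdiff.differentiableAt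
      ((isOpen_Ioo.preimage Complex.continuous_im).mem_nhds hmem)).hasDerivAt
    have h2 : deriv Φ (τ * Complex.I) = 0 := by
      have h3 : HasDerivAt (fun s : ℝ => (τ : ℂ) * Complex.I + s) 1 0 := by
        simpa using (Complex.ofRealCLM.hasDerivAt (x := (0:ℝ))).const_add ((τ : ℂ) * Complex.I)
      have h4 := HasDerivAt.comp_of_eq (x := (0:ℝ)) h1 h3 (by simp)
      have h5 : (Φ ∘ fun s : ℝ => (τ : ℂ) * Complex.I + s) = fun _ => Φ (τ * Complex.I) := by
        funext s
        simp only [Function.comp]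
        rw [htrans]; simp
      rw [h5, mul_one] at h4
      exact h4.unique (hasDerivAt_const _ _)
    rw [h2] at h1
    have h3 : HasDerivAt (fun s : ℝ => (s : ℂ) * Complex.I) Complex.I τ := by
      simpa using (Complex.ofRealCLM.hasDerivAt (x := τ)).mul_const Complex.I
    have h4 := HasDerivAt.comp_of_eq (x := τ) h1 h3 rfl
    rw [zero_mul] at h4
    exact h4
  have hco : ContinuousOn (fun s : ℝ => Φ (s * Complex.I)) (Set.Icc a b) := by
    simp only [hΦ]
    refine continuousOn_of_dominated (bound := fun t => C * cauchyWeight t) ?_ ?_ ?_ ?_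
    · intro τ hτ
      exact (hcont _ (by simpa using hτ)).aestronglyMeasurable
    · intro τ hτ
      refine Eventually.of_forall fun t => ?_
      rw [hval']; exact hb t τ hτ
    · exact integrable_cauchyWeight.const_mul _
    · refine Eventually.of_forall fun t τ hτ => ?_
      have h1 := hd t τ hτ
      have : (fun s : ℝ => g (s * Complex.I) t) = fun s : ℝ =>
          f (fun i => (t i : ℂ) + ((s * v i : ℝ) : ℂ) * Complex.I) := by
        funext s; exact hval' s t
      rw [this]
      refine ContinuousAt.continuousWithinAt ?_
      exact h1.continuousAt.comp
        (f := fun s : ℝ => fun i => (t i : ℂ) + ((s * v i : ℝ) : ℂ) * Complex.I) (by fun_prop)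
  have := intervalIntegral.integral_eq_sub_of_hasDerivAt_of_le hab hco hder (by simp)
  simp only [intervalIntegral.integral_zero] at this
  simp only [hΦ, hval'] at this
  exact (sub_eq_zero.1 this.symm).symm

theorem integral_comp_sinh {ι : Type*} [Fintype ι] {R : ℝ} (hR : 0 < R) (g : (ι → ℝ) → ℂ) :
    ∫ u : ι → ℝ, g u =
      ∫ t : ι → ℝ, (∏ i, (R * Real.cosh (t i) : ℂ)) * g (fun i => R * Real.sinh (t i)) := by
  classical
  have hder : ∀ t ∈ (Set.univ : Set (ι → ℝ)), HasFDerivWithinAt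
      (fun t : ι → ℝ => fun i => R * Real.sinh (t i))
      (ContinuousLinearMap.pi fun i => (R * Real.cosh (t i)) •
        (ContinuousLinearMap.proj i : (ι → ℝ) →L[ℝ] ℝ)) Set.univ t := by
    intro t _
    rw [hasFDerivWithinAt_pi]
    intro i
    refine HasFDerivAt.hasFDerivWithinAt ?_
    have h1 : HasDerivAt (fun s => R * Real.sinh s) (R * Real.cosh (t i)) (t i) :=
      (Real.hasDerivAt_sinh _).const_mul R
    exact HasDerivAt.comp_hasFDerivAt (h₂ := fun s => R * Real.sinh s) (f := fun t : ι → ℝ => t i) t h1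
      (ContinuousLinearMap.proj (R := ℝ) (φ := fun _ : ι => ℝ) i).hasFDerivAt
  have hinj : Set.InjOn (fun t : ι → ℝ => fun i => R * Real.sinh (t i)) Set.univ := by
    intro s _ t _ h
    funext i
    have := congrFun h i
    exact Real.sinh_injective (mul_left_cancel₀ hR.ne' this)
  have himg : (fun t : ι → ℝ => fun i => R * Real.sinh (t i)) '' Set.univ = Set.univ := by
    rw [Set.image_univ, Set.range_eq_univ]
    intro u
    refine ⟨fun i => Real.arsinh (u i / R), ?_⟩
    funext i
    simp only [Real.sinh_arsinh]
    field_simp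
  have h := integral_image_eq_integral_abs_det_fderiv_smul volume MeasurableSet.univ hder hinj g
  rw [himg] at h
  simp only [setIntegral_univ] at h
  rw [h]
  refine integral_congr_ae (Eventually.of_forall fun t => ?_)
  have hdet : (ContinuousLinearMap.pi fun i => (R * Real.cosh (t i)) •
      (ContinuousLinearMap.proj i : (ι → ℝ) →L[ℝ] ℝ)).det = ∏ i, R * Real.cosh (t i) := by
    rw [ContinuousLinearMap.det]
    have : ((ContinuousLinearMap.pi fun i => (R * Real.cosh (t i)) •
      (ContinuousLinearMap.proj i : (ι → ℝ) →L[ℝ] ℝ) : (ι → ℝ) →L[ℝ] (ι → ℝ)) : (ι → ℝ) →ₗ[ℝ] (ι → ℝ)) =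
        Matrix.toLin' (Matrix.diagonal fun i => R * Real.cosh (t i)) := by
      apply LinearMap.ext
      intro x
      funext i
      simp [Matrix.mulVec_diagonal]
    rw [this, LinearMap.det_toLin', Matrix.det_diagonal]
  simp only [hdet]
  rw [abs_of_pos (Finset.prod_pos fun i _ => mul_pos hR (Real.cosh_pos _)), Complex.real_smul]
  push_cast
  rfl

theorem eq_of_eq_on_real {k : ℕ} {F G : (Fin k → ℂ) → ℂ} (hF : Differentiable ℂ F)
    (hG : Differentiable ℂ G) (h : ∀ x : Fin k → ℝ, F (fun i => (x i : ℂ)) = G fun i => (x i : ℂ)) :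
    F = G := by
  funext x
  set L : ℂ → (Fin k → ℂ) := fun ζ i => (x i).re + ζ * (x i).im with hL
  have hLd : Differentiable ℂ L := by
    rw [hL]; fun_prop
  have h1 : AnalyticOnNhd ℂ (F ∘ L) Set.univ :=
    DifferentiableOn.analyticOnNhd (hF.comp hLd).differentiableOn isOpen_univ
  have h2 : AnalyticOnNhd ℂ (G ∘ L) Set.univ :=
    DifferentiableOn.analyticOnNhd (hG.comp hLd).differentiableOn isOpen_univ
  have hreal : ∀ s : ℝ, (F ∘ L) s = (G ∘ L) s := by
    intro s
    have := h fun i => (x i).re + s * (x i).im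
    simpa [hL] using this
  have hfreq : ∃ᶠ z in 𝓝[≠] (0:ℂ), (F ∘ L) z = (G ∘ L) z := by
    have ht : Tendsto (fun n : ℕ => (((1 / ((n:ℝ) + 1) : ℝ)) : ℂ)) atTop (𝓝[≠] 0) := by
      rw [tendsto_nhdsWithin_iff]
      constructor
      · have := (Complex.continuous_ofReal.tendsto 0).comp
          (tendsto_one_div_add_atTop_nhds_zero_nat (𝕜 := ℝ))
        simpa [Function.comp_def] using this
      · refine Eventually.of_forall fun n => ?_
        simp only [Set.mem_compl_iff, Set.mem_singleton_iff, Complex.ofReal_eq_zero]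
        positivity
    exact ht.frequently (Frequently.of_forall fun n => hreal _)
  have := h1.eqOn_of_preconnected_of_frequently_eq h2 isPreconnected_univ (Set.mem_univ 0) hfreq
  have h3 := this (Set.mem_univ Complex.I)
  have h4 : L Complex.I = x := by
    funext i
    apply Complex.ext <;> simp [hL]
  simpa [Function.comp, h4] using h3

/-- The direction in which the contour of a variable is displaced: `+1` for `w`, `-1` for `z`. -/
def sgn {m n : ℕ} : Fin m ⊕ Fin n → ℝ := Sum.elim (fun _ => 1) fun _ => -1

theorem abs_sgn {m n : ℕ} (i : Fin m ⊕ Fin n) : |sgn i| = 1 := by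
  cases i <;> simp [sgn]

theorem sgn_mul_sgn {m n : ℕ} (i : Fin m ⊕ Fin n) : sgn i * sgn i = 1 := by
  cases i <;> simp [sgn]

/-- The Gamma functions with poles in the weight. -/
def polePart (ħ : ℝ) {m n N : ℕ} (p : Fin m ⊕ Fin n → ℂ) (y : Fin N → ℂ) : ℂ :=
  ∏ i, ∏ b, Complex.Gamma (sgn i * (y b - p i) / (Complex.I * ħ))

/-- The powers of `ħ` in the weight. -/
def powPart (ħ : ℝ) {m n N : ℕ} (p : Fin m ⊕ Fin n → ℂ) (y : Fin N → ℂ) : ℂ :=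
  (∏ i, ∏ b, (ħ : ℂ) ^ (Complex.I / ħ * (sgn i * (p i - y b)))) *
    ∏ a, ∏ b, ((ħ : ℂ) ^ (Complex.I / ħ * (p (.inl a) - p (.inr b))))⁻¹

/-- The reciprocal Gamma functions of differences within a block. -/
def diagPart (ħ : ℝ) {m : ℕ} (w : Fin m → ℂ) : ℂ :=
  ∏ p ∈ (Finset.univ : Finset (Fin m)).offDiag,
    (Complex.Gamma ((w p.1 - w p.2) / (Complex.I * ħ)))⁻¹

/-- The reciprocal Gamma functions of differences between blocks. -/
def crossPart (ħ : ℝ) {m n : ℕ} (p : Fin m ⊕ Fin n → ℂ) : ℂ :=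
  ∏ a, ∏ b, (Complex.Gamma ((p (.inr b) - p (.inl a)) / (Complex.I * ħ)))⁻¹

/-- The numerical prefactor of the weight. -/
def weightConst (ħ : ℝ) (m n : ℕ) : ℂ :=
  ((2 * Real.pi * ħ : ℂ) ^ (m + n))⁻¹ / ((m.factorial : ℂ) * (n.factorial : ℂ))

theorem weight_eq (ħ : ℝ) {m n : ℕ} (p : Fin m ⊕ Fin n → ℂ) (y : Fin (m + n + 1) → ℂ) :
    weight ħ (fun a => p (.inl a)) (fun b => p (.inr b)) y =
      weightConst ħ m n * powPart ħ p y * crossPart ħ p * diagPart ħ (fun a => p (.inl a)) *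
        diagPart ħ (fun b => p (.inr b)) * polePart ħ p y := by
  simp only [weight, weightConst, powPart, crossPart, diagPart, polePart, Finset.prod_inv_distrib,
    Fintype.prod_sum_type, sgn, Sum.elim_inl, Sum.elim_inr, Finset.prod_mul_distrib, div_eq_mul_inv,
    mul_inv]
  have e1 : ∀ a b, ((-1 : ℝ) : ℂ) * (y b - p (.inr a)) = p (.inr a) - y b := by
    intro a b; push_cast; ring
  have e2 : ∀ a b, ((-1 : ℝ) : ℂ) * (p (.inr a) - y b) = y b - p (.inr a) := by
    intro a b; push_cast; ring
  simp only [e1, e2, Complex.ofReal_one, one_mul]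
  ring

/-- The integrand of the Mellin-Barnes integral as a function of complex integration variables. -/
def kern (ħ : ℝ) {m n : ℕ} (A : (Fin m → ℂ) → ℂ → ℂ) (B : (Fin n → ℂ) → ℂ → ℂ)
    (y : Fin (m + n + 1) → ℂ) (ε : ℂ) (p : Fin m ⊕ Fin n → ℂ) : ℂ :=
  A (fun a => p (.inl a)) (∑ k, y k - ∑ b, p (.inr b)) *
    B (fun b => p (.inr b)) (ε - ∑ k, y k + ∑ b, p (.inr b)) *
      weight ħ (fun a => p (.inl a)) (fun b => p (.inr b)) y

/-- The flat contour at height `α`. -/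
def flat {m n : ℕ} (α : ℝ) (u : Fin m ⊕ Fin n → ℝ) : Fin m ⊕ Fin n → ℂ :=
  fun i => u i - ((sgn i * α : ℝ) : ℂ) * Complex.I

theorem div_I_mul_re (ħ : ℝ) (ζ : ℂ) : (ζ / (Complex.I * ħ)).re = ζ.im / ħ := by
  have : ζ / (Complex.I * ħ) = (-Complex.I * ζ) / ħ := by
    rw [← div_div, Complex.div_I]; ring_nf
  rw [this, Complex.div_ofReal_re]; simp

theorem div_I_mul_im (ħ : ℝ) (ζ : ℂ) : (ζ / (Complex.I * ħ)).im = -ζ.re / ħ := by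
  have : ζ / (Complex.I * ħ) = (-Complex.I * ζ) / ħ := by
    rw [← div_div, Complex.div_I]; ring_nf
  rw [this, Complex.div_ofReal_im]; simp

theorem norm_div_I_mul {ħ : ℝ} (hħ : 0 < ħ) (ζ : ℂ) : ‖ζ / (Complex.I * ħ)‖ = ‖ζ‖ / ħ := by
  rw [norm_div, norm_mul, Complex.norm_I, one_mul, Complex.norm_real, Real.norm_of_nonneg hħ.le]

theorem norm_pow_I_div {ħ : ℝ} (hħ : 0 < ħ) (ζ : ℂ) :
    ‖(ħ : ℂ) ^ (Complex.I / ħ * ζ)‖ = Real.exp (-(Real.log ħ / ħ) * ζ.im) := by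
  rw [Complex.norm_cpow_eq_rpow_re_of_pos hħ, Real.rpow_def_of_pos hħ]
  congr 1
  have : Complex.I / ħ * ζ = (Complex.I * ζ) / ħ := by ring
  rw [this, Complex.div_ofReal_re]
  simp; ring

theorem norm_prod_le {ι : Type*} (s : Finset ι) (f : ι → ℂ) (g : ι → ℝ) {K T : ℝ} {M : ℕ}
    (h : ∀ i ∈ s, ‖f i‖ ≤ K * T ^ M * Real.exp (g i)) :
    ‖∏ i ∈ s, f i‖ ≤ K ^ s.card * T ^ (M * s.card) * Real.exp (∑ i ∈ s, g i) := by
  rw [norm_prod]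
  refine (Finset.prod_le_prod (fun i _ => norm_nonneg _) h).trans_eq ?_
  rw [Finset.prod_mul_distrib, Finset.prod_const, mul_pow, ← pow_mul, Real.exp_sum]

theorem norm_mul_le_of {a b : ℂ} {K₁ K₂ T g₁ g₂ : ℝ} {M₁ M₂ : ℕ}
    (ha : ‖a‖ ≤ K₁ * T ^ M₁ * Real.exp g₁) (hb : ‖b‖ ≤ K₂ * T ^ M₂ * Real.exp g₂) :
    ‖a * b‖ ≤ (K₁ * K₂) * T ^ (M₁ + M₂) * Real.exp (g₁ + g₂) := by
  rw [norm_mul, Real.exp_add, pow_add]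
  refine (mul_le_mul ha hb (norm_nonneg _) ((norm_nonneg _).trans ha)).trans_eq ?_
  ring

theorem sum_offDiag_eq {m : ℕ} (f : Fin m → Fin m → ℝ) (hf : ∀ a, f a a = 0) :
    ∑ p ∈ (Finset.univ : Finset (Fin m)).offDiag, f p.1 p.2 = ∑ a, ∑ b, f a b := by
  rw [← Finset.sum_product']
  refine Finset.sum_subset (fun p _ => by simp) fun p _ hp => ?_
  simp at hp
  rw [hp, hf]

/-- The exponential estimate on the strip of width `η`, with explicit constants. -/
def StripBound (ħ : ℝ) {N : ℕ} (Φ : (Fin N → ℂ) → ℂ → (Fin (N + 1) → ℝ) → ℂ) (η C₁ C₂ : ℝ) (M : ℕ) :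
    Prop :=
  ∀ y ε x, (∀ k, |(y k).im| < η) → |ε.im| < η →
    ‖Φ y ε x‖ ≤ C₁ * Real.exp (C₂ * ∑ a, |x a|) * (1 + ∑ a, ‖y a‖) ^ M *
      Real.exp (-(Real.pi / (2 * ħ)) * ((∑ a, ∑ b, |(y a - y b).re|) / 2))

theorem exists_polePart_le {ħ : ℝ} (hħ : 0 < ħ) (m n N : ℕ) {δ : ℝ} (hδ : 0 < δ) (H : ℝ) :
    ∃ K : ℝ, ∃ M : ℕ, 0 ≤ K ∧ ∀ (y : Fin N → ℂ) (p : Fin m ⊕ Fin n → ℂ) (T : ℝ), 1 ≤ T →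
      (∀ i b, δ ≤ sgn i * ((y b).im - (p i).im)) → (∀ i b, |(y b).im - (p i).im| ≤ H) →
      (∀ i b, |(p i).re - (y b).re| ≤ T) →
      ‖polePart ħ p y‖ ≤ K * T ^ M *
        Real.exp (-(Real.pi / (2 * ħ)) * ∑ i, ∑ b, |(p i).re - (y b).re|) := by
  obtain ⟨C, M, hC, h⟩ := exists_norm_Gamma_le_strip (δ := δ / ħ) (by positivity) (H / ħ)
  refine ⟨((C * (1 + 1 / ħ) ^ M) ^ N) ^ (Fintype.card (Fin m ⊕ Fin n)), M * N * Fintype.card (Fin m ⊕ Fin n), by positivity,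
    fun y p T hT h1 h2 h3 => ?_⟩
  rw [Finset.mul_sum]
  simp only [Finset.mul_sum]
  refine norm_prod_le Finset.univ _ _ (M := M * N) fun i _ => ?_
  have := norm_prod_le Finset.univ (fun b => Complex.Gamma (sgn i * (y b - p i) / (Complex.I * ħ)))
    (fun b => -(Real.pi / (2 * ħ)) * |(p i).re - (y b).re|) (K := C * (1 + 1 / ħ) ^ M) (T := T) (M := M)
    fun b _ => ?_
  · simpa using this
  · have hre : (sgn i * (y b - p i) / (Complex.I * ħ)).re = sgn i * ((y b).im - (p i).im) / ħ := by
      rw [div_I_mul_re]; simp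
    have him : |(sgn i * (y b - p i) / (Complex.I * ħ)).im| = |(p i).re - (y b).re| / ħ := by
      rw [div_I_mul_im, abs_div, abs_neg, Complex.re_ofReal_mul, abs_mul, abs_sgn, one_mul, abs_of_pos hħ,
        Complex.sub_re, abs_sub_comm]
    have h4 : sgn i * ((y b).im - (p i).im) ≤ H := by
      refine (le_abs_self _).trans ?_
      rw [abs_mul, abs_sgn, one_mul]; exact h2 i b
    have := h (sgn i * (y b - p i) / (Complex.I * ħ)) (by rw [hre]; gcongr; exact h1 i b)
      (by rw [hre]; gcongr)
    rw [him] at this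
    refine this.trans ?_
    have e : -(Real.pi / 2) * (|(p i).re - (y b).re| / ħ) = -(Real.pi / (2 * ħ)) * |(p i).re - (y b).re| := by
      field_simp
    rw [e, mul_assoc C _ (T ^ M), ← mul_pow]
    gcongr
    have h5 := h3 i b
    have : |(p i).re - (y b).re| / ħ ≤ T / ħ := by gcongr
    calc 1 + |(p i).re - (y b).re| / ħ ≤ T + T / ħ := by linarith
      _ = _ := by ring

theorem exists_inv_Gamma_le {ħ : ℝ} (hħ : 0 < ħ) (H : ℝ) :
    ∃ K : ℝ, ∃ M : ℕ, 0 ≤ K ∧ ∀ (ζ : ℂ) (T : ℝ), 1 ≤ T → |ζ.im| ≤ H → |ζ.re| ≤ T →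
      ‖(Complex.Gamma (ζ / (Complex.I * ħ)))⁻¹‖ ≤ K * T ^ M *
        Real.exp (Real.pi / (2 * ħ) * |ζ.re|) := by
  obtain ⟨C, M, hC, h⟩ := exists_norm_inv_Gamma_le_strip (H / ħ)
  refine ⟨C * (1 + 1 / ħ) ^ M, M, by positivity, fun ζ T hT h1 h2 => ?_⟩
  have := h (ζ / (Complex.I * ħ)) (by rw [div_I_mul_re, abs_div, abs_of_pos hħ]; gcongr)
  rw [div_I_mul_im, abs_div, abs_of_pos hħ, abs_neg] at this
  refine this.trans ?_
  have e : Real.pi / 2 * (|ζ.re| / ħ) = Real.pi / (2 * ħ) * |ζ.re| := by field_simp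
  rw [e, mul_assoc C _ (T ^ M), ← mul_pow]
  gcongr
  have : |ζ.re| / ħ ≤ T / ħ := by gcongr
  calc 1 + |ζ.re| / ħ ≤ T + T / ħ := by linarith
      _ = _ := by ring

theorem exists_diagPart_le {ħ : ℝ} (hħ : 0 < ħ) (m : ℕ) (H : ℝ) :
    ∃ K : ℝ, ∃ M : ℕ, 0 ≤ K ∧ ∀ (w : Fin m → ℂ) (T : ℝ), 1 ≤ T →
      (∀ a b, |(w a).im - (w b).im| ≤ H) → (∀ a b, |(w a).re - (w b).re| ≤ T) →
      ‖diagPart ħ w‖ ≤ K * T ^ M *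
        Real.exp (Real.pi / (2 * ħ) * ∑ a, ∑ b, |(w a).re - (w b).re|) := by
  obtain ⟨C, M, hC, h⟩ := exists_inv_Gamma_le hħ H
  refine ⟨C ^ (Finset.univ : Finset (Fin m)).offDiag.card,
    M * (Finset.univ : Finset (Fin m)).offDiag.card, by positivity, fun w T hT h1 h2 => ?_⟩
  have := norm_prod_le (Finset.univ : Finset (Fin m)).offDiag
    (fun p => (Complex.Gamma ((w p.1 - w p.2) / (Complex.I * ħ)))⁻¹)
    (fun p => Real.pi / (2 * ħ) * |(w p.1).re - (w p.2).re|) (K := C) (T := T) (M := M) fun p _ => by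
      have := h (w p.1 - w p.2) T hT (by simpa using h1 _ _) (by simpa using h2 _ _)
      simpa using this
  rw [← Finset.mul_sum, sum_offDiag_eq (fun a b => |(w a).re - (w b).re|) (by simp)] at this
  exact this

theorem exists_crossPart_le {ħ : ℝ} (hħ : 0 < ħ) (m n : ℕ) (H : ℝ) :
    ∃ K : ℝ, ∃ M : ℕ, 0 ≤ K ∧ ∀ (p : Fin m ⊕ Fin n → ℂ) (T : ℝ), 1 ≤ T →
      (∀ i j, |(p i).im - (p j).im| ≤ H) → (∀ i j, |(p i).re - (p j).re| ≤ T) →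
      ‖crossPart ħ p‖ ≤ K * T ^ M *
        Real.exp (Real.pi / (2 * ħ) * ∑ a, ∑ b, |(p (.inr b)).re - (p (.inl a)).re|) := by
  obtain ⟨C, M, hC, h⟩ := exists_inv_Gamma_le hħ H
  refine ⟨(C ^ n) ^ m, M * n * m, by positivity, fun p T hT h1 h2 => ?_⟩
  rw [Finset.mul_sum]
  simp only [Finset.mul_sum]
  have := norm_prod_le Finset.univ
    (fun a => ∏ b, (Complex.Gamma ((p (.inr b) - p (.inl a)) / (Complex.I * ħ)))⁻¹)
    (fun a => ∑ b, Real.pi / (2 * ħ) * |(p (.inr b)).re - (p (.inl a)).re|)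
    (K := C ^ n) (T := T) (M := M * n) fun a _ => by
      have := norm_prod_le Finset.univ
        (fun b => (Complex.Gamma ((p (.inr b) - p (.inl a)) / (Complex.I * ħ)))⁻¹)
        (fun b => Real.pi / (2 * ħ) * |(p (.inr b)).re - (p (.inl a)).re|)
        (K := C) (T := T) (M := M) fun b _ => by
          have := h (p (.inr b) - p (.inl a)) T hT (by simpa using h1 _ _) (by simpa using h2 _ _)
          simpa using this
      simpa using this
  simp only [Finset.card_univ, Fintype.card_fin] at this
  exact this

theorem exists_powPart_le {ħ : ℝ} (hħ : 0 < ħ) (m n N : ℕ) :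
    ∃ L : ℝ, 0 ≤ L ∧ ∀ (y : Fin N → ℂ) (p : Fin m ⊕ Fin n → ℂ) (H : ℝ), 0 ≤ H →
      (∀ i b, |(p i).im - (y b).im| ≤ H) → (∀ i j, |(p i).im - (p j).im| ≤ H) →
      ‖powPart ħ p y‖ ≤ Real.exp (L * H) := by
  set l := |Real.log ħ / ħ| with hl
  have hb : ∀ (ζ : ℂ) (H : ℝ), |ζ.im| ≤ H → -(Real.log ħ / ħ) * ζ.im ≤ l * H := by
    intro ζ H h
    refine (le_abs_self _).trans ?_
    rw [abs_mul, abs_neg]; gcongr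
  have hb' : ∀ (ζ : ℂ) (H : ℝ), |ζ.im| ≤ H → -(-(Real.log ħ / ħ) * ζ.im) ≤ l * H := by
    intro ζ H h
    refine (neg_le_abs _).trans ?_
    rw [abs_mul, abs_neg]; gcongr
  refine ⟨(Fintype.card (Fin m ⊕ Fin n) * N + m * n) * l, by positivity, fun y p H hH h1 h2 => ?_⟩
  have e1 : ‖∏ i, ∏ b, (ħ : ℂ) ^ (Complex.I / ħ * (sgn i * (p i - y b)))‖ ≤
      Real.exp (Fintype.card (Fin m ⊕ Fin n) * N * (l * H)) := by
    simp only [norm_prod, norm_pow_I_div hħ]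
    simp only [← Real.exp_sum]
    refine Real.exp_le_exp.2 ?_
    refine (Finset.sum_le_sum fun i _ => Finset.sum_le_sum fun b _ => hb _ H ?_).trans_eq ?_
    · rw [Complex.im_ofReal_mul, abs_mul, abs_sgn, one_mul, Complex.sub_im]; exact h1 i b
    · simp; ring
  have e2 : ‖∏ a, ∏ b, ((ħ : ℂ) ^ (Complex.I / ħ * (p (.inl a) - p (.inr b))))⁻¹‖ ≤
      Real.exp (m * n * (l * H)) := by
    simp only [norm_prod, norm_inv, norm_pow_I_div hħ]
    simp only [← Real.exp_neg, ← Real.exp_sum]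
    refine Real.exp_le_exp.2 ?_
    refine (Finset.sum_le_sum fun i _ => Finset.sum_le_sum fun b _ => hb' _ H ?_).trans_eq ?_
    · rw [Complex.sub_im]; exact h2 _ _
    · simp; ring
  rw [powPart, norm_mul]
  refine (mul_le_mul e1 e2 (norm_nonneg _) (Real.exp_pos _).le).trans_eq ?_
  rw [← Real.exp_add]; congr 1; ring

theorem flat_re {m n : ℕ} (α : ℝ) (u : Fin m ⊕ Fin n → ℝ) (i) : (flat α u i).re = u i := by
  simp [flat]

theorem flat_im {m n : ℕ} (α : ℝ) (u : Fin m ⊕ Fin n → ℝ) (i) : (flat α u i).im = -(sgn i * α) := by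
  simp [flat]

theorem sum_abs_headPos_add_tailPos {m n : ℕ} (x : Fin (m + n + 1 + 1) → ℝ) :
    ∑ a, |headPos x a| + ∑ a, |tailPos x a| = ∑ a, |x a| := by
  have h : m + 1 + (n + 1) = m + n + 1 + 1 := by omega
  rw [← (finCongr h).sum_comp fun i => |x i|]
  exact (Fin.sum_univ_add fun i : Fin (m + 1 + (n + 1)) => |x (finCongr h i)|).symm

set_option maxHeartbeats 1000000 in
theorem exists_kern_flat_le {ħ : ℝ} (hħ : 0 < ħ) (m n : ℕ) {δ : ℝ} (hδ : 0 < δ) {H : ℝ} (hH : 0 < H)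
    {C₁ C₂ : ℝ} (hC₁ : 0 ≤ C₁) (M : ℕ) :
    ∃ K : ℝ, ∃ M' : ℕ, 0 ≤ K ∧ ∀ Φ₁ Φ₂,
      StripBound ħ Φ₁ ((2 * m + 2 * n + 4) * H) C₁ C₂ M →
      StripBound ħ Φ₂ ((2 * m + 2 * n + 4) * H) C₁ C₂ M →
      ∀ (y : Fin (m + n + 1) → ℂ) (ε : ℂ) (x : Fin (m + n + 1 + 1) → ℝ) (α : ℝ),
      (∀ k, |(y k).im| + δ ≤ α) → α ≤ H → |ε.im| ≤ H → ∀ u : Fin m ⊕ Fin n → ℝ,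
      ‖kern ħ (fun w e => Φ₁ w e (headPos x)) (fun z e => Φ₂ z e (tailPos x)) y ε (flat α u)‖ ≤
        K * Real.exp (C₂ * ∑ a, |x a|) * (1 + ∑ a, ‖y a‖ + ∑ i, |u i|) ^ M' *
          Real.exp (-(Real.pi / (2 * ħ)) * ((∑ a, ∑ b, |(y a - y b).re|) / 2 +
            2 * ∑ i, max 0 (|u i| - (1 + ∑ a, ‖y a‖)))) := by
  obtain ⟨K₁, M₁, hK₁, h₁⟩ := exists_polePart_le hħ m n (m + n + 1) hδ (2 * H)
  obtain ⟨K₂, M₂, hK₂, h₂⟩ := exists_diagPart_le hħ m (2 * H)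
  obtain ⟨K₃, M₃, hK₃, h₃⟩ := exists_diagPart_le hħ n (2 * H)
  obtain ⟨K₄, M₄, hK₄, h₄⟩ := exists_crossPart_le hħ m n (2 * H)
  obtain ⟨L, hL, h₅⟩ := exists_powPart_le hħ m n (m + n + 1)
  set D := 1 + (m + n) * H with hD
  have hD1 : 1 ≤ D := by have : 0 ≤ (m + n) * H := by positivity
                         linarith
  refine ⟨(C₁ * D ^ M) * (C₁ * D ^ M) *
    (‖weightConst ħ m n‖ * Real.exp (L * (2 * H)) * K₄ * K₂ * K₃ * K₁), M + M + (0 + 0 + M₄ + M₂ + M₃ + M₁),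
    by positivity, fun Φ₁ Φ₂ hΦ₁ hΦ₂ y ε x α hy hα hε u => ?_⟩
  have hα0 : 0 ≤ α := by linarith [hy (Fin.last _), abs_nonneg (y (Fin.last _)).im]
  have hyα : ∀ k, |(y k).im| ≤ H := fun k => by linarith [hy k]
  have habsα : |α| ≤ H := by rwa [abs_of_nonneg hα0]
  set Y := 1 + ∑ a, ‖y a‖ with hY
  set S := ∑ i, |u i| with hS
  set T := Y + S with hT
  have hY1 : 1 ≤ Y := by
    have : 0 ≤ ∑ a, ‖y a‖ := by positivity
    linarith
  have hS0 : 0 ≤ S := by positivity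
  have hT1 : 1 ≤ T := by linarith
  have hui : ∀ i, |u i| ≤ S := fun i =>
    Finset.single_le_sum (f := fun i => |u i|) (fun i _ => abs_nonneg _) (Finset.mem_univ i)
  have hyi : ∀ k, |(y k).re| ≤ Y - 1 := fun k => by
    have := Finset.single_le_sum (f := fun i => ‖y i‖) (fun i _ => norm_nonneg _) (Finset.mem_univ k)
    have := Complex.abs_re_le_norm (y k)
    linarith
  have hflat : ∀ i, |(flat α u i).im| ≤ H := fun i => by
    rw [flat_im, abs_neg, abs_mul, abs_sgn, one_mul]; exact habsα
  have hnflat : ∀ i, ‖flat α u i‖ ≤ |u i| + H := fun i => by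
    refine (Complex.norm_le_abs_re_add_abs_im _).trans ?_
    rw [flat_re]; linarith [hflat i]
  have hsumuu : ∀ i j, i ≠ j → |u i| + |u j| ≤ S := fun i j hij =>
    Finset.add_le_sum (f := fun i => |u i|) (fun i _ => abs_nonneg _) (Finset.mem_univ i) (Finset.mem_univ j) hij
  have huu : ∀ i j, |(flat α u i).re - (flat α u j).re| ≤ T := fun i j => by
    rw [flat_re, flat_re]
    rcases eq_or_ne i j with h | h
    · subst h; simp; linarith
    · refine (abs_sub _ _).trans ((hsumuu i j h).trans (by linarith))
  have huy : ∀ i b, |(flat α u i).re - (y b).re| ≤ T := fun i b => by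
    rw [flat_re]
    refine (abs_sub _ _).trans ?_
    linarith [hui i, hyi b]
  have him : ∀ i j, |(flat α u i).im - (flat α u j).im| ≤ 2 * H := fun i j => by
    refine (abs_sub _ _).trans ?_
    linarith [hflat i, hflat j]
  have himy : ∀ i b, |(flat α u i).im - (y b).im| ≤ 2 * H := fun i j => by
    refine (abs_sub _ _).trans ?_
    linarith [hflat i, hyα j]
  have hSlr : ∑ a, |u (.inl a)| + ∑ b, |u (.inr b)| = S := by
    rw [hS, Fintype.sum_sum_type]
  have hSl : 0 ≤ ∑ a, |u (.inl a)| := by positivity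
  have hSr : 0 ≤ ∑ a, |u (.inr a)| := by positivity
  have hsumy : |(∑ k, y k).im| ≤ (m + n + 1) * H := by
    rw [Complex.im_sum]
    refine (Finset.abs_sum_le_sum_abs _ _).trans ((Finset.sum_le_sum fun k _ => hyα k).trans_eq ?_)
    simp
  have hsumz : |(∑ b, flat α u (.inr b)).im| ≤ n * H := by
    rw [Complex.im_sum]
    refine (Finset.abs_sum_le_sum_abs _ _).trans ((Finset.sum_le_sum fun k _ => hflat _).trans_eq ?_)
    simp
  have hmH : 0 ≤ m * H := by positivity
  have hnH : 0 ≤ n * H := by positivity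
  have b₁ := hΦ₁ (fun a => flat α u (.inl a)) (∑ k, y k - ∑ b, flat α u (.inr b)) (headPos x)
    (fun k => (hflat _).trans_lt (by nlinarith)) (by
      rw [Complex.sub_im]
      refine (abs_sub _ _).trans_lt ?_
      nlinarith)
  have b₂ := hΦ₂ (fun b => flat α u (.inr b)) (ε - ∑ k, y k + ∑ b, flat α u (.inr b)) (tailPos x)
    (fun k => (hflat _).trans_lt (by nlinarith)) (by
      rw [Complex.add_im, Complex.sub_im]
      refine (abs_add_le _ _).trans_lt ?_
      have := abs_sub ε.im (∑ k, y k).im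
      nlinarith)
  simp only [Complex.sub_re, flat_re] at b₁ b₂
  have hw : 1 + ∑ a, ‖flat α u (.inl a)‖ ≤ D * T := by
    have : ∑ a, ‖flat α u (.inl a)‖ ≤ ∑ a, (|u (.inl a)| + H) := Finset.sum_le_sum fun a _ => hnflat _
    rw [Finset.sum_add_distrib] at this
    simp at this
    nlinarith [mul_nonneg hmH (by linarith : 0 ≤ T - 1), mul_nonneg hnH (by linarith : 0 ≤ T - 1)]
  have hz : 1 + ∑ a, ‖flat α u (.inr a)‖ ≤ D * T := by
    have : ∑ a, ‖flat α u (.inr a)‖ ≤ ∑ a, (|u (.inr a)| + H) := Finset.sum_le_sum fun a _ => hnflat _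
    rw [Finset.sum_add_distrib] at this
    simp at this
    nlinarith [mul_nonneg hmH (by linarith : 0 ≤ T - 1), mul_nonneg hnH (by linarith : 0 ≤ T - 1)]
  have c₁ : ‖Φ₁ (fun a => flat α u (.inl a)) (∑ k, y k - ∑ b, flat α u (.inr b)) (headPos x)‖ ≤
      (C₁ * D ^ M) * T ^ M * Real.exp (C₂ * ∑ a, |headPos x a| + -(Real.pi / (2 * ħ)) *
        ((∑ a, ∑ b, |u (.inl a) - u (.inl b)|) / 2)) := by
    refine b₁.trans ?_
    rw [Real.exp_add, mul_assoc C₁ (D ^ M), ← mul_pow]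
    calc _ ≤ C₁ * Real.exp (C₂ * ∑ a, |headPos x a|) * (D * T) ^ M * Real.exp (-(Real.pi / (2 * ħ)) *
        ((∑ a, ∑ b, |u (.inl a) - u (.inl b)|) / 2)) := by gcongr
      _ = _ := by ring
  have c₂ : ‖Φ₂ (fun b => flat α u (.inr b)) (ε - ∑ k, y k + ∑ b, flat α u (.inr b)) (tailPos x)‖ ≤
      (C₁ * D ^ M) * T ^ M * Real.exp (C₂ * ∑ a, |tailPos x a| + -(Real.pi / (2 * ħ)) *
        ((∑ a, ∑ b, |u (.inr a) - u (.inr b)|) / 2)) := by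
    refine b₂.trans ?_
    rw [Real.exp_add, mul_assoc C₁ (D ^ M), ← mul_pow]
    calc _ ≤ C₁ * Real.exp (C₂ * ∑ a, |tailPos x a|) * (D * T) ^ M * Real.exp (-(Real.pi / (2 * ħ)) *
        ((∑ a, ∑ b, |u (.inr a) - u (.inr b)|) / 2)) := by gcongr
      _ = _ := by ring
  have d₁ := h₁ y (flat α u) T hT1 (fun i b => by
      rw [flat_im]
      have h1 : sgn i * ((y b).im - -(sgn i * α)) = sgn i * (y b).im + (sgn i * sgn i) * α := by ring
      rw [h1, sgn_mul_sgn]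
      have h2 := neg_abs_le (sgn i * (y b).im)
      rw [abs_mul, abs_sgn] at h2
      linarith [hy b]) (fun i b => by rw [abs_sub_comm]; exact himy i b) huy
  have d₂ := h₂ (fun a => flat α u (.inl a)) T hT1 (fun _ _ => him _ _) (fun _ _ => huu _ _)
  have d₃ := h₃ (fun a => flat α u (.inr a)) T hT1 (fun _ _ => him _ _) (fun _ _ => huu _ _)
  have d₄ := h₄ (flat α u) T hT1 him huu
  have d₅ := h₅ y (flat α u) (2 * H) (by positivity) himy him
  simp only [flat_re] at d₁ d₂ d₃ d₄
  have d₅' : ‖powPart ħ (flat α u) y‖ ≤ Real.exp (L * (2 * H)) * T ^ 0 * Real.exp 0 := by simpa using d₅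
  have d₆ : ‖weightConst ħ m n‖ ≤ ‖weightConst ħ m n‖ * T ^ 0 * Real.exp 0 := by simp
  have tot := norm_mul_le_of (norm_mul_le_of c₁ c₂)
    (norm_mul_le_of (norm_mul_le_of (norm_mul_le_of (norm_mul_le_of (norm_mul_le_of d₆ d₅') d₄) d₂) d₃) d₁)
  rw [kern, weight_eq]
  refine tot.trans ?_
  have hyy : ∀ k, |(y k).re| ≤ Y := fun k => by linarith [hyi k]
  have hint := sum_abs_sub_interlace_excess (ι := Fin m ⊕ Fin n) (by simp) u (fun b => (y b).re) hyy
  have hsplit : ∑ i, ∑ j, |u i - u j| = ∑ a, ∑ b, |u (.inl a) - u (.inl b)| +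
      ∑ a, ∑ b, |u (.inr a) - u (.inr b)| + 2 * ∑ a, ∑ b, |u (.inr b) - u (.inl a)| := by
    simp only [Fintype.sum_sum_type, Finset.sum_add_distrib]
    have h1 : ∑ a, ∑ b, |u (.inr a) - u (.inl b)| = ∑ a, ∑ b, |u (.inr b) - u (.inl a)| :=
      Finset.sum_comm
    have h2 : ∑ a, ∑ b, |u (.inl a) - u (.inr b)| = ∑ a, ∑ b, |u (.inr b) - u (.inl a)| := by
      simp only [abs_sub_comm]
    rw [h1, h2]; ring
  have hx := sum_abs_headPos_add_tailPos x
  rw [mul_right_comm _ (Real.exp (C₂ * ∑ a, |x a|)),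
    mul_assoc _ (Real.exp (C₂ * ∑ a, |x a|)), ← Real.exp_add]
  refine mul_le_mul_of_nonneg_left (Real.exp_le_exp.2 ?_) (by positivity)
  simp only [Complex.sub_re]
  rw [← hx]
  have hpi : 0 < Real.pi / (2 * ħ) := by have := Real.pi_pos; positivity
  rw [hsplit] at hint
  have key : ∀ c a b A B X P Z E : ℝ, c * (A + B + 2 * X + Z + 4 * E) ≤ c * (2 * P) →
      a + -c * (A / 2) + (b + -c * (B / 2)) + (0 + 0 + c * X + c * A + c * B + -c * P) ≤
        -c * (Z / 2 + 2 * E) + (a + b) := by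
    intros; linarith
  rw [mul_add C₂, add_comm (C₂ * _ + C₂ * _)]
  exact key _ _ _ _ _ _ _ _ _ (mul_le_mul_of_nonneg_left hint hpi.le)

theorem exists_pow_mul_exp_le {c : ℝ} (hc : 0 < c) (j : ℕ) :
    ∃ K : ℝ, 0 ≤ K ∧ ∀ S : ℝ, 0 ≤ S → (1 + S) ^ j * Real.exp (-c * S) ≤ K := by
  refine ⟨j.factorial / c ^ j * Real.exp c, by positivity, fun S hS => ?_⟩
  have h := Real.pow_div_factorial_le_exp (c * (1 + S)) (by positivity) j
  rw [mul_pow, div_le_iff₀ (by positivity)] at h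
  have e : Real.exp (-c * S) = Real.exp c * (Real.exp (c * (1 + S)))⁻¹ := by
    rw [← Real.exp_neg, ← Real.exp_add]; ring_nf
  rw [e]
  have h2 : (1 + S) ^ j ≤ j.factorial / c ^ j * Real.exp (c * (1 + S)) := by
    rw [div_mul_eq_mul_div, le_div_iff₀ (by positivity)]; linarith
  have hp := Real.exp_pos (c * (1 + S))
  calc _ ≤ (j.factorial / c ^ j * Real.exp (c * (1 + S))) * (Real.exp c * (Real.exp (c * (1 + S)))⁻¹) := by
        gcongr
    _ = _ := by field_simp

theorem exists_pow_mul_exp_le_cauchyWeight (ι : Type*) [Fintype ι] {c : ℝ} (hc : 0 < c) (M : ℕ) :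
    ∃ K : ℝ, 0 ≤ K ∧ ∀ (Y : ℝ) (u : ι → ℝ), 1 ≤ Y →
      (Y + ∑ i, |u i|) ^ M * Real.exp (-c * ∑ i, max 0 (|u i| - Y)) ≤
        K * Y ^ (M + 2 * Fintype.card ι) * cauchyWeight u := by
  obtain ⟨K, hK, h⟩ := exists_pow_mul_exp_le hc (M + 2 * Fintype.card ι)
  set k := Fintype.card ι
  refine ⟨(k + 1) ^ M * 2 ^ k * K, by positivity, fun Y u hY => ?_⟩
  set S := ∑ i, max 0 (|u i| - Y) with hS
  have hS0 : 0 ≤ S := Finset.sum_nonneg fun i _ => le_max_left _ _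
  have hui : ∀ i, |u i| ≤ Y + max 0 (|u i| - Y) := fun i => by
    linarith [le_max_right 0 (|u i| - Y)]
  have heS : ∀ i, max 0 (|u i| - Y) ≤ S := fun i =>
    Finset.single_le_sum (f := fun i => max 0 (|u i| - Y)) (fun i _ => le_max_left _ _) (Finset.mem_univ i)
  have h1 : Y + ∑ i, |u i| ≤ (k + 1) * (Y * (1 + S)) := by
    have := Finset.sum_le_sum fun i (_ : i ∈ Finset.univ) => hui i
    rw [Finset.sum_add_distrib] at this
    simp only [Finset.sum_const, Finset.card_univ, nsmul_eq_mul] at this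
    have hk : (0:ℝ) ≤ k := by positivity
    have h3 : (k:ℝ) * Y + S ≤ k * (Y * (1 + S)) + Y * S := by
      have : 0 ≤ k * (Y * S) := by positivity
      nlinarith
    nlinarith
  have h2 : ∏ i, (1 + u i ^ 2) ≤ (2 * (Y * (1 + S)) ^ 2) ^ k := by
    refine (Finset.prod_le_prod (fun i _ => by positivity) (g := fun _ => 2 * (Y * (1 + S)) ^ 2)
      fun i _ => ?_).trans_eq (by simp [k])
    have h3 : |u i| ≤ Y * (1 + S) := by nlinarith [hui i, heS i]
    have h4 : u i ^ 2 ≤ (Y * (1 + S)) ^ 2 := by rw [← sq_abs]; gcongr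
    have h5 : 1 ≤ Y * (1 + S) := by nlinarith
    nlinarith
  have h3 : (1:ℝ) = (∏ i, (1 + u i ^ 2)) * cauchyWeight u := by
    rw [cauchyWeight, ← Finset.prod_mul_distrib, Finset.prod_eq_one]
    intro i _
    have : 0 < 1 + u i ^ 2 := by positivity
    field_simp
  have hY0 : 0 ≤ Y + ∑ i, |u i| := by positivity
  calc _ = (Y + ∑ i, |u i|) ^ M * Real.exp (-c * S) * ((∏ i, (1 + u i ^ 2)) * cauchyWeight u) := by
        rw [← h3, mul_one]
    _ ≤ ((k + 1) * (Y * (1 + S))) ^ M * Real.exp (-c * S) * ((2 * (Y * (1 + S)) ^ 2) ^ k * cauchyWeight u) := by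
        have := cauchyWeight_pos u
        gcongr
    _ = (k + 1) ^ M * 2 ^ k * ((1 + S) ^ (M + 2 * k) * Real.exp (-c * S)) * Y ^ (M + 2 * k) * cauchyWeight u := by
        have e : (2 * (Y * (1 + S)) ^ 2) ^ k = 2 ^ k * (Y ^ (2 * k) * (1 + S) ^ (2 * k)) := by
          rw [mul_pow, ← pow_mul, mul_pow]
        rw [e, mul_pow, mul_pow, pow_add, pow_add]; ring
    _ ≤ _ := by
        have := cauchyWeight_pos u
        have := h S hS0
        gcongr

theorem StripBound.mono {ħ : ℝ} {N : ℕ} {Φ : (Fin N → ℂ) → ℂ → (Fin (N + 1) → ℝ) → ℂ}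
    {η η' C₁ C₂ C₁' C₂' : ℝ} {M M' : ℕ} (h : StripBound ħ Φ η C₁ C₂ M) (hη : η' ≤ η) (hC₁ : 0 ≤ C₁)
    (h₁ : C₁ ≤ C₁') (h₂ : C₂ ≤ C₂') (hM : M ≤ M') : StripBound ħ Φ η' C₁' C₂' M' := by
  intro y ε x hy hε
  refine (h y ε x (fun k => (hy k).trans_le hη) (hε.trans_le hη)).trans ?_
  have : 1 ≤ 1 + ∑ a, ‖y a‖ := by
    have : 0 ≤ ∑ a, ‖y a‖ := by positivity
    linarith
  have : 0 ≤ ∑ a, |x a| := by positivity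
  have : (1 + ∑ a, ‖y a‖) ^ M ≤ (1 + ∑ a, ‖y a‖) ^ M' := pow_le_pow_right₀ ‹_› hM
  have := hC₁.trans h₁
  gcongr

theorem exists_kern_flat_le_cauchyWeight {ħ : ℝ} (hħ : 0 < ħ) (m n : ℕ) {δ : ℝ} (hδ : 0 < δ) {H : ℝ}
    (hH : 0 < H) {C₁ C₂ : ℝ} (hC₁ : 0 ≤ C₁) (M : ℕ) :
    ∃ K : ℝ, ∃ M' : ℕ, 0 ≤ K ∧ ∀ Φ₁ Φ₂,
      StripBound ħ Φ₁ ((2 * m + 2 * n + 4) * H) C₁ C₂ M →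
      StripBound ħ Φ₂ ((2 * m + 2 * n + 4) * H) C₁ C₂ M →
      ∀ (y : Fin (m + n + 1) → ℂ) (ε : ℂ) (x : Fin (m + n + 1 + 1) → ℝ) (α : ℝ),
      (∀ k, |(y k).im| + δ ≤ α) → α ≤ H → |ε.im| ≤ H → ∀ u : Fin m ⊕ Fin n → ℝ,
      ‖kern ħ (fun w e => Φ₁ w e (headPos x)) (fun z e => Φ₂ z e (tailPos x)) y ε (flat α u)‖ ≤
        K * Real.exp (C₂ * ∑ a, |x a|) * (1 + ∑ a, ‖y a‖) ^ M' *
          Real.exp (-(Real.pi / (2 * ħ)) * ((∑ a, ∑ b, |(y a - y b).re|) / 2)) *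
          (Real.exp (-(Real.pi / (2 * ħ)) * ∑ i, max 0 (|u i| - (1 + ∑ a, ‖y a‖))) *
            cauchyWeight u) := by
  obtain ⟨K, M', hK, h⟩ := exists_kern_flat_le hħ m n hδ hH hC₁ (C₂ := C₂) M
  have hc : 0 < Real.pi / (2 * ħ) := by have := Real.pi_pos; positivity
  obtain ⟨K', hK', h'⟩ := exists_pow_mul_exp_le_cauchyWeight (Fin m ⊕ Fin n) hc M'
  refine ⟨K * K', M' + 2 * Fintype.card (Fin m ⊕ Fin n), by positivity,
    fun Φ₁ Φ₂ hΦ₁ hΦ₂ y ε x α hy hα hε u => ?_⟩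
  refine (h Φ₁ Φ₂ hΦ₁ hΦ₂ y ε x α hy hα hε u).trans ?_
  have hY : 1 ≤ 1 + ∑ a, ‖y a‖ := by
    have : 0 ≤ ∑ a, ‖y a‖ := by positivity
    linarith
  have h2 := h' _ u hY
  set Y := 1 + ∑ a, ‖y a‖
  set c := Real.pi / (2 * ħ)
  set S := ∑ i, max 0 (|u i| - Y)
  set G := (∑ a, ∑ b, |(y a - y b).re|) / 2
  have e : Real.exp (-c * (G + 2 * S)) = Real.exp (-c * G) * (Real.exp (-c * S) * Real.exp (-c * S)) := by
    rw [← Real.exp_add, ← Real.exp_add]; ring_nf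
  rw [e]
  calc _ = K * Real.exp (C₂ * ∑ a, |x a|) * Real.exp (-c * G) * Real.exp (-c * S) *
        ((Y + ∑ i, |u i|) ^ M' * Real.exp (-c * S)) := by ring
    _ ≤ K * Real.exp (C₂ * ∑ a, |x a|) * Real.exp (-c * G) * Real.exp (-c * S) *
        (K' * Y ^ (M' + 2 * Fintype.card (Fin m ⊕ Fin n)) * cauchyWeight u) := by gcongr
    _ = _ := by ring

theorem differentiableAt_prod {E ι : Type*} [NormedAddCommGroup E] [NormedSpace ℂ E] {s : Finset ι}
    {f : ι → E → ℂ} {e₀ : E} (h : ∀ i ∈ s, DifferentiableAt ℂ (f i) e₀) :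
    DifferentiableAt ℂ (fun e => ∏ i ∈ s, f i e) e₀ := by
  classical
  induction s using Finset.induction_on with
  | empty => simp
  | insert a s ha ih =>
    simp only [Finset.prod_insert ha]
    exact (h a (by simp)).mul (ih fun i hi => h i (by simp [hi]))

theorem differentiableAt_div_const {E : Type*} [NormedAddCommGroup E] [NormedSpace ℂ E]
    {f : E → ℂ} {e₀ : E} (h : DifferentiableAt ℂ f e₀) (c : ℂ) :
    DifferentiableAt ℂ (fun e => f e / c) e₀ := by
  simp only [div_eq_mul_inv]
  exact h.mul_const _

section Diff
variable {E : Type*} [NormedAddCommGroup E] [NormedSpace ℂ E] {m n N : ℕ} {ħ : ℝ} {e₀ : E}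

theorem differentiableAt_polePart {P : E → Fin m ⊕ Fin n → ℂ} {Y : E → Fin N → ℂ}
    (hP : DifferentiableAt ℂ P e₀) (hY : DifferentiableAt ℂ Y e₀)
    (h : ∀ i b, 0 < (sgn i * (Y e₀ b - P e₀ i) / (Complex.I * ħ)).re ∨
      (sgn i * (Y e₀ b - P e₀ i) / (Complex.I * ħ)).im ≠ 0) :
    DifferentiableAt ℂ (fun e => polePart ħ (P e) (Y e)) e₀ := by
  have hP' := differentiableAt_pi.1 hP
  have hY' := differentiableAt_pi.1 hY
  unfold polePart
  refine differentiableAt_prod fun i _ => differentiableAt_prod fun b _ => ?_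
  refine DifferentiableAt.comp (g := Complex.Gamma) e₀ (Complex.differentiableAt_Gamma _ ?_) ?_
  · intro k hk
    rcases h i b with h | h <;> rw [hk] at h <;> simp at h
    have : (0:ℝ) ≤ k := by positivity
    linarith
  · exact differentiableAt_div_const (((hY' b).sub (hP' i)).const_mul _) _

theorem differentiableAt_inv_Gamma {f : E → ℂ} (hf : DifferentiableAt ℂ f e₀) :
    DifferentiableAt ℂ (fun e => (Complex.Gamma (f e))⁻¹) e₀ :=
  (Complex.differentiable_one_div_Gamma (f e₀)).comp e₀ hf

theorem differentiableAt_powPart (hħ : 0 < ħ) {P : E → Fin m ⊕ Fin n → ℂ} {Y : E → Fin N → ℂ}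
    (hP : DifferentiableAt ℂ P e₀) (hY : DifferentiableAt ℂ Y e₀) :
    DifferentiableAt ℂ (fun e => powPart ħ (P e) (Y e)) e₀ := by
  have hP' := differentiableAt_pi.1 hP
  have hY' := differentiableAt_pi.1 hY
  have hne : (ħ : ℂ) ≠ 0 := by exact_mod_cast hħ.ne'
  unfold powPart
  refine DifferentiableAt.mul ?_ ?_
  · refine differentiableAt_prod fun i _ => differentiableAt_prod fun b _ => ?_
    refine DifferentiableAt.const_cpow ?_ (Or.inl hne)
    exact (((hP' i).sub (hY' b)).const_mul _).const_mul _
  · refine differentiableAt_prod fun i _ => differentiableAt_prod fun b _ => ?_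
    refine DifferentiableAt.inv (DifferentiableAt.const_cpow ?_ (Or.inl hne)) ?_
    · exact ((hP' _).sub (hP' _)).const_mul _
    · exact fun h => hne (Complex.cpow_eq_zero_iff _ _ |>.1 h).1

theorem differentiableAt_diagPart {w : E → Fin m → ℂ} (hw : DifferentiableAt ℂ w e₀) :
    DifferentiableAt ℂ (fun e => diagPart ħ (w e)) e₀ := by
  have hw' := differentiableAt_pi.1 hw
  unfold diagPart
  exact differentiableAt_prod fun p _ =>
    differentiableAt_inv_Gamma (differentiableAt_div_const ((hw' _).sub (hw' _)) _)

theorem differentiableAt_crossPart {P : E → Fin m ⊕ Fin n → ℂ} (hP : DifferentiableAt ℂ P e₀) :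
    DifferentiableAt ℂ (fun e => crossPart ħ (P e)) e₀ := by
  have hP' := differentiableAt_pi.1 hP
  unfold crossPart
  exact differentiableAt_prod fun i _ => differentiableAt_prod fun b _ =>
    differentiableAt_inv_Gamma (differentiableAt_div_const ((hP' _).sub (hP' _)) _)

theorem differentiableAt_weight (hħ : 0 < ħ) {P : E → Fin m ⊕ Fin n → ℂ} {Y : E → Fin (m + n + 1) → ℂ}
    (hP : DifferentiableAt ℂ P e₀) (hY : DifferentiableAt ℂ Y e₀)
    (h : ∀ i b, 0 < (sgn i * (Y e₀ b - P e₀ i) / (Complex.I * ħ)).re ∨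
      (sgn i * (Y e₀ b - P e₀ i) / (Complex.I * ħ)).im ≠ 0) :
    DifferentiableAt ℂ (fun e => weight ħ (fun a => P e (.inl a)) (fun b => P e (.inr b)) (Y e)) e₀ := by
  have hP' := differentiableAt_pi.1 hP
  simp only [weight_eq]
  exact (((((differentiableAt_const _).mul (differentiableAt_powPart hħ hP hY)).mul
    (differentiableAt_crossPart hP)).mul
    (differentiableAt_diagPart (differentiableAt_pi.2 fun a => hP' (.inl a)))).mul
    (differentiableAt_diagPart (differentiableAt_pi.2 fun a => hP' (.inr a)))).mul
    (differentiableAt_polePart hP hY h)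

end Diff

theorem differentiableAt_kern {ħ : ℝ} (hħ : 0 < ħ) {m n : ℕ} {A : (Fin m → ℂ) → ℂ → ℂ}
    {B : (Fin n → ℂ) → ℂ → ℂ} (hA : Differentiable ℂ fun q : (Fin m → ℂ) × ℂ => A q.1 q.2)
    (hB : Differentiable ℂ fun q : (Fin n → ℂ) × ℂ => B q.1 q.2)
    (y : Fin (m + n + 1) → ℂ) (ε : ℂ) {p : Fin m ⊕ Fin n → ℂ}
    (h : ∀ i b, 0 < sgn i * ((y b).im - (p i).im) ∨ (y b).re - (p i).re ≠ 0) :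
    DifferentiableAt ℂ (kern ħ A B y ε) p := by
  unfold kern
  refine DifferentiableAt.mul (DifferentiableAt.mul ?_ ?_)
    (differentiableAt_weight hħ (P := fun p => p) (Y := fun _ => y) differentiableAt_fun_id
      (differentiableAt_const _) ?_)
  · exact (hA _).comp p (f := fun p : Fin m ⊕ Fin n → ℂ =>
      ((fun a => p (.inl a)), ∑ k, y k - ∑ b, p (.inr b))) (by fun_prop)
  · exact (hB _).comp p (f := fun p : Fin m ⊕ Fin n → ℂ =>
      ((fun a => p (.inr a)), ε - ∑ k, y k + ∑ b, p (.inr b))) (by fun_prop)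
  · intro i b
    rw [div_I_mul_re, div_I_mul_im]
    rcases h i b with h | h
    · left
      rw [Complex.im_ofReal_mul, Complex.sub_im]
      positivity
    · right
      rw [Complex.re_ofReal_mul, Complex.sub_re]
      have : sgn i ≠ 0 := by
        intro h0; have := abs_sgn i; rw [h0] at this; simp at this
      simp only [ne_eq, div_eq_zero_iff, neg_eq_zero, mul_eq_zero, hħ.ne', or_false, this, false_or]
      exact h

theorem flat_below {m n N : ℕ} {y : Fin N → ℂ} {α : ℝ} (h : ∀ k, |(y k).im| < α)
    (u : Fin m ⊕ Fin n → ℝ) (i) (b) : 0 < sgn i * ((y b).im - (flat α u i).im) := by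
  rw [flat_im]
  have h1 : sgn i * ((y b).im - -(sgn i * α)) = sgn i * (y b).im + (sgn i * sgn i) * α := by ring
  rw [h1, sgn_mul_sgn]
  have h2 := neg_abs_le (sgn i * (y b).im)
  rw [abs_mul, abs_sgn] at h2
  linarith [h b]

theorem integral_sum_pi {m n : ℕ} (f : (Fin m → ℝ) × (Fin n → ℝ) → ℂ) :
    ∫ p, f p = ∫ u : Fin m ⊕ Fin n → ℝ, f (fun a => u (.inl a), fun b => u (.inr b)) :=
  ((volume_measurePreserving_sumPiEquivProdPi fun _ : Fin m ⊕ Fin n => ℝ).integral_comp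
    (MeasurableEquiv.measurableEmbedding _) f).symm

theorem integrable_sum_pi {m n : ℕ} (f : (Fin m → ℝ) × (Fin n → ℝ) → ℂ)
    (hf : Integrable fun u : Fin m ⊕ Fin n → ℝ => f (fun a => u (.inl a), fun b => u (.inr b))) :
    Integrable f :=
  ((volume_measurePreserving_sumPiEquivProdPi fun _ : Fin m ⊕ Fin n => ℝ).integrable_comp_emb
    (MeasurableEquiv.measurableEmbedding _)).1 hf

theorem integrand_eq_kern (ħ : ℝ) {m n : ℕ} (Φ₁ : (Fin m → ℂ) → ℂ → (Fin (m + 1) → ℝ) → ℂ)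
    (Φ₂ : (Fin n → ℂ) → ℂ → (Fin (n + 1) → ℝ) → ℂ) (α : ℝ) (y : Fin (m + n + 1) → ℂ) (ε : ℂ)
    (x : Fin (m + n + 1 + 1) → ℝ) (u : Fin m ⊕ Fin n → ℝ) :
    integrand ħ Φ₁ Φ₂ α y ε x (fun a => u (.inl a), fun b => u (.inr b)) =
      kern ħ (fun w e => Φ₁ w e (headPos x)) (fun z e => Φ₂ z e (tailPos x)) y ε (flat α u) := by
  have h1 : (fun a => flat α u (.inl a)) = fun a => (u (.inl a) : ℂ) - Complex.I * α := by
    funext a; simp [flat, sgn]; ring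
  have h2 : (fun b => flat α u (.inr b)) = fun b => (u (.inr b) : ℂ) + Complex.I * α := by
    funext a; simp [flat, sgn]; ring
  have h3 : ∀ b, flat α u (.inr b) = (u (.inr b) : ℂ) + Complex.I * α := fun b => congrFun h2 b
  simp only [integrand, kern, h1, h3]

theorem continuous_flat {m n : ℕ} (α : ℝ) : Continuous (flat α : (Fin m ⊕ Fin n → ℝ) → _) :=
  continuous_pi fun i =>
    (Complex.continuous_ofReal.comp (continuous_apply i)).sub continuous_const

section Node
variable {ħ : ℝ} {m n : ℕ} {Φ₁ : (Fin m → ℂ) → ℂ → (Fin (m + 1) → ℝ) → ℂ}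
  {Φ₂ : (Fin n → ℂ) → ℂ → (Fin (n + 1) → ℝ) → ℂ}

/-- The function satisfies the exponential estimate on all strips. -/
def HasStripBounds (ħ : ℝ) {N : ℕ} (Φ : (Fin N → ℂ) → ℂ → (Fin (N + 1) → ℝ) → ℂ) : Prop :=
  ∀ η : ℝ, ∃ C₁ C₂ : ℝ, ∃ M : ℕ, 0 ≤ C₁ ∧ 0 ≤ C₂ ∧ StripBound ħ Φ η C₁ C₂ M

theorem exists_kern_flat_le_of_hasStripBounds (hħ : 0 < ħ) (h₁ : HasStripBounds ħ Φ₁)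
    (h₂ : HasStripBounds ħ Φ₂) (y : Fin (m + n + 1) → ℂ) (ε : ℂ) (x : Fin (m + n + 1 + 1) → ℝ)
    {α₀ : ℝ} (hα₀ : ∀ k, |(y k).im| < α₀) (α₁ : ℝ) :
    ∃ K : ℝ, 0 ≤ K ∧ ∀ α ∈ Set.Icc α₀ α₁, ∀ u : Fin m ⊕ Fin n → ℝ,
      ‖kern ħ (fun w e => Φ₁ w e (headPos x)) (fun z e => Φ₂ z e (tailPos x)) y ε (flat α u)‖ ≤
        K * (Real.exp (-(Real.pi / (2 * ħ)) * ∑ i, max 0 (|u i| - (1 + ∑ a, ‖y a‖))) *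
            cauchyWeight u) := by
  obtain ⟨δ, hδ, hδy⟩ : ∃ δ > 0, ∀ k, |(y k).im| + δ ≤ α₀ := by
    obtain ⟨k₀, hk₀⟩ := Finite.exists_max fun k => |(y k).im|
    exact ⟨α₀ - |(y k₀).im|, by linarith [hα₀ k₀], fun k => by linarith [hk₀ k]⟩
  set H := max 1 (max |α₁| |ε.im|) with hH
  have hH0 : 0 < H := lt_of_lt_of_le one_pos (le_max_left _ _)
  obtain ⟨C₁, C₂, M, hC₁, hC₂, hb₁⟩ := h₁ ((2 * m + 2 * n + 4) * H)
  obtain ⟨D₁, D₂, M', hD₁, hD₂, hb₂⟩ := h₂ ((2 * m + 2 * n + 4) * H)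
  obtain ⟨K, M'', hK, h⟩ := exists_kern_flat_le_cauchyWeight hħ m n hδ hH0
    (hC₁.trans (le_max_left C₁ D₁)) (C₂ := max C₂ D₂) (max M M')
  refine ⟨_, ?_, fun α hα u => h Φ₁ Φ₂
    (hb₁.mono le_rfl hC₁ (le_max_left _ _) (le_max_left _ _) (le_max_left _ _))
    (hb₂.mono le_rfl hD₁ (le_max_right _ _) (le_max_right _ _) (le_max_right _ _)) y ε x α
    (fun k => (hδy k).trans hα.1)
    (hα.2.trans ((le_abs_self _).trans ((le_max_left _ _).trans (le_max_right _ _))))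
    ((le_max_right _ _).trans (le_max_right _ _)) u⟩
  positivity

theorem integrable_kern_flat (hħ : 0 < ħ)
    (hd₁ : ∀ x, Differentiable ℂ fun q : (Fin m → ℂ) × ℂ => Φ₁ q.1 q.2 x)
    (hd₂ : ∀ x, Differentiable ℂ fun q : (Fin n → ℂ) × ℂ => Φ₂ q.1 q.2 x)
    (h₁ : HasStripBounds ħ Φ₁)
    (h₂ : HasStripBounds ħ Φ₂) (y : Fin (m + n + 1) → ℂ) (ε : ℂ) (x : Fin (m + n + 1 + 1) → ℝ)
    {α : ℝ} (hα : ∀ k, |(y k).im| < α) :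
    Integrable fun u => kern ħ (fun w e => Φ₁ w e (headPos x)) (fun z e => Φ₂ z e (tailPos x)) y ε
      (flat α u) := by
  obtain ⟨K, hK, h⟩ := exists_kern_flat_le_of_hasStripBounds hħ h₁ h₂ y ε x hα α
  have hcont : Continuous fun u => kern ħ (fun w e => Φ₁ w e (headPos x))
      (fun z e => Φ₂ z e (tailPos x)) y ε (flat α u) := by
    refine continuous_iff_continuousAt.2 fun u => ?_
    exact (differentiableAt_kern hħ (hd₁ _) (hd₂ _) y ε
      fun i b => Or.inl (flat_below hα u i b)).continuousAt.comp (continuous_flat α).continuousAt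
  refine ((integrable_cauchyWeight (ι := Fin m ⊕ Fin n)).const_mul K).mono' hcont.aestronglyMeasurable
    (Eventually.of_forall fun u => ?_)
  refine (h α ⟨le_rfl, le_rfl⟩ u).trans ?_
  refine mul_le_mul_of_nonneg_left ?_ hK
  refine mul_le_of_le_one_left (cauchyWeight_pos u).le (Real.exp_le_one_iff.2 ?_)
  have : 0 ≤ ∑ i, max 0 (|u i| - (1 + ∑ a, ‖y a‖)) := Finset.sum_nonneg fun i _ => le_max_left _ _
  have hc : 0 < Real.pi / (2 * ħ) := by have := Real.pi_pos; positivity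
  nlinarith

theorem integral_kern_flat_eq (hħ : 0 < ħ)
    (hd₁ : ∀ x, Differentiable ℂ fun q : (Fin m → ℂ) × ℂ => Φ₁ q.1 q.2 x)
    (hd₂ : ∀ x, Differentiable ℂ fun q : (Fin n → ℂ) × ℂ => Φ₂ q.1 q.2 x)
    (h₁ : HasStripBounds ħ Φ₁)
    (h₂ : HasStripBounds ħ Φ₂) (y : Fin (m + n + 1) → ℂ) (ε : ℂ) (x : Fin (m + n + 1 + 1) → ℝ)
    {α α' : ℝ} (hα : ∀ k, |(y k).im| < α) (hα' : ∀ k, |(y k).im| < α') :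
    ∫ u, kern ħ (fun w e => Φ₁ w e (headPos x)) (fun z e => Φ₂ z e (tailPos x)) y ε (flat α u) =
      ∫ u, kern ħ (fun w e => Φ₁ w e (headPos x)) (fun z e => Φ₂ z e (tailPos x)) y ε (flat α' u) := by
  wlog hle : α ≤ α' generalizing α α'
  · exact (this hα' hα (not_le.1 hle).le).symm
  obtain ⟨K, hK, h⟩ := exists_kern_flat_le_of_hasStripBounds hħ h₁ h₂ y ε x hα α'
  have hflat : ∀ (τ : ℝ) (t : Fin m ⊕ Fin n → ℝ),
      (fun i => (t i : ℂ) + ((τ * -sgn i : ℝ) : ℂ) * Complex.I) = flat τ t := by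
    intro τ t; funext i; simp only [flat]; push_cast; ring
  have := integral_shift (fun i => -sgn i) hle
    (kern ħ (fun w e => Φ₁ w e (headPos x)) (fun z e => Φ₂ z e (tailPos x)) y ε) K ?_ ?_
  · simpa only [hflat] using this
  · intro t τ hτ
    rw [hflat]
    exact differentiableAt_kern hħ (hd₁ _) (hd₂ _) y ε
      fun i b => Or.inl (flat_below (fun k => (hα k).trans_le hτ.1) t i b)
  · intro t τ hτ
    rw [hflat]
    refine (h τ hτ t).trans ?_
    refine mul_le_mul_of_nonneg_left ?_ hK
    refine mul_le_of_le_one_left (cauchyWeight_pos t).le (Real.exp_le_one_iff.2 ?_)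
    have : 0 ≤ ∑ i, max 0 (|t i| - (1 + ∑ a, ‖y a‖)) := Finset.sum_nonneg fun i _ => le_max_left _ _
    have hc : 0 < Real.pi / (2 * ħ) := by have := Real.pi_pos; positivity
    nlinarith

end Node

theorem Psi_node (ħ : ℝ) {m n : ℕ} (α : (Fin (m + n + 1) → ℂ) → ℝ) (hα : ∀ y k, |(y k).im| < α y)
    (left : Chain m) (right : Chain n) (y : Fin (m + n + 1) → ℂ) (ε : ℂ)
    (x : Fin (m + n + 1 + 1) → ℝ) :
    Psi ħ (.node α hα left right) y ε x = ∫ u : Fin m ⊕ Fin n → ℝ,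
      kern ħ (fun w e => Psi ħ left w e (headPos x)) (fun z e => Psi ħ right z e (tailPos x)) y ε
        (flat (α y) u) := by
  rw [Psi]
  beta_reduce
  rw [integral_sum_pi]
  simp only [integrand_eq_kern]

/-- The sum of the mutual distances of `N` reals. -/
def spread {N : ℕ} (Y : Fin N → ℝ) : ℝ := (∑ a, ∑ b, |Y a - Y b|) / 2

theorem spread_nonneg {N : ℕ} (Y : Fin N → ℝ) : 0 ≤ spread Y := by unfold spread; positivity

theorem spread_const {N : ℕ} (c : ℝ) : spread (fun _ : Fin N => c) = 0 := by simp [spread]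

theorem spread_neg {N : ℕ} (Y : Fin N → ℝ) : spread (fun a => -Y a) = spread Y := by
  unfold spread
  congr 1
  refine Finset.sum_congr rfl fun a _ => Finset.sum_congr rfl fun b _ => ?_
  rw [← abs_neg]; congr 1; ring

theorem spread_comp {N : ℕ} (Y : Fin N → ℝ) (σ : Equiv.Perm (Fin N)) :
    spread (fun a => Y (σ a)) = spread Y := by
  unfold spread
  rw [← Equiv.sum_comp σ fun a => ∑ b, |Y a - Y b|]
  congr 1
  refine Finset.sum_congr rfl fun a _ => ?_
  exact Equiv.sum_comp σ fun b => |Y (σ a) - Y b|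

theorem spread_add_le {N : ℕ} (g e : Fin N → ℝ) (he : ∀ a, 0 ≤ e a) :
    spread (fun a => g a + e a) ≤ spread g + (N - 1) * ∑ a, e a := by
  have h : ∀ a b, |g a + e a - (g b + e b)| ≤ |g a - g b| + e a + e b - if a = b then 2 * e a else 0 := by
    intro a b
    split_ifs with h
    · subst h; simp; linarith
    · have : g a + e a - (g b + e b) = (g a - g b) + (e a - e b) := by ring
      rw [this]
      refine (abs_add_le _ _).trans ?_
      have : |e a - e b| ≤ e a + e b := abs_le.2 ⟨by linarith [he a, he b], by linarith [he a, he b]⟩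
      linarith
  have := Finset.sum_le_sum fun a (_ : a ∈ Finset.univ) =>
    Finset.sum_le_sum fun b (_ : b ∈ Finset.univ) => h a b
  simp only [Finset.sum_add_distrib, Finset.sum_sub_distrib, Finset.sum_const, Finset.card_univ,
    nsmul_eq_mul, ← Finset.mul_sum, Finset.sum_ite_eq, Finset.mem_univ, if_true, Fintype.card_fin] at this
  unfold spread
  linarith

/-- The exponent that governs the growth of the integrand, in terms of the heights `h i = ± Im p i`
of the integration variables. -/
def energy {m n : ℕ} (Y : Fin (m + n + 1) → ℝ) (h : Fin m ⊕ Fin n → ℝ) : ℝ :=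
  (m - n) * ∑ b, Y b - (m + 1) * ∑ a, h (.inl a) - (n + 1) * ∑ b, h (.inr b) +
    spread (fun a => h (.inl a)) + spread (fun b => h (.inr b))

theorem energy_add_le {m n : ℕ} (Y : Fin (m + n + 1) → ℝ) (g e : Fin m ⊕ Fin n → ℝ)
    (he : ∀ i, 0 ≤ e i) : energy Y (fun i => g i + e i) ≤ energy Y g - 2 * ∑ i, e i := by
  have h1 := spread_add_le (fun a => g (.inl a)) (fun a => e (.inl a)) fun a => he _
  have h2 := spread_add_le (fun a => g (.inr a)) (fun a => e (.inr a)) fun a => he _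
  unfold energy
  simp only [Fintype.sum_sum_type, Finset.sum_add_distrib] at *
  linarith

theorem energy_const {m n : ℕ} (Y : Fin (m + n + 1) → ℝ) (c : ℝ) :
    energy Y (fun _ : Fin m ⊕ Fin n => c) = (m - n) * ∑ b, Y b - (m * (m + 1) + n * (n + 1)) * c := by
  unfold energy
  simp only [spread_const, Finset.sum_const, Finset.card_univ, Fintype.card_fin, nsmul_eq_mul]
  ring

theorem energy_eq {m n : ℕ} (Y : Fin (m + n + 1) → ℝ) (P : Fin m ⊕ Fin n → ℝ) :
    ∑ i, ∑ b, sgn i * (Y b - P i) + spread (fun a => P (.inl a)) + spread (fun b => P (.inr b)) -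
      ∑ a, ∑ b, (P (.inr b) - P (.inl a)) = energy Y fun i => sgn i * P i := by
  unfold energy
  simp only [Fintype.sum_sum_type, sgn, Sum.elim_inl, Sum.elim_inr, one_mul, neg_one_mul, spread_neg,
    Finset.sum_sub_distrib, Finset.sum_neg_distrib, Finset.sum_const, Finset.card_univ, Fintype.card_fin,
    nsmul_eq_mul, ← Finset.mul_sum]
  push_cast
  ring

/-- Growth in `y`, locally uniformly in `x`. -/
def HasGrowth (ħ : ℝ) {N : ℕ} (F : (Fin N → ℂ) × ℂ × (Fin (N + 1) → ℂ) → ℂ) : Prop :=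
  ∀ X κ : ℝ, 0 < κ → ∃ C : ℝ, 0 ≤ C ∧ ∀ y ε x, ‖x‖ ≤ X →
    ‖F (y, ε, x)‖ ≤ Real.exp (C * (1 + ‖y‖ + ‖ε‖) +
      (spread (fun k => (y k).im) + κ * ‖y‖) / ħ * Real.log (2 + ‖y‖))

/-- The first `m + 1` of `m + n + 2` complex positions. -/
def headC {m n : ℕ} (x : Fin (m + n + 1 + 1) → ℂ) : Fin (m + 1) → ℂ := fun i => x ⟨i, by omega⟩

/-- The last `n + 1` of `m + n + 2` complex positions. -/
def tailC {m n : ℕ} (x : Fin (m + n + 1 + 1) → ℂ) : Fin (n + 1) → ℂ := fun j => x ⟨m + 1 + j, by omega⟩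

theorem norm_headC_le {m n : ℕ} (x : Fin (m + n + 1 + 1) → ℂ) : ‖headC x‖ ≤ ‖x‖ :=
  (pi_norm_le_iff_of_nonneg (norm_nonneg _)).2 fun _ => norm_le_pi_norm x _

theorem norm_tailC_le {m n : ℕ} (x : Fin (m + n + 1 + 1) → ℂ) : ‖tailC x‖ ≤ ‖x‖ :=
  (pi_norm_le_iff_of_nonneg (norm_nonneg _)).2 fun _ => norm_le_pi_norm x _

/-- The factors of the integrand other than the interactions within a block and the Gamma functions
with poles. -/
def outerPart (ħ : ℝ) {m n : ℕ} (F₁ : (Fin m → ℂ) × ℂ × (Fin (m + 1) → ℂ) → ℂ)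
    (F₂ : (Fin n → ℂ) × ℂ × (Fin (n + 1) → ℂ) → ℂ) (y : Fin (m + n + 1) → ℂ) (ε : ℂ)
    (x : Fin (m + n + 1 + 1) → ℂ) (p : Fin m ⊕ Fin n → ℂ) : ℂ :=
  F₁ (fun a => p (.inl a), ∑ k, y k - ∑ b, p (.inr b), headC x) *
    F₂ (fun b => p (.inr b), ε - ∑ k, y k + ∑ b, p (.inr b), tailC x) *
      (weightConst ħ m n * powPart ħ p y * crossPart ħ p)

theorem kern_eq_outerPart (ħ : ℝ) {m n : ℕ} (F₁ : (Fin m → ℂ) × ℂ × (Fin (m + 1) → ℂ) → ℂ)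
    (F₂ : (Fin n → ℂ) × ℂ × (Fin (n + 1) → ℂ) → ℂ) (y : Fin (m + n + 1) → ℂ) (ε : ℂ)
    (x : Fin (m + n + 1 + 1) → ℂ) (p : Fin m ⊕ Fin n → ℂ) :
    kern ħ (fun w e => F₁ (w, e, headC x)) (fun z e => F₂ (z, e, tailC x)) y ε p =
      outerPart ħ F₁ F₂ y ε x p * (diagPart ħ (fun a => p (.inl a)) *
        diagPart ħ (fun b => p (.inr b)) * polePart ħ p y) := by
  rw [kern, weight_eq, outerPart]; ring

theorem norm_prod_le_exp {ι : Type*} (s : Finset ι) (f : ι → ℂ) (g : ι → ℝ)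
    (h : ∀ i ∈ s, ‖f i‖ ≤ Real.exp (g i)) : ‖∏ i ∈ s, f i‖ ≤ Real.exp (∑ i ∈ s, g i) := by
  rw [norm_prod, Real.exp_sum]
  exact Finset.prod_le_prod (fun i _ => norm_nonneg _) h

theorem norm_mul_le_exp {a b : ℂ} {s t : ℝ} (ha : ‖a‖ ≤ Real.exp s) (hb : ‖b‖ ≤ Real.exp t) :
    ‖a * b‖ ≤ Real.exp (s + t) := by
  rw [norm_mul, Real.exp_add]
  exact mul_le_mul ha hb (norm_nonneg _) (Real.exp_pos _).le

theorem exists_diagPart_growth {ħ : ℝ} (hħ : 0 < ħ) (m : ℕ) : ∃ C : ℝ, 0 ≤ C ∧ ∀ (w : Fin m → ℂ) (ρ : ℝ),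
    2 ≤ ρ → ‖w‖ ≤ ρ → ‖diagPart ħ w‖ ≤ Real.exp (C * ρ) := by
  obtain ⟨C, hC, h⟩ := exists_norm_inv_Gamma_le (K := 2 / ħ) (by positivity)
  refine ⟨(Finset.univ : Finset (Fin m)).offDiag.card * C, by positivity, fun w ρ hρ hw => ?_⟩
  refine (norm_prod_le_exp _ _ (fun p => -((w p.1).im - (w p.2).im) / ħ * Real.log ρ + C * ρ)
    fun p _ => ?_).trans (Real.exp_le_exp.2 ?_)
  · refine (h ρ hρ _ ?_).trans_eq ?_
    · rw [norm_div_I_mul hħ, div_mul_eq_mul_div]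
      gcongr
      refine (norm_sub_le _ _).trans ?_
      linarith [norm_le_pi_norm w p.1, norm_le_pi_norm w p.2]
    · rw [div_I_mul_re, Complex.sub_im]; ring_nf
  · rw [Finset.sum_add_distrib, Finset.sum_const, nsmul_eq_mul]
    have : ∑ p ∈ (Finset.univ : Finset (Fin m)).offDiag, -((w p.1).im - (w p.2).im) / ħ * Real.log ρ = 0 := by
      rw [sum_offDiag_eq (fun a b => -((w a).im - (w b).im) / ħ * Real.log ρ) (by simp)]
      have e : ∀ a b, -((w a).im - (w b).im) / ħ * Real.log ρ =
          (w b).im * (Real.log ρ / ħ) - (w a).im * (Real.log ρ / ħ) := by intros; ring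
      simp only [e, Finset.sum_sub_distrib, Finset.sum_const, Finset.card_univ, nsmul_eq_mul,
        ← Finset.mul_sum]
      ring
    rw [this]; linarith

theorem exists_polePart_growth {ħ : ℝ} (hħ : 0 < ħ) (m n N : ℕ) : ∃ C : ℝ, 0 ≤ C ∧
    ∀ (p : Fin m ⊕ Fin n → ℂ) (y : Fin N → ℂ) (ρ : ℝ), 2 ≤ ρ → ‖p‖ ≤ ρ → ‖y‖ ≤ ρ →
      (∀ i b, 1 ≤ sgn i * ((y b).im - (p i).im) ∨ 1 ≤ |(y b).re - (p i).re|) →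
      ‖polePart ħ p y‖ ≤ Real.exp (C * ρ +
        (∑ i, ∑ b, sgn i * ((y b).im - (p i).im)) / ħ * Real.log ρ) := by
  obtain ⟨C, hC, h⟩ := exists_norm_Gamma_le (K := 2 / ħ) (δ := 1 / ħ) (by positivity) (by positivity)
  refine ⟨Fintype.card (Fin m ⊕ Fin n) * (N * C), by positivity, fun p y ρ hρ hp hy hs => ?_⟩
  refine (norm_prod_le_exp _ _ (fun i => ∑ b, (sgn i * ((y b).im - (p i).im) / ħ * Real.log ρ + C * ρ))
    fun i _ => norm_prod_le_exp _ _ _ fun b _ => ?_).trans_eq ?_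
  · refine (h ρ hρ _ ?_ ?_).trans_eq ?_
    · rw [norm_div_I_mul hħ, div_mul_eq_mul_div, norm_mul, Complex.norm_real, Real.norm_eq_abs, abs_sgn,
        one_mul]
      gcongr
      refine (norm_sub_le _ _).trans ?_
      linarith [norm_le_pi_norm y b, norm_le_pi_norm p i]
    · rw [div_I_mul_re, div_I_mul_im, Complex.im_ofReal_mul, Complex.re_ofReal_mul, abs_div, abs_neg, abs_mul,
        abs_sgn, one_mul, abs_of_pos hħ, Complex.sub_im, Complex.sub_re]
      refine (hs i b).imp (fun h => ?_) fun h => ?_ <;> gcongr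
    · rw [div_I_mul_re, Complex.im_ofReal_mul, Complex.sub_im]
  · congr 1
    simp only [Finset.sum_add_distrib, Finset.sum_const, Finset.card_univ, nsmul_eq_mul,
      Fintype.card_fin, Finset.sum_div, Finset.sum_mul]
    ring

theorem exists_crossPart_growth {ħ : ℝ} (hħ : 0 < ħ) (m n : ℕ) : ∃ C : ℝ, 0 ≤ C ∧
    ∀ (p : Fin m ⊕ Fin n → ℂ) (ρ : ℝ), 2 ≤ ρ → ‖p‖ ≤ ρ →
      ‖crossPart ħ p‖ ≤ Real.exp (C * ρ +
        (-∑ a, ∑ b, ((p (.inr b)).im - (p (.inl a)).im)) / ħ * Real.log ρ) := by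
  obtain ⟨C, hC, h⟩ := exists_norm_inv_Gamma_le (K := 2 / ħ) (by positivity)
  refine ⟨m * (n * C), by positivity, fun p ρ hρ hp => ?_⟩
  refine (norm_prod_le_exp _ _
    (fun a => ∑ b, (-((p (.inr b)).im - (p (.inl a)).im) / ħ * Real.log ρ + C * ρ))
    fun i _ => norm_prod_le_exp _ _ _ fun b _ => ?_).trans_eq ?_
  · refine (h ρ hρ _ ?_).trans_eq ?_
    · rw [norm_div_I_mul hħ, div_mul_eq_mul_div]
      gcongr
      refine (norm_sub_le _ _).trans ?_
      linarith [norm_le_pi_norm p (.inr b), norm_le_pi_norm p (.inl i)]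
    · rw [div_I_mul_re, Complex.sub_im]; ring_nf
  · congr 1
    simp only [Finset.sum_add_distrib, Finset.sum_const, Finset.card_univ, nsmul_eq_mul,
      Fintype.card_fin, ← Finset.sum_div, ← Finset.sum_mul, Finset.sum_neg_distrib]
    ring

theorem norm_sum_le_card_mul {N : ℕ} (y : Fin N → ℂ) : ‖∑ k, y k‖ ≤ N * ‖y‖ := by
  refine (norm_sum_le _ _).trans ((Finset.sum_le_sum fun k _ => norm_le_pi_norm y k).trans_eq ?_)
  simp

theorem exists_outerPart_growth {ħ : ℝ} (hħ : 0 < ħ) {m n : ℕ}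
    {F₁ : (Fin m → ℂ) × ℂ × (Fin (m + 1) → ℂ) → ℂ} {F₂ : (Fin n → ℂ) × ℂ × (Fin (n + 1) → ℂ) → ℂ}
    (h₁ : HasGrowth ħ F₁) (h₂ : HasGrowth ħ F₂) (X : ℝ) {κ : ℝ} (hκ : 0 < κ) :
    ∃ C : ℝ, 0 ≤ C ∧ ∀ y ε x (p : Fin m ⊕ Fin n → ℂ) (ρ : ℝ), ‖x‖ ≤ X → 2 + ‖p‖ ≤ ρ → ‖y‖ ≤ ρ →
      ‖outerPart ħ F₁ F₂ y ε x p‖ ≤ Real.exp (C * (ρ + ‖ε‖) + (spread (fun a => (p (.inl a)).im) +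
        spread (fun b => (p (.inr b)).im) - ∑ a, ∑ b, ((p (.inr b)).im - (p (.inl a)).im) + κ * ρ) / ħ *
          Real.log ρ) := by
  obtain ⟨C₁, hC₁, b₁⟩ := h₁ X (κ / 2) (by positivity)
  obtain ⟨C₂, hC₂, b₂⟩ := h₂ X (κ / 2) (by positivity)
  obtain ⟨C₃, hC₃, b₃⟩ := exists_crossPart_growth hħ m n
  obtain ⟨L, hL, b₄⟩ := exists_powPart_le hħ m n (m + n + 1)
  set N : ℝ := m + n + 1 with hN
  refine ⟨C₁ * (2 + N + n) + C₂ * (3 + N + n) + ‖weightConst ħ m n‖ + 2 * L + C₃, by positivity,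
    fun y ε x p ρ hx hp hy => ?_⟩
  have hp0 := norm_nonneg p
  have hρ : 2 ≤ ρ := by linarith
  have hρ0 : 0 ≤ ρ := by linarith
  have hlog : 0 ≤ Real.log ρ := Real.log_nonneg (by linarith)
  have hsy : ‖∑ k, y k‖ ≤ N * ρ := by
    refine (norm_sum_le_card_mul y).trans ?_
    rw [hN]; push_cast; gcongr
  have hnw : ‖fun a => p (.inl a)‖ ≤ ‖p‖ :=
    (pi_norm_le_iff_of_nonneg hp0).2 fun a => norm_le_pi_norm p _
  have hnz : ‖fun a => p (.inr a)‖ ≤ ‖p‖ :=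
    (pi_norm_le_iff_of_nonneg hp0).2 fun a => norm_le_pi_norm p _
  have hsz : ‖∑ k, p (.inr k)‖ ≤ n * ρ := by
    refine (norm_sum_le_card_mul fun b => p (.inr b)).trans ?_
    gcongr; linarith
  have key : ∀ (k : ℕ) (w : Fin k → ℂ) (e : ℂ) (C E : ℝ), 0 ≤ C → ‖w‖ ≤ ‖p‖ → 1 + ‖w‖ + ‖e‖ ≤ E →
      C * (1 + ‖w‖ + ‖e‖) + (spread (fun a => (w a).im) + κ / 2 * ‖w‖) / ħ * Real.log (2 + ‖w‖) ≤
      C * E + (spread (fun a => (w a).im) + κ / 2 * ρ) / ħ * Real.log ρ := by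
    intro k w e C E hC hw he
    have h0 := norm_nonneg w
    have hs := spread_nonneg fun a => (w a).im
    have h3 : Real.log (2 + ‖w‖) ≤ Real.log ρ := Real.log_le_log (by linarith) (by linarith)
    have h4 : ‖w‖ ≤ ρ := by linarith
    have h5 : 0 ≤ Real.log (2 + ‖w‖) := Real.log_nonneg (by linarith)
    gcongr
  have c₁ := (b₁ (fun a => p (.inl a)) (∑ k, y k - ∑ b, p (.inr b)) (headC x)
    ((norm_headC_le x).trans hx)).trans (Real.exp_le_exp.2 (key _ _ _ C₁ ((2 + N + n) * ρ) hC₁ hnw (by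
      have := norm_sub_le (∑ k, y k) (∑ b, p (.inr b))
      linarith)))
  have c₂ := (b₂ (fun a => p (.inr a)) (ε - ∑ k, y k + ∑ b, p (.inr b)) (tailC x)
    ((norm_tailC_le x).trans hx)).trans (Real.exp_le_exp.2 (key _ _ _ C₂ ((2 + N + n) * ρ + ‖ε‖) hC₂ hnz (by
      have h1 := norm_add_le (ε - ∑ k, y k) (∑ b, p (.inr b))
      have h2 := norm_sub_le ε (∑ k, y k)
      linarith)))
  have c₃ := b₃ p ρ hρ (by linarith)
  have himp : ∀ i, |(p i).im| ≤ ρ := fun i =>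
    (Complex.abs_im_le_norm _).trans ((norm_le_pi_norm p i).trans (by linarith))
  have himy : ∀ i, |(y i).im| ≤ ρ := fun i =>
    (Complex.abs_im_le_norm _).trans ((norm_le_pi_norm y i).trans hy)
  have c₄ := b₄ y p (2 * ρ) (by linarith) (fun i b => (abs_sub _ _).trans (by linarith [himp i, himy b]))
    (fun i b => (abs_sub _ _).trans (by linarith [himp i, himp b]))
  have c₅ : ‖weightConst ħ m n‖ ≤ Real.exp (‖weightConst ħ m n‖ * ρ) := by
    have h1 := Real.add_one_le_exp (‖weightConst ħ m n‖ * ρ)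
    nlinarith [norm_nonneg (weightConst ħ m n)]
  rw [outerPart]
  refine (norm_mul_le_exp (norm_mul_le_exp c₁ c₂) (norm_mul_le_exp (norm_mul_le_exp c₅ c₄) c₃)).trans
    (Real.exp_le_exp.2 ?_)
  have e0 := norm_nonneg ε
  have hA : C₁ * ((2 + N + n) * ρ) + C₂ * ((2 + N + n) * ρ + ‖ε‖) + ‖weightConst ħ m n‖ * ρ + L * (2 * ρ) +
      C₃ * ρ ≤ (C₁ * (2 + N + n) + C₂ * (3 + N + n) + ‖weightConst ħ m n‖ + 2 * L + C₃) * (ρ + ‖ε‖) := by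
    have hN0 : 0 ≤ N := by positivity
    have : 0 ≤ (C₁ * (2 + N + n) + C₂ * (2 + N + n) + ‖weightConst ħ m n‖ + 2 * L + C₃) * ‖ε‖ := by positivity
    have : 0 ≤ C₂ * ρ := by positivity
    nlinarith
  have hB : ∀ s₁ s₂ d : ℝ, (s₁ + κ / 2 * ρ) / ħ * Real.log ρ + (s₂ + κ / 2 * ρ) / ħ * Real.log ρ +
      -d / ħ * Real.log ρ = (s₁ + s₂ - d + κ * ρ) / ħ * Real.log ρ := by intros; ring
  have := hB (spread fun a => (p (.inl a)).im) (spread fun b => (p (.inr b)).im)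
    (∑ a, ∑ b, ((p (.inr b)).im - (p (.inl a)).im))
  linarith

theorem exists_kern_growth {ħ : ℝ} (hħ : 0 < ħ) {m n : ℕ}
    {F₁ : (Fin m → ℂ) × ℂ × (Fin (m + 1) → ℂ) → ℂ} {F₂ : (Fin n → ℂ) × ℂ × (Fin (n + 1) → ℂ) → ℂ}
    (h₁ : HasGrowth ħ F₁) (h₂ : HasGrowth ħ F₂) (X : ℝ) {κ : ℝ} (hκ : 0 < κ) :
    ∃ C : ℝ, 0 ≤ C ∧ ∀ y ε x (p : Fin m ⊕ Fin n → ℂ) (ρ : ℝ), ‖x‖ ≤ X → 2 + ‖p‖ ≤ ρ → ‖y‖ ≤ ρ →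
      (∀ i b, 1 ≤ sgn i * ((y b).im - (p i).im) ∨ 1 ≤ |(y b).re - (p i).re|) →
      ‖kern ħ (fun w e => F₁ (w, e, headC x)) (fun z e => F₂ (z, e, tailC x)) y ε p‖ ≤
        Real.exp (C * (ρ + ‖ε‖) + (energy (fun b => (y b).im) (fun i => sgn i * (p i).im) + κ * ρ) / ħ *
          Real.log ρ) := by
  obtain ⟨C₁, hC₁, b₁⟩ := exists_outerPart_growth hħ h₁ h₂ X hκ
  obtain ⟨C₂, hC₂, b₂⟩ := exists_diagPart_growth hħ m
  obtain ⟨C₃, hC₃, b₃⟩ := exists_diagPart_growth hħ n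
  obtain ⟨C₄, hC₄, b₄⟩ := exists_polePart_growth hħ m n (m + n + 1)
  refine ⟨C₁ + C₂ + C₃ + C₄, by positivity, fun y ε x p ρ hx hp hy hs => ?_⟩
  have hp0 := norm_nonneg p
  have hnw : ‖fun a => p (.inl a)‖ ≤ ‖p‖ :=
    (pi_norm_le_iff_of_nonneg hp0).2 fun a => norm_le_pi_norm p _
  have hnz : ‖fun a => p (.inr a)‖ ≤ ‖p‖ :=
    (pi_norm_le_iff_of_nonneg hp0).2 fun a => norm_le_pi_norm p _
  rw [kern_eq_outerPart]
  refine (norm_mul_le_exp (b₁ y ε x p ρ hx hp hy) (norm_mul_le_exp (norm_mul_le_exp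
    (b₂ _ ρ (by linarith) (by linarith)) (b₃ _ ρ (by linarith) (by linarith)))
    (b₄ p y ρ (by linarith) (by linarith) hy hs))).trans (Real.exp_le_exp.2 ?_)
  rw [← energy_eq]
  have : 0 ≤ (C₂ + C₃ + C₄) * ‖ε‖ := by positivity
  have hB : ∀ a b c : ℝ, (a + κ * ρ) / ħ * Real.log ρ + c / ħ * Real.log ρ =
      (c + a + κ * ρ) / ħ * Real.log ρ := by intros; ring
  have := hB (spread (fun a => (p (.inl a)).im) + spread (fun b => (p (.inr b)).im) -
    ∑ a, ∑ b, ((p (.inr b)).im - (p (.inl a)).im)) 0 (∑ i, ∑ b, sgn i * ((y b).im - (p i).im))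
  have e : ∑ i, ∑ b, sgn i * ((y b).im - (p i).im) + spread (fun a => (p (.inl a)).im) +
      spread (fun b => (p (.inr b)).im) - ∑ a, ∑ b, ((p (.inr b)).im - (p (.inl a)).im) + κ * ρ =
      ∑ i, ∑ b, sgn i * ((y b).im - (p i).im) + (spread (fun a => (p (.inl a)).im) +
      spread (fun b => (p (.inr b)).im) - ∑ a, ∑ b, ((p (.inr b)).im - (p (.inl a)).im)) + κ * ρ := by ring
  rw [e]
  linarith

/-- The point of the tilted contours with complex parameter `τ`. -/
def tiltPt {m n : ℕ} (R c : ℝ) (τ : Fin m ⊕ Fin n → ℂ) : Fin m ⊕ Fin n → ℂ :=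
  fun i => R * Complex.sinh (τ i) - ((sgn i * c : ℝ) : ℂ) * Complex.I

/-- The parameters on the contours tilted by the angles `ϑ i`. -/
def ang {m n : ℕ} (ϑ t : Fin m ⊕ Fin n → ℝ) : Fin m ⊕ Fin n → ℂ :=
  fun i => t i + ((ϑ i * sgn i : ℝ) : ℂ) * Complex.I

theorem cos_mul_sgn {m n : ℕ} (θ : ℝ) (i : Fin m ⊕ Fin n) : Real.cos (θ * sgn i) = Real.cos θ := by
  cases i <;> simp [sgn]

theorem sin_mul_sgn {m n : ℕ} (θ : ℝ) (i : Fin m ⊕ Fin n) :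
    Real.sin (θ * sgn i) = sgn i * Real.sin θ := by
  cases i <;> simp [sgn]

theorem sinh_add_mul_I_re (a b : ℝ) :
    (Complex.sinh (a + b * Complex.I)).re = Real.sinh a * Real.cos b := by
  rw [Complex.sinh_add, Complex.sinh_mul_I, Complex.cosh_mul_I]
  simp [Complex.sinh_ofReal_re, Complex.cosh_ofReal_re, Complex.sin_ofReal_re, Complex.cos_ofReal_re]

theorem sinh_add_mul_I_im (a b : ℝ) :
    (Complex.sinh (a + b * Complex.I)).im = Real.cosh a * Real.sin b := by
  rw [Complex.sinh_add, Complex.sinh_mul_I, Complex.cosh_mul_I]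
  simp [Complex.sinh_ofReal_re, Complex.cosh_ofReal_re, Complex.sin_ofReal_re, Complex.cos_ofReal_re]

theorem cosh_add_mul_I_re (a b : ℝ) :
    (Complex.cosh (a + b * Complex.I)).re = Real.cosh a * Real.cos b := by
  rw [Complex.cosh_add, Complex.sinh_mul_I, Complex.cosh_mul_I]
  simp [Complex.sinh_ofReal_re, Complex.cosh_ofReal_re, Complex.sin_ofReal_re, Complex.cos_ofReal_re]

theorem norm_sinh_le (z : ℂ) : ‖Complex.sinh z‖ ≤ Real.cosh z.re := by
  rw [Complex.sinh, Real.cosh_eq, norm_div, Complex.norm_ofNat]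
  gcongr
  refine (norm_sub_le _ _).trans_eq ?_
  simp [Complex.norm_exp]

theorem norm_cosh_le (z : ℂ) : ‖Complex.cosh z‖ ≤ Real.cosh z.re := by
  rw [Complex.cosh, Real.cosh_eq, norm_div, Complex.norm_ofNat]
  gcongr
  refine (norm_add_le _ _).trans_eq ?_
  simp [Complex.norm_exp]

theorem cosh_le_one_add_abs_sinh (t : ℝ) : Real.cosh t ≤ 1 + |Real.sinh t| := by
  have h := Real.cosh_sq t
  have := sq_abs (Real.sinh t)
  nlinarith [abs_nonneg (Real.sinh t), Real.cosh_pos t]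

theorem one_add_sq_le_two_mul_cosh (t : ℝ) : 1 + t ^ 2 ≤ 2 * Real.cosh t := by
  have h1 : Real.cosh t = 1 + 2 * Real.sinh (t / 2) ^ 2 := by
    have := Real.cosh_two_mul (t / 2)
    rw [show 2 * (t / 2) = t by ring] at this
    rw [this, Real.cosh_sq]; ring
  have h2 : (t / 2) ^ 2 ≤ Real.sinh (t / 2) ^ 2 := by
    rw [← sq_abs (t / 2), ← sq_abs (Real.sinh (t / 2)), Real.abs_sinh]
    have := Real.self_le_sinh_iff.2 (abs_nonneg (t / 2))
    gcongr
  nlinarith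

section Geometry
variable {m n : ℕ} {R c : ℝ}

theorem ang_re (ϑ t : Fin m ⊕ Fin n → ℝ) (i) : (ang ϑ t i).re = t i := by simp [ang]

theorem tiltPt_ang_re (ϑ t : Fin m ⊕ Fin n → ℝ) (i) :
    (tiltPt R c (ang ϑ t) i).re = R * (Real.sinh (t i) * Real.cos (ϑ i)) := by
  rw [tiltPt, Complex.sub_re, Complex.re_ofReal_mul, ang, sinh_add_mul_I_re, cos_mul_sgn]
  simp

theorem sgn_mul_tiltPt_ang_im (ϑ t : Fin m ⊕ Fin n → ℝ) (i) :
    sgn i * (tiltPt R c (ang ϑ t) i).im = R * Real.sin (ϑ i) * Real.cosh (t i) - c := by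
  rw [tiltPt, Complex.sub_im, Complex.im_ofReal_mul, ang, sinh_add_mul_I_im, sin_mul_sgn,
    Complex.im_ofReal_mul, Complex.I_im]
  have := sgn_mul_sgn i
  linear_combination (R * Real.cosh (t i) * Real.sin (ϑ i) - c) * this

theorem norm_tiltPt_le (hR : 0 ≤ R) (τ : Fin m ⊕ Fin n → ℂ) (i) :
    ‖tiltPt R c τ i‖ ≤ R * Real.cosh (τ i).re + |c| := by
  rw [tiltPt]
  refine (norm_sub_le _ _).trans ?_
  rw [norm_mul, norm_mul, Complex.norm_I, Complex.norm_real, Complex.norm_real, Real.norm_of_nonneg hR,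
    Real.norm_eq_abs, abs_mul, abs_sgn, one_mul, mul_one]
  have := norm_sinh_le (τ i)
  gcongr

theorem norm_tiltPt_ang_le (hR : 0 ≤ R) (ϑ t : Fin m ⊕ Fin n → ℝ) :
    ‖tiltPt R c (ang ϑ t)‖ ≤ R * ∑ i, Real.cosh (t i) + |c| := by
  have h0 : 0 ≤ ∑ i, Real.cosh (t i) := Finset.sum_nonneg fun i _ => (Real.cosh_pos _).le
  refine (pi_norm_le_iff_of_nonneg (by positivity)).2 fun i => (norm_tiltPt_le hR _ i).trans ?_
  rw [ang_re]
  have := Finset.single_le_sum (f := fun i => Real.cosh (t i)) (fun i _ => (Real.cosh_pos _).le)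
    (Finset.mem_univ i)
  gcongr

theorem sin_le_cos_of_le_pi_div_four {θ : ℝ} (h0 : 0 ≤ θ) (h : θ ≤ Real.pi / 4) :
    Real.sin θ ≤ Real.cos θ := by
  rw [← Real.sin_pi_div_two_sub]
  have := Real.pi_pos
  exact Real.sin_le_sin_of_le_of_le_pi_div_two (by linarith) (by linarith) (by linarith)

/-- On the tilted contours the integration variables stay away from the poles. -/
theorem tiltPt_separated (hR : 0 < R) {N : ℕ} {y : Fin N → ℂ} {B : ℝ} (hy : ‖y‖ ≤ B)
    {ϑ : Fin m ⊕ Fin n → ℝ} {i : Fin m ⊕ Fin n} (h0 : 0 ≤ ϑ i) (h1 : ϑ i ≤ Real.pi / 4)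
    (hc : R * Real.sin (ϑ i) + 2 * B + 2 ≤ c) (t : Fin m ⊕ Fin n → ℝ) (b : Fin N) :
    1 ≤ sgn i * ((y b).im - (tiltPt R c (ang ϑ t) i).im) ∨
      1 ≤ |(y b).re - (tiltPt R c (ang ϑ t) i).re| := by
  by_contra! h
  obtain ⟨ha, hb⟩ := h
  have hyb := (norm_le_pi_norm y b).trans hy
  have hre := (Complex.abs_re_le_norm (y b)).trans hyb
  have him := (Complex.abs_im_le_norm (y b)).trans hyb
  have hs := sin_le_cos_of_le_pi_div_four h0 h1
  have hs0 : 0 ≤ Real.sin (ϑ i) := Real.sin_nonneg_of_nonneg_of_le_pi h0 (by linarith [Real.pi_pos])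
  rw [mul_sub, sgn_mul_tiltPt_ang_im] at ha
  rw [tiltPt_ang_re] at hb
  have h2 : |R * (Real.sinh (t i) * Real.cos (ϑ i))| ≤ B + 1 := by
    have := abs_sub_abs_le_abs_sub (R * (Real.sinh (t i) * Real.cos (ϑ i))) (y b).re
    rw [abs_sub_comm] at this
    linarith
  rw [abs_mul, abs_mul, abs_of_pos hR, abs_of_nonneg (hs0.trans hs)] at h2
  have h3 : R * Real.sin (ϑ i) * Real.cosh (t i) ≤ R * Real.sin (ϑ i) + (B + 1) := by
    have h4 := cosh_le_one_add_abs_sinh (t i)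
    calc _ ≤ R * Real.sin (ϑ i) * (1 + |Real.sinh (t i)|) := by gcongr
      _ = R * Real.sin (ϑ i) + R * (|Real.sinh (t i)| * Real.sin (ϑ i)) := by ring
      _ ≤ R * Real.sin (ϑ i) + R * (|Real.sinh (t i)| * Real.cos (ϑ i)) := by gcongr
      _ ≤ _ := by gcongr
  have h5 := neg_abs_le (sgn i * (y b).im)
  rw [abs_mul, abs_sgn] at h5
  linarith

theorem tiltPt_separated' (hR : 0 < R) {N : ℕ} {y : Fin N → ℂ} {B : ℝ} (hy : ‖y‖ ≤ B)
    {ϑ : Fin m ⊕ Fin n → ℝ} {i : Fin m ⊕ Fin n} (h0 : 0 ≤ ϑ i) (h1 : ϑ i ≤ Real.pi / 4)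
    (hc : R * Real.sin (ϑ i) + 2 * B + 2 ≤ c) (t : Fin m ⊕ Fin n → ℝ) (b : Fin N) :
    0 < sgn i * ((y b).im - (tiltPt R c (ang ϑ t) i).im) ∨
      (y b).re - (tiltPt R c (ang ϑ t) i).re ≠ 0 :=
  (tiltPt_separated hR hy h0 h1 hc t b).imp (fun h => one_pos.trans_le h) fun h h' => by
    rw [h', abs_zero] at h; exact absurd h (by norm_num)

end Geometry

theorem mul_sub_mul_log_le {a s ρ : ℝ} (ha : 0 ≤ a) (hs : 0 < s) (hρ : 1 ≤ ρ) :
    a * ρ - s * ρ * Real.log ρ ≤ a * Real.exp (a / s) := by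
  rcases le_total (Real.log ρ) (a / s) with h | h
  · have h2 : ρ ≤ Real.exp (a / s) := (Real.log_le_iff_le_exp (by linarith)).1 h
    have h3 : 0 ≤ s * ρ * Real.log ρ := by have := Real.log_nonneg hρ; positivity
    nlinarith
  · have h2 : a ≤ s * Real.log ρ := by rwa [div_le_iff₀ hs, mul_comm] at h
    have : 0 ≤ a * Real.exp (a / s) := by positivity
    nlinarith

theorem differentiableAt_kern_param {E : Type*} [NormedAddCommGroup E] [NormedSpace ℂ E] {ħ : ℝ}
    (hħ : 0 < ħ) {m n : ℕ} {F₁ : (Fin m → ℂ) × ℂ × (Fin (m + 1) → ℂ) → ℂ}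
    {F₂ : (Fin n → ℂ) × ℂ × (Fin (n + 1) → ℂ) → ℂ} (hF₁ : Differentiable ℂ F₁)
    (hF₂ : Differentiable ℂ F₂) {Y : E → Fin (m + n + 1) → ℂ} {Z : E → ℂ}
    {X : E → Fin (m + n + 1 + 1) → ℂ} {P : E → Fin m ⊕ Fin n → ℂ} {e₀ : E}
    (hY : DifferentiableAt ℂ Y e₀) (hZ : DifferentiableAt ℂ Z e₀) (hX : DifferentiableAt ℂ X e₀)
    (hP : DifferentiableAt ℂ P e₀)
    (h : ∀ i b, 0 < sgn i * ((Y e₀ b).im - (P e₀ i).im) ∨ (Y e₀ b).re - (P e₀ i).re ≠ 0) :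
    DifferentiableAt ℂ (fun e => kern ħ (fun w a => F₁ (w, a, headC (X e)))
      (fun z a => F₂ (z, a, tailC (X e))) (Y e) (Z e) (P e)) e₀ := by
  have hY' := differentiableAt_pi.1 hY
  have hX' := differentiableAt_pi.1 hX
  have hP' := differentiableAt_pi.1 hP
  have hsY : DifferentiableAt ℂ (fun e => ∑ k, Y e k) e₀ := DifferentiableAt.fun_sum fun k _ => hY' k
  have hsP : DifferentiableAt ℂ (fun e => ∑ k, P e (.inr k)) e₀ :=
    DifferentiableAt.fun_sum fun k _ => hP' _
  unfold kern
  refine DifferentiableAt.mul (DifferentiableAt.mul ?_ ?_) (differentiableAt_weight hħ hP hY ?_)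
  · exact (hF₁ _).comp e₀ (f := fun e =>
      (fun a => P e (.inl a), ∑ k, Y e k - ∑ b, P e (.inr b), headC (X e)))
      ((differentiableAt_pi.2 fun a => hP' _).prodMk ((hsY.sub hsP).prodMk
        (differentiableAt_pi.2 fun a => hX' _)))
  · exact (hF₂ _).comp e₀ (f := fun e =>
      (fun b => P e (.inr b), Z e - ∑ k, Y e k + ∑ b, P e (.inr b), tailC (X e)))
      ((differentiableAt_pi.2 fun a => hP' _).prodMk (((hZ.sub hsY).add hsP).prodMk
        (differentiableAt_pi.2 fun a => hX' _)))
  · intro i b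
    rw [div_I_mul_re, div_I_mul_im]
    rcases h i b with h | h
    · left
      rw [Complex.im_ofReal_mul, Complex.sub_im]
      positivity
    · right
      rw [Complex.re_ofReal_mul, Complex.sub_re]
      have : sgn i ≠ 0 := by
        intro h0; have := abs_sgn i; rw [h0] at this; simp at this
      simp only [ne_eq, div_eq_zero_iff, neg_eq_zero, mul_eq_zero, hħ.ne', or_false, this, false_or]
      exact h

/-- The integrand on the tilted contours, including the Jacobian of the parametrisation. -/
def tiltKern (ħ : ℝ) {m n : ℕ} (F₁ : (Fin m → ℂ) × ℂ × (Fin (m + 1) → ℂ) → ℂ)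
    (F₂ : (Fin n → ℂ) × ℂ × (Fin (n + 1) → ℂ) → ℂ) (R c : ℝ)
    (q : (Fin (m + n + 1) → ℂ) × ℂ × (Fin (m + n + 1 + 1) → ℂ)) (τ : Fin m ⊕ Fin n → ℂ) : ℂ :=
  (∏ i, (R : ℂ) * Complex.cosh (τ i)) *
    kern ħ (fun w a => F₁ (w, a, headC q.2.2)) (fun z a => F₂ (z, a, tailC q.2.2)) q.1 q.2.1
      (tiltPt R c τ)

/-- The integral over the contours tilted by the angle `θ`. -/
def tiltInt (ħ : ℝ) {m n : ℕ} (F₁ : (Fin m → ℂ) × ℂ × (Fin (m + 1) → ℂ) → ℂ)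
    (F₂ : (Fin n → ℂ) × ℂ × (Fin (n + 1) → ℂ) → ℂ) (R c θ : ℝ)
    (q : (Fin (m + n + 1) → ℂ) × ℂ × (Fin (m + n + 1 + 1) → ℂ)) : ℂ :=
  ∫ t, tiltKern ħ F₁ F₂ R c q (ang (fun _ => θ) t)

theorem norm_jacobian_le {m n : ℕ} {R : ℝ} (hR : 0 ≤ R) (ϑ t : Fin m ⊕ Fin n → ℝ) :
    ‖∏ i, (R : ℂ) * Complex.cosh (ang ϑ t i)‖ ≤ Real.exp (R * ∑ i, Real.cosh (t i)) := by
  rw [Finset.mul_sum]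
  refine norm_prod_le_exp _ _ _ fun i _ => ?_
  rw [norm_mul, Complex.norm_real, Real.norm_of_nonneg hR]
  have h1 := norm_cosh_le (ang ϑ t i)
  rw [ang_re] at h1
  have h2 := Real.add_one_le_exp (R * Real.cosh (t i))
  have : R * ‖Complex.cosh (ang ϑ t i)‖ ≤ R * Real.cosh (t i) := by gcongr
  linarith

theorem differentiable_tiltPt {m n : ℕ} (R c : ℝ) :
    Differentiable ℂ (tiltPt R c : (Fin m ⊕ Fin n → ℂ) → _) :=
  differentiable_pi.2 fun i => (((Complex.differentiable_sinh).comp (differentiable_apply i)).const_mul _).sub_const _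

theorem continuous_ang {m n : ℕ} (ϑ : Fin m ⊕ Fin n → ℝ) : Continuous (ang ϑ) :=
  continuous_pi fun i =>
    (Complex.continuous_ofReal.comp (continuous_apply i)).add continuous_const

section Tilt
variable {ħ : ℝ} {m n : ℕ} {F₁ : (Fin m → ℂ) × ℂ × (Fin (m + 1) → ℂ) → ℂ}
  {F₂ : (Fin n → ℂ) × ℂ × (Fin (n + 1) → ℂ) → ℂ}

theorem differentiableAt_tiltKern (hħ : 0 < ħ) (hF₁ : Differentiable ℂ F₁)
    (hF₂ : Differentiable ℂ F₂) {R c : ℝ} (hR : 0 < R) (q : (Fin (m + n + 1) → ℂ) × ℂ × (Fin (m + n + 1 + 1) → ℂ))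
    (ϑ t : Fin m ⊕ Fin n → ℝ) (h0 : ∀ i, 0 ≤ ϑ i) (h1 : ∀ i, ϑ i ≤ Real.pi / 4)
    (hc : ∀ i, R * Real.sin (ϑ i) + 2 * ‖q.1‖ + 2 ≤ c) :
    DifferentiableAt ℂ (tiltKern ħ F₁ F₂ R c q) (ang ϑ t) := by
  unfold tiltKern
  refine DifferentiableAt.mul ?_ ?_
  · exact differentiableAt_prod fun i _ =>
      ((Complex.differentiable_cosh.comp (differentiable_apply i)) _).const_mul _
  · exact differentiableAt_kern_param hħ hF₁ hF₂ (differentiableAt_const _) (differentiableAt_const _)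
      (differentiableAt_const _) (differentiable_tiltPt R c _)
      fun i b => tiltPt_separated' hR le_rfl (h0 i) (h1 i) (hc i) t b

/-- The growth estimate for a value `v` of an integrand at the point `p`. -/
def GrowthAt (ħ C κ : ℝ) (y : Fin (m + n + 1) → ℂ) (ε : ℂ) (p : Fin m ⊕ Fin n → ℂ) (v : ℂ) : Prop :=
  ∀ ρ : ℝ, 2 + ‖p‖ ≤ ρ → ‖y‖ ≤ ρ → ‖v‖ ≤ Real.exp (C * (ρ + ‖ε‖) +
    (energy (fun b => (y b).im) (fun i => sgn i * (p i).im) + κ * ρ) / ħ * Real.log ρ)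

theorem exists_jacobian_mul_growth (hħ : 0 < ħ) (m n : ℕ) {C : ℝ} (hC : 0 ≤ C) {R : ℝ} (hR : 0 < R)
    (c B E : ℝ) (hB : 0 ≤ B) (hE : 0 ≤ E) (κ : ℝ) : ∃ C' A D : ℝ, 0 ≤ C' ∧ 0 ≤ A ∧ 2 ≤ D ∧
      ∀ (y : Fin (m + n + 1) → ℂ) (ε : ℂ), ‖y‖ ≤ B → ‖ε‖ ≤ E → ∀ ϑ t : Fin m ⊕ Fin n → ℝ, (∀ i, 0 ≤ ϑ i) →
      (∀ i, ϑ i ≤ Real.pi / 4) → ∀ v : ℂ, GrowthAt ħ C κ y ε (tiltPt R c (ang ϑ t)) v →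
      ‖(∏ i, (R : ℂ) * Complex.cosh (ang ϑ t i)) * v‖ ≤ Real.exp (C' * (D + R * ∑ i, Real.cosh (t i)) +
        (A - 2 * ∑ i, R * Real.sin (ϑ i) * Real.cosh (t i) + κ * (D + R * ∑ i, Real.cosh (t i))) / ħ *
          Real.log (D + R * ∑ i, Real.cosh (t i))) := by
  refine ⟨2 * C + 1, (m + n) * ((m + n + 1) * B) + (m * (m + 1) + n * (n + 1)) * |c|, 2 + B + E + |c|, by positivity,
    by positivity, by linarith [abs_nonneg c], fun y ε hy hε ϑ t h0 h1 v hv => ?_⟩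
  set χ := ∑ i, Real.cosh (t i) with hχ
  have hχ0 : 0 ≤ χ := Finset.sum_nonneg fun i _ => (Real.cosh_pos _).le
  have hRχ : 0 ≤ R * χ := by positivity
  set ρ := 2 + B + E + |c| + R * χ with hρ
  have hp := norm_tiltPt_ang_le (c := c) hR.le ϑ t
  have hs0 : ∀ i, 0 ≤ Real.sin (ϑ i) := fun i =>
    Real.sin_nonneg_of_nonneg_of_le_pi (h0 i) (by linarith [Real.pi_pos, h1 i])
  have hk := hv ρ (by linarith) (by linarith [abs_nonneg c])
  refine (norm_mul_le_exp (norm_jacobian_le hR.le ϑ t) hk).trans (Real.exp_le_exp.2 ?_)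
  simp only [sgn_mul_tiltPt_ang_im]
  have hen := energy_add_le (fun b => (y b).im) (fun _ : Fin m ⊕ Fin n => -c)
    (fun i => R * Real.sin (ϑ i) * Real.cosh (t i)) fun i => by
      have := hs0 i
      have := Real.cosh_pos (t i)
      positivity
  rw [energy_const] at hen
  simp only [neg_add_eq_sub] at hen
  have hsY : |∑ b, (y b).im| ≤ (m + n + 1) * B := by
    refine (Finset.abs_sum_le_sum_abs _ _).trans ((Finset.sum_le_sum fun b _ =>
      (Complex.abs_im_le_norm _).trans ((norm_le_pi_norm y b).trans hy)).trans_eq ?_)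
    simp
  have hA : (m - n) * ∑ b, (y b).im ≤ (m + n) * ((m + n + 1) * B) := by
    refine (le_abs_self _).trans ?_
    rw [abs_mul]
    have : |(m:ℝ) - n| ≤ m + n := abs_le.2 ⟨by
      have : (0:ℝ) ≤ m := by positivity
      linarith, by
      have : (0:ℝ) ≤ n := by positivity
      linarith⟩
    gcongr
  have hA2 : -((m * (m + 1) + n * (n + 1)) * -c) ≤ (m * (m + 1) + n * (n + 1)) * |c| := by
    rw [mul_neg, neg_neg]
    gcongr
    exact le_abs_self c
  have hlog : 0 ≤ Real.log ρ := Real.log_nonneg (by linarith [abs_nonneg c])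
  have : R * χ + C * (ρ + ‖ε‖) ≤ (2 * C + 1) * ρ := by
    have : C * ‖ε‖ ≤ C * ρ := by
      gcongr
      linarith [abs_nonneg c]
    nlinarith [abs_nonneg c]
  rw [← add_assoc]
  gcongr
  linarith

theorem exists_jacobian_mul_le_exp_sq (hħ : 0 < ħ) (m n : ℕ) {C : ℝ} (hC : 0 ≤ C) {R : ℝ} (hR : 0 < R)
    (c B E : ℝ) (hB : 0 ≤ B) (hE : 0 ≤ E) {κ : ℝ} (hκ : 0 < κ) : ∃ K : ℝ, 0 ≤ K ∧
      ∀ (y : Fin (m + n + 1) → ℂ) (ε : ℂ), ‖y‖ ≤ B → ‖ε‖ ≤ E → ∀ ϑ t : Fin m ⊕ Fin n → ℝ, (∀ i, 0 ≤ ϑ i) →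
      (∀ i, ϑ i ≤ Real.pi / 4) → ∀ v : ℂ, GrowthAt ħ C κ y ε (tiltPt R c (ang ϑ t)) v →
      ‖(∏ i, (R : ℂ) * Complex.cosh (ang ϑ t i)) * v‖ ≤
        Real.exp (K * (1 + ∑ i, Real.cosh (t i)) ^ 2) := by
  obtain ⟨C, A, D, hC, hA, hD, h⟩ := exists_jacobian_mul_growth hħ m n hC hR c B E hB hE κ
  refine ⟨(C + (A + κ) / ħ) * (D + R) ^ 2, by positivity, fun y ε hy hε ϑ t h0 h1 v hv =>
    (h y ε hy hε ϑ t h0 h1 v hv).trans (Real.exp_le_exp.2 ?_)⟩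
  set χ := ∑ i, Real.cosh (t i) with hχ
  have hχ0 : 0 ≤ χ := Finset.sum_nonneg fun i _ => (Real.cosh_pos _).le
  have hs : 0 ≤ ∑ i, R * Real.sin (ϑ i) * Real.cosh (t i) := Finset.sum_nonneg fun i _ => by
    have := Real.sin_nonneg_of_nonneg_of_le_pi (h0 i) (by linarith [Real.pi_pos, h1 i])
    have := Real.cosh_pos (t i)
    positivity
  set ρ := D + R * χ with hρ
  have hRχ : 0 ≤ R * χ := by positivity
  have hρ1 : 1 ≤ ρ := by linarith
  have hlog := Real.log_nonneg hρ1
  have hlog' : Real.log ρ ≤ ρ := (Real.log_le_sub_one_of_pos (by linarith)).trans (by linarith)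
  have e1 : (A - 2 * ∑ i, R * Real.sin (ϑ i) * Real.cosh (t i) + κ * ρ) / ħ * Real.log ρ ≤ (A + κ) / ħ * ρ ^ 2 := by
    calc _ ≤ ((A + κ) * ρ) / ħ * ρ := by
          gcongr
          nlinarith
      _ = _ := by ring
  have e2 : C * ρ ≤ C * ρ ^ 2 := by gcongr; nlinarith
  have e3 : ρ ≤ (D + R) * (1 + χ) := by nlinarith
  calc _ ≤ (C + (A + κ) / ħ) * ρ ^ 2 := by linarith
    _ ≤ (C + (A + κ) / ħ) * ((D + R) * (1 + χ)) ^ 2 := by gcongr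
    _ = _ := by ring

theorem exists_jacobian_mul_le_exp_neg (hħ : 0 < ħ) (m n : ℕ) {C : ℝ} (hC : 0 ≤ C) {R : ℝ} (hR : 0 < R)
    (c B E : ℝ) (hB : 0 ≤ B) (hE : 0 ≤ E) {κ σ : ℝ} (hκ : 0 < κ) (hσ : κ ≤ σ) : ∃ K : ℝ,
      ∀ (y : Fin (m + n + 1) → ℂ) (ε : ℂ), ‖y‖ ≤ B → ‖ε‖ ≤ E → ∀ ϑ t : Fin m ⊕ Fin n → ℝ, (∀ i, 0 ≤ ϑ i) →
      (∀ i, ϑ i ≤ Real.pi / 4) → (∀ i, σ ≤ Real.sin (ϑ i)) →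
      ∀ v : ℂ, GrowthAt ħ C κ y ε (tiltPt R c (ang ϑ t)) v →
      ‖(∏ i, (R : ℂ) * Complex.cosh (ang ϑ t i)) * v‖ ≤ Real.exp (K - ∑ i, Real.cosh (t i)) := by
  obtain ⟨C, A, D, hC, hA, hD, h⟩ := exists_jacobian_mul_growth hħ m n hC hR c B E hB hE κ
  replace hκ := hκ.trans_le hσ
  set a := C + (A + 2 * σ * D) / ħ + R⁻¹ with ha
  refine ⟨a * Real.exp (a / (σ / ħ)), fun y ε hy hε ϑ t h0 h1 h2 v hv =>
    (h y ε hy hε ϑ t h0 h1 v hv).trans (Real.exp_le_exp.2 ?_)⟩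
  set χ := ∑ i, Real.cosh (t i) with hχ
  have hχ0 : 0 ≤ χ := Finset.sum_nonneg fun i _ => (Real.cosh_pos _).le
  have hs : R * σ * χ ≤ ∑ i, R * Real.sin (ϑ i) * Real.cosh (t i) := by
    rw [hχ, Finset.mul_sum]
    refine Finset.sum_le_sum fun i _ => ?_
    have := h2 i
    have := Real.cosh_pos (t i)
    gcongr
  set ρ := D + R * χ with hρ
  have hRχ : 0 ≤ R * χ := by positivity
  have hρ1 : 1 ≤ ρ := by linarith
  have hlog := Real.log_nonneg hρ1
  have hlog' : Real.log ρ ≤ ρ := (Real.log_le_sub_one_of_pos (by linarith)).trans (by linarith)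
  have ha0 : 0 ≤ a := by positivity
  have key := mul_sub_mul_log_le ha0 (div_pos hκ hħ) hρ1
  have e1 : (A - 2 * ∑ i, R * Real.sin (ϑ i) * Real.cosh (t i) + κ * ρ) / ħ * Real.log ρ ≤
      (A + 2 * σ * D) / ħ * ρ - σ / ħ * ρ * Real.log ρ := by
    calc _ ≤ (A + 2 * σ * D - σ * ρ) / ħ * Real.log ρ := by
          gcongr
          nlinarith
      _ = (A + 2 * σ * D) / ħ * Real.log ρ - σ / ħ * ρ * Real.log ρ := by ring
      _ ≤ _ := by gcongr
  have e2 : χ ≤ R⁻¹ * ρ := by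
    rw [hρ, mul_add, inv_mul_cancel_left₀ hR.ne']
    have : 0 ≤ R⁻¹ * D := by positivity
    linarith
  linarith

theorem exists_growthAt_kern (hħ : 0 < ħ) (h₁ : HasGrowth ħ F₁) (h₂ : HasGrowth ħ F₂) (X : ℝ) {κ : ℝ}
    (hκ : 0 < κ) : ∃ C : ℝ, 0 ≤ C ∧ ∀ y ε x (p : Fin m ⊕ Fin n → ℂ), ‖x‖ ≤ X →
      (∀ i b, 1 ≤ sgn i * ((y b).im - (p i).im) ∨ 1 ≤ |(y b).re - (p i).re|) →
      GrowthAt ħ C κ y ε p (kern ħ (fun w e => F₁ (w, e, headC x)) (fun z e => F₂ (z, e, tailC x)) y ε p) := by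
  obtain ⟨C, hC, h⟩ := exists_kern_growth hħ h₁ h₂ X hκ
  exact ⟨C, hC, fun y ε x p hx hs ρ hρ hy => h y ε x p ρ hx hρ hy hs⟩

theorem exists_tiltKern_le_exp_sq (hħ : 0 < ħ) (h₁ : HasGrowth ħ F₁) (h₂ : HasGrowth ħ F₂) {R : ℝ} (hR : 0 < R)
    (c X B E : ℝ) (hB : 0 ≤ B) (hE : 0 ≤ E) : ∃ K : ℝ, 0 ≤ K ∧ ∀ q : (Fin (m + n + 1) → ℂ) × ℂ × (Fin (m + n + 1 + 1) → ℂ),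
      ‖q.1‖ ≤ B → ‖q.2.1‖ ≤ E → ‖q.2.2‖ ≤ X → ∀ ϑ t : Fin m ⊕ Fin n → ℝ, (∀ i, 0 ≤ ϑ i) →
      (∀ i, ϑ i ≤ Real.pi / 4) → (∀ i, R * Real.sin (ϑ i) + 2 * B + 2 ≤ c) →
      ‖tiltKern ħ F₁ F₂ R c q (ang ϑ t)‖ ≤ Real.exp (K * (1 + ∑ i, Real.cosh (t i)) ^ 2) := by
  obtain ⟨C, hC, hg⟩ := exists_growthAt_kern hħ h₁ h₂ X one_pos
  obtain ⟨K, hK, h⟩ := exists_jacobian_mul_le_exp_sq hħ m n hC hR c B E hB hE one_pos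
  exact ⟨K, hK, fun q hy hε hx ϑ t h0 h1 hc => h q.1 q.2.1 hy hε ϑ t h0 h1 _
    (hg _ _ _ _ hx fun i b => tiltPt_separated hR hy (h0 i) (h1 i) (hc i) t b)⟩

theorem exists_tiltKern_le_exp_neg (hħ : 0 < ħ) (h₁ : HasGrowth ħ F₁) (h₂ : HasGrowth ħ F₂) {R : ℝ} (hR : 0 < R)
    (c X B E : ℝ) (hB : 0 ≤ B) (hE : 0 ≤ E) {σ : ℝ} (hσ : 0 < σ) : ∃ K : ℝ, ∀ q : (Fin (m + n + 1) → ℂ) × ℂ × (Fin (m + n + 1 + 1) → ℂ),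
      ‖q.1‖ ≤ B → ‖q.2.1‖ ≤ E → ‖q.2.2‖ ≤ X → ∀ ϑ t : Fin m ⊕ Fin n → ℝ, (∀ i, 0 ≤ ϑ i) →
      (∀ i, ϑ i ≤ Real.pi / 4) → (∀ i, σ ≤ Real.sin (ϑ i)) → (∀ i, R * Real.sin (ϑ i) + 2 * B + 2 ≤ c) →
      ‖tiltKern ħ F₁ F₂ R c q (ang ϑ t)‖ ≤ Real.exp (K - ∑ i, Real.cosh (t i)) := by
  obtain ⟨C, hC, hg⟩ := exists_growthAt_kern hħ h₁ h₂ X hσ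
  obtain ⟨K, h⟩ := exists_jacobian_mul_le_exp_neg hħ m n hC hR c B E hB hE hσ le_rfl
  exact ⟨K, fun q hy hε hx ϑ t h0 h1 h2 hc => h q.1 q.2.1 hy hε ϑ t h0 h1 h2 _
    (hg _ _ _ _ hx fun i b => tiltPt_separated hR hy (h0 i) (h1 i) (hc i) t b)⟩

end Tilt

theorem exp_neg_sum_cosh_le {ι : Type*} [Fintype ι] {a : ℝ} (ha : 0 < a) (t : ι → ℝ) :
    Real.exp (-a * ∑ i, Real.cosh (t i)) ≤ (2 / a) ^ Fintype.card ι * cauchyWeight t := by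
  rw [Finset.mul_sum, Real.exp_sum, cauchyWeight, ← Finset.card_univ, ← Finset.prod_const,
    ← Finset.prod_mul_distrib]
  refine Finset.prod_le_prod (fun i _ => (Real.exp_pos _).le) fun i _ => ?_
  have h1 := one_add_sq_le_two_mul_cosh (t i)
  have h2 := Real.add_one_le_exp (a * Real.cosh (t i))
  have h0 : 0 < 1 + t i ^ 2 := by positivity
  rw [neg_mul, Real.exp_neg, ← div_eq_mul_inv, inv_le_comm₀ (Real.exp_pos _) (by positivity), inv_div, div_div_eq_mul_div]
  rw [div_le_iff₀ two_pos]
  nlinarith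

theorem cosh_le_exp_abs (a : ℝ) : Real.cosh a ≤ Real.exp |a| := by
  rw [← Real.cosh_abs, Real.cosh_eq]
  have : Real.exp (-|a|) ≤ Real.exp |a| := Real.exp_le_exp.2 (by linarith [abs_nonneg a])
  linarith

theorem add_mul_sgn_eq_ang {m n : ℕ} (t : Fin m ⊕ Fin n → ℝ) (ζ : ℂ) :
    (fun i => (t i : ℂ) + ζ * sgn i) = ang (fun _ => ζ.im) fun i => t i + ζ.re * sgn i := by
  funext i
  simp only [ang]
  push_cast
  nth_rw 1 [← Complex.re_add_im ζ]
  ring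

theorem norm_tilt_le_of_boundary {m n : ℕ} (f : (Fin m ⊕ Fin n → ℂ) → ℂ) {θ₀ : ℝ} (hθ : 0 < θ₀)
    (hθ' : θ₀ ≤ Real.pi / 4) {c₁ K L : ℝ} (hc₁ : 0 < c₁) (hK : 0 ≤ K) (hL : 0 ≤ L)
    (hd : ∀ θ ∈ Set.Icc 0 θ₀, ∀ t, DifferentiableAt ℂ f (ang (fun _ => θ) t))
    (hg : ∀ θ ∈ Set.Icc 0 θ₀, ∀ t, ‖f (ang (fun _ => θ) t)‖ ≤
      Real.exp (K * (1 + ∑ i, Real.cosh (t i)) ^ 2))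
    (hb : ∀ t, ‖f (ang (fun _ => 0) t)‖ ≤ L * Real.exp (-c₁ * ∑ i, Real.cosh (t i)))
    (ht : ∀ t, ‖f (ang (fun _ => θ₀) t)‖ ≤ L * Real.exp (-c₁ * ∑ i, Real.cosh (t i)))
    {θ : ℝ} (h0 : θ ∈ Set.Icc 0 θ₀) (t : Fin m ⊕ Fin n → ℝ) :
    ‖f (ang (fun _ => θ) t)‖ ≤ L * Real.exp (-(c₁ / 2) * ∑ i, Real.cosh (t i)) := by
  have hpi := Real.pi_pos
  set l : ℂ → Fin m ⊕ Fin n → ℂ := fun ζ i => t i + ζ * sgn i with hl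
  have hlang : ∀ ζ, l ζ = ang (fun _ => ζ.im) fun i => t i + ζ.re * sgn i := add_mul_sgn_eq_ang t
  set e : ℂ → ℂ := fun ζ => ∑ i, Complex.cosh (l ζ i) with he
  have here : ∀ ζ, (e ζ).re = Real.cos ζ.im * ∑ i, Real.cosh (t i + ζ.re * sgn i) := by
    intro ζ
    rw [he, Complex.re_sum, Finset.mul_sum]
    refine Finset.sum_congr rfl fun i _ => ?_
    rw [hlang, ang, cosh_add_mul_I_re, cos_mul_sgn, mul_comm]
  set g : ℂ → ℂ := fun ζ => f (l ζ) * Complex.exp (c₁ * e ζ) with hg'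
  have hng : ∀ ζ, ‖g ζ‖ = ‖f (ang (fun _ => ζ.im) fun i => t i + ζ.re * sgn i)‖ *
      Real.exp (c₁ * (Real.cos ζ.im * ∑ i, Real.cosh (t i + ζ.re * sgn i))) := by
    intro ζ
    rw [hg', norm_mul, Complex.norm_exp, Complex.re_ofReal_mul, here, hlang]
  have hld : Differentiable ℂ l := by rw [hl]; fun_prop
  have hed : Differentiable ℂ e := by
    refine Differentiable.fun_sum fun i _ => ?_
    exact Complex.differentiable_cosh.comp (differentiable_pi.1 hld i)
  have hgd : ∀ ζ : ℂ, ζ.im ∈ Set.Icc 0 θ₀ → DifferentiableAt ℂ g ζ := by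
    intro ζ hζ
    refine DifferentiableAt.mul ?_ ?_
    · refine DifferentiableAt.comp (g := f) ζ ?_ (hld ζ)
      rw [hlang]
      exact hd _ hζ _
    · exact ((hed ζ).const_mul _).cexp
  have hsum : ∀ s : Fin m ⊕ Fin n → ℝ, 0 ≤ ∑ i, Real.cosh (s i) := fun s =>
    Finset.sum_nonneg fun i _ => (Real.cosh_pos _).le
  have hbd : ∀ ζ : ℂ, ‖f (ang (fun _ => ζ.im) fun i => t i + ζ.re * sgn i)‖ ≤
      L * Real.exp (-c₁ * ∑ i, Real.cosh (t i + ζ.re * sgn i)) → ‖g ζ‖ ≤ L := by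
    intro ζ h
    rw [hng]
    have h1 : Real.cos ζ.im * ∑ i, Real.cosh (t i + ζ.re * sgn i) ≤
        ∑ i, Real.cosh (t i + ζ.re * sgn i) :=
      mul_le_of_le_one_left (hsum _) (Real.cos_le_one _)
    calc _ ≤ L * Real.exp (-c₁ * ∑ i, Real.cosh (t i + ζ.re * sgn i)) *
          Real.exp (c₁ * ∑ i, Real.cosh (t i + ζ.re * sgn i)) := by gcongr
      _ = L := by rw [mul_assoc, ← Real.exp_add]; simp
  set ζ₀ : ℂ := θ * Complex.I with hζ₀
  have him : ζ₀.im = θ := by simp [hζ₀]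
  have hre : ζ₀.re = 0 := by simp [hζ₀]
  have key : ‖g ζ₀‖ ≤ L := by
    refine PhragmenLindelof.horizontal_strip (a := 0) (b := θ₀) (C := L) ?_ ?_ ?_ ?_ ?_ ?_
    · refine DifferentiableOn.diffContOnCl fun ζ hζ => (hgd ζ ?_).differentiableWithinAt
      have : closure (Complex.im ⁻¹' Set.Ioo 0 θ₀) ⊆ Complex.im ⁻¹' Set.Icc 0 θ₀ :=
        closure_minimal (Set.preimage_mono Set.Ioo_subset_Icc_self)
          (isClosed_Icc.preimage Complex.continuous_im)
      exact this hζ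
    · set S := ∑ i, Real.exp |t i| with hS
      have hS0 : 0 ≤ S := by positivity
      refine ⟨2, ?_, (K + c₁) * (1 + S) ^ 2, Asymptotics.IsBigO.of_bound 1 ?_⟩
      · rw [lt_div_iff₀ (by linarith)]; linarith
      · refine mem_inf_of_right fun ζ hζ => ?_
        have hζ' : ζ.im ∈ Set.Icc 0 θ₀ := Set.Ioo_subset_Icc_self hζ
        show ‖g ζ‖ ≤ 1 * ‖_‖
        rw [hng, one_mul, Real.norm_of_nonneg (Real.exp_pos _).le]
        set χ := ∑ i, Real.cosh (t i + ζ.re * sgn i) with hχ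
        have hχ0 : 0 ≤ χ := hsum _
        have hχS : χ ≤ S * Real.exp |ζ.re| := by
          rw [hχ, hS, Finset.sum_mul]
          refine Finset.sum_le_sum fun i _ => (cosh_le_exp_abs _).trans ?_
          rw [← Real.exp_add]
          refine Real.exp_le_exp.2 ((abs_add_le _ _).trans_eq ?_)
          rw [abs_mul, abs_sgn, mul_one]
        have h1 : 1 ≤ Real.exp |ζ.re| := Real.one_le_exp (abs_nonneg _)
        have h2 : 1 + χ ≤ (1 + S) * Real.exp |ζ.re| := by linarith
        have h3 : Real.exp (2 * |ζ.re|) = Real.exp |ζ.re| ^ 2 := by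
          rw [← Real.exp_nat_mul]; norm_num
        have h4 : Real.cos ζ.im * χ ≤ (1 + χ) ^ 2 := by
          have := mul_le_of_le_one_left hχ0 (Real.cos_le_one ζ.im)
          nlinarith
        calc _ ≤ Real.exp (K * (1 + χ) ^ 2) * Real.exp (c₁ * (1 + χ) ^ 2) := by
              gcongr
              exact hg _ hζ' _
          _ = Real.exp ((K + c₁) * (1 + χ) ^ 2) := by rw [← Real.exp_add]; ring_nf
          _ ≤ Real.exp ((K + c₁) * ((1 + S) * Real.exp |ζ.re|) ^ 2) := by gcongr
          _ = _ := by rw [h3]; ring_nf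
    · intro ζ hζ
      refine hbd ζ ?_
      rw [hζ]; exact hb _
    · intro ζ hζ
      refine hbd ζ ?_
      rw [hζ]; exact ht _
    · rw [him]; exact h0.1
    · rw [him]; exact h0.2
  rw [hng, him, hre] at key
  simp only [zero_mul, add_zero] at key
  have hcos : 1 / 2 ≤ Real.cos θ := by
    have h1 := Real.one_sub_sq_div_two_le_cos (x := θ)
    have h2 : θ ≤ 1 := by linarith [h0.2, Real.pi_lt_four]
    nlinarith [h0.1]
  set χ := ∑ i, Real.cosh (t i) with hχ
  have hχ0 : 0 ≤ χ := hsum _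
  have h5 : ‖f (ang (fun _ => θ) t)‖ ≤ L * Real.exp (-(c₁ * (Real.cos θ * χ))) := by
    rw [Real.exp_neg, ← div_eq_mul_inv, le_div_iff₀ (Real.exp_pos _)]
    exact key
  refine h5.trans ?_
  gcongr
  have := mul_le_mul_of_nonneg_left (mul_le_mul_of_nonneg_right hcos hχ0) hc₁.le
  linarith

theorem integrable_exp_neg_sum_cosh {ι : Type*} [Fintype ι] {a : ℝ} (ha : 0 < a) :
    Integrable fun t : ι → ℝ => Real.exp (-a * ∑ i, Real.cosh (t i)) := by
  refine ((integrable_cauchyWeight (ι := ι)).const_mul ((2 / a) ^ Fintype.card ι)).mono' ?_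
    (Eventually.of_forall fun t => ?_)
  · refine Continuous.aestronglyMeasurable ?_
    have : Continuous fun t : ι → ℝ => ∑ i, Real.cosh (t i) :=
      continuous_finsetSum _ fun i _ => Real.continuous_cosh.comp (continuous_apply i)
    exact Real.continuous_exp.comp (continuous_const.mul this)
  · rw [Real.norm_of_nonneg (Real.exp_pos _).le]
    exact exp_neg_sum_cosh_le ha t

section Tilt
variable {ħ : ℝ} {m n : ℕ} {F₁ : (Fin m → ℂ) × ℂ × (Fin (m + 1) → ℂ) → ℂ}
  {F₂ : (Fin n → ℂ) × ℂ × (Fin (n + 1) → ℂ) → ℂ}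
  {Φ₁ : (Fin m → ℂ) → ℂ → (Fin (m + 1) → ℝ) → ℂ} {Φ₂ : (Fin n → ℂ) → ℂ → (Fin (n + 1) → ℝ) → ℂ}

theorem ang_zero (t : Fin m ⊕ Fin n → ℝ) : ang (fun _ => 0) t = fun i => (t i : ℂ) := by
  funext i; simp [ang]

theorem tiltPt_ofReal (R c : ℝ) (t : Fin m ⊕ Fin n → ℝ) :
    tiltPt R c (fun i => (t i : ℂ)) = flat c fun i => R * Real.sinh (t i) := by
  funext i; simp [tiltPt, flat]

theorem tiltKern_ofReal (hΦ₁ : ∀ y ε x, F₁ (y, ε, fun a => (x a : ℂ)) = Φ₁ y ε x)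
    (hΦ₂ : ∀ y ε x, F₂ (y, ε, fun a => (x a : ℂ)) = Φ₂ y ε x) (R c : ℝ) (y : Fin (m + n + 1) → ℂ) (ε : ℂ)
    (x : Fin (m + n + 1 + 1) → ℝ) (τ : Fin m ⊕ Fin n → ℂ) :
    tiltKern ħ F₁ F₂ R c (y, ε, fun a => (x a : ℂ)) τ = (∏ i, (R : ℂ) * Complex.cosh (τ i)) *
      kern ħ (fun w e => Φ₁ w e (headPos x)) (fun z e => Φ₂ z e (tailPos x)) y ε (tiltPt R c τ) := by
  have h1 : headC (fun a => (x a : ℂ)) = fun a => (headPos (m := m) (n := n) x a : ℂ) := rfl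
  have h2 : tailC (fun a => (x a : ℂ)) = fun a => (tailPos (m := m) (n := n) x a : ℂ) := rfl
  simp only [tiltKern, h1, h2, hΦ₁, hΦ₂]

/-- For real positions the tilted contours can be replaced by flat ones. -/
theorem tiltInt_eq (hħ : 0 < ħ) (hF₁ : Differentiable ℂ F₁) (hF₂ : Differentiable ℂ F₂)
    (hg₁ : HasGrowth ħ F₁) (hg₂ : HasGrowth ħ F₂)
    (hΦ₁ : ∀ y ε x, F₁ (y, ε, fun a => (x a : ℂ)) = Φ₁ y ε x)
    (hΦ₂ : ∀ y ε x, F₂ (y, ε, fun a => (x a : ℂ)) = Φ₂ y ε x)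
    (h₁ : HasStripBounds ħ Φ₁) (h₂ : HasStripBounds ħ Φ₂) {R c θ₀ : ℝ} (hR : 0 < R) (hθ : 0 < θ₀)
    (hθ' : θ₀ ≤ Real.pi / 4) (y : Fin (m + n + 1) → ℂ) (ε : ℂ) (x : Fin (m + n + 1 + 1) → ℝ)
    (hc : R * Real.sin θ₀ + 2 * ‖y‖ + 2 ≤ c) :
    tiltInt ħ F₁ F₂ R c θ₀ (y, ε, fun a => (x a : ℂ)) =
      ∫ u, kern ħ (fun w e => Φ₁ w e (headPos x)) (fun z e => Φ₂ z e (tailPos x)) y ε (flat c u) := by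
  have hpi := Real.pi_pos
  set q : (Fin (m + n + 1) → ℂ) × ℂ × (Fin (m + n + 1 + 1) → ℂ) := (y, ε, fun a => (x a : ℂ)) with hq
  have hsin : ∀ θ ∈ Set.Icc 0 θ₀, R * Real.sin θ ≤ R * Real.sin θ₀ := fun θ hθ2 => by
    have := Real.sin_le_sin_of_le_of_le_pi_div_two (by linarith [hθ2.1]) (by linarith) hθ2.2
    gcongr
  have hs0 : 0 < Real.sin θ₀ := Real.sin_pos_of_pos_of_lt_pi hθ (by linarith)
  have hy0 := norm_nonneg y
  have hyc : ∀ k, |(y k).im| < c := fun k => by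
    have := (Complex.abs_im_le_norm (y k)).trans (norm_le_pi_norm y k)
    have : 0 < R * Real.sin θ₀ := by positivity
    linarith
  set c₀ := Real.pi / (2 * ħ) with hc₀
  have hc₀0 : 0 < c₀ := by positivity
  set c₁ := min 1 (c₀ * R / 2) with hc₁
  have hc₁0 : 0 < c₁ := lt_min one_pos (by positivity)
  have hc₁1 : c₁ ≤ 1 := min_le_left _ _
  have hc₁2 : 2 * c₁ ≤ c₀ * R := by
    have : c₁ ≤ c₀ * R / 2 := min_le_right _ _
    linarith
  obtain ⟨K₁, hK₁, b₁⟩ := exists_tiltKern_le_exp_sq hħ hg₁ hg₂ hR c ‖q.2.2‖ ‖y‖ ‖ε‖ hy0 (norm_nonneg ε)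
  obtain ⟨K₂, b₂⟩ := exists_tiltKern_le_exp_neg hħ hg₁ hg₂ hR c ‖q.2.2‖ ‖y‖ ‖ε‖ hy0 (norm_nonneg ε) hs0
  obtain ⟨K₃, hK₃, b₃⟩ := exists_kern_flat_le_of_hasStripBounds hħ h₁ h₂ y ε x hyc c
  set Y := 1 + ∑ a, ‖y a‖ with hY
  have hY0 : 0 ≤ Y := by positivity
  set k := Fintype.card (Fin m ⊕ Fin n) with hk
  set L₀ := (R / c₁ * Real.exp (c₁ + c₀ * Y + c₁)) ^ k with hL₀
  have hd : ∀ θ ∈ Set.Icc 0 θ₀, ∀ t, DifferentiableAt ℂ (tiltKern ħ F₁ F₂ R c q) (ang (fun _ => θ) t) :=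
    fun θ hθ2 t => differentiableAt_tiltKern hħ hF₁ hF₂ hR q _ t (fun _ => hθ2.1)
      (fun _ => hθ2.2.trans hθ') fun _ => by have := hsin θ hθ2; linarith
  have hbot : ∀ t, ‖tiltKern ħ F₁ F₂ R c q (ang (fun _ => 0) t)‖ ≤
      (L₀ * K₃ + Real.exp K₂) * Real.exp (-c₁ * ∑ i, Real.cosh (t i)) := by
    intro t
    rw [ang_zero, hq, tiltKern_ofReal hΦ₁ hΦ₂, tiltPt_ofReal, norm_mul]
    have h3 := b₃ c ⟨le_rfl, le_rfl⟩ fun i => R * Real.sinh (t i)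
    have hcw : cauchyWeight (fun i => R * Real.sinh (t i)) ≤ 1 :=
      Finset.prod_le_one (fun i _ => by positivity) fun i _ =>
        inv_le_one_of_one_le₀ (by nlinarith [sq_nonneg (R * Real.sinh (t i))])
    have hper : ∀ i ∈ (Finset.univ : Finset (Fin m ⊕ Fin n)),
        ‖(R : ℂ) * Complex.cosh (t i)‖ * Real.exp (-c₀ * max 0 (|R * Real.sinh (t i)| - Y)) ≤
          (R / c₁ * Real.exp (c₁ + c₀ * Y + c₁)) * Real.exp (-c₁ * Real.cosh (t i)) := by
      intro i _
      have e1 : ‖(R : ℂ) * Complex.cosh (t i)‖ = R * Real.cosh (t i) := by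
        rw [← Complex.ofReal_cosh, ← Complex.ofReal_mul, Complex.norm_real, Real.norm_of_nonneg]
        have := Real.cosh_pos (t i)
        positivity
      have e2 : R * Real.cosh (t i) ≤ R / c₁ * Real.exp (c₁ * Real.cosh (t i)) := by
        have := Real.add_one_le_exp (c₁ * Real.cosh (t i))
        rw [div_mul_eq_mul_div, le_div_iff₀ hc₁0]
        have h6 := mul_le_mul_of_nonneg_left this hR.le
        linarith
      have e3 := cosh_le_one_add_abs_sinh (t i)
      have e4 := le_max_right 0 (|R * Real.sinh (t i)| - Y)
      rw [e1]
      refine (mul_le_mul_of_nonneg_right e2 (Real.exp_pos _).le).trans ?_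
      rw [mul_assoc, mul_assoc, ← Real.exp_add, ← Real.exp_add]
      rw [abs_mul, abs_of_pos hR] at e4 ⊢
      refine mul_le_mul_of_nonneg_left (Real.exp_le_exp.2 ?_) (by positivity)
      have e5 := mul_le_mul_of_nonneg_left e4 hc₀0.le
      have e6 := mul_le_mul_of_nonneg_right hc₁2 (abs_nonneg (Real.sinh (t i)))
      have e7 := mul_le_mul_of_nonneg_left e3 hc₁0.le
      linarith
    have hprod := Finset.prod_le_prod (fun i _ => by positivity) hper
    rw [Finset.prod_mul_distrib, Finset.prod_mul_distrib, Finset.prod_const, Finset.card_univ, ← hk, ← hL₀,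
      ← Real.exp_sum, ← Real.exp_sum, ← Finset.mul_sum, ← Finset.mul_sum, ← norm_prod] at hprod
    calc _ ≤ ‖∏ i, (R : ℂ) * Complex.cosh (t i)‖ * (K₃ * (Real.exp (-c₀ * ∑ i, max 0 (|R * Real.sinh (t i)| - Y)) * 1)) := by
          refine mul_le_mul_of_nonneg_left (h3.trans ?_) (norm_nonneg _)
          gcongr
      _ = K₃ * (‖∏ i, (R : ℂ) * Complex.cosh (t i)‖ * Real.exp (-c₀ * ∑ i, max 0 (|R * Real.sinh (t i)| - Y))) := by ring
      _ ≤ K₃ * (L₀ * Real.exp (-c₁ * ∑ i, Real.cosh (t i))) := by gcongr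
      _ ≤ _ := by
          rw [← mul_assoc, mul_comm K₃]
          gcongr
          linarith [Real.exp_pos K₂]
  have htop : ∀ t, ‖tiltKern ħ F₁ F₂ R c q (ang (fun _ => θ₀) t)‖ ≤
      (L₀ * K₃ + Real.exp K₂) * Real.exp (-c₁ * ∑ i, Real.cosh (t i)) := by
    intro t
    have hχ0 : 0 ≤ ∑ i, Real.cosh (t i) := Finset.sum_nonneg fun i _ => (Real.cosh_pos _).le
    refine (b₂ q le_rfl le_rfl le_rfl _ t (fun _ => hθ.le) (fun _ => hθ') (fun _ => le_rfl) fun _ => hc).trans ?_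
    rw [sub_eq_add_neg, Real.exp_add]
    have : 0 ≤ L₀ * K₃ := by positivity
    refine mul_le_mul (by linarith) (Real.exp_le_exp.2 ?_) (Real.exp_pos _).le (by positivity)
    nlinarith
  have hall := fun θ (h0 : θ ∈ Set.Icc 0 θ₀) t => norm_tilt_le_of_boundary (tiltKern ħ F₁ F₂ R c q) hθ hθ' hc₁0
    hK₁ (by positivity) hd (fun θ hθ2 t => b₁ q le_rfl le_rfl le_rfl _ t (fun _ => hθ2.1)
      (fun _ => hθ2.2.trans hθ') fun _ => by have := hsin θ hθ2; linarith) hbot htop h0 t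
  have hshift := integral_shift (sgn : Fin m ⊕ Fin n → ℝ) hθ.le (tiltKern ħ F₁ F₂ R c q)
    ((L₀ * K₃ + Real.exp K₂) * (2 / (c₁ / 2)) ^ k) (fun t τ hτ => hd τ hτ t) fun t τ hτ => by
      refine (hall τ hτ t).trans ?_
      rw [mul_assoc]
      have := exp_neg_sum_cosh_le (half_pos hc₁0) t
      gcongr
  have hflat := integral_comp_sinh hR (fun u : Fin m ⊕ Fin n → ℝ =>
    kern ħ (fun w e => Φ₁ w e (headPos x)) (fun z e => Φ₂ z e (tailPos x)) y ε (flat c u))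
  rw [hflat]
  unfold tiltInt
  refine hshift.symm.trans (integral_congr_ae (Eventually.of_forall fun t => ?_))
  have e0 : (fun i => (t i : ℂ) + ((0 * sgn i : ℝ) : ℂ) * Complex.I) = fun i => (t i : ℂ) := by
    funext i; simp
  beta_reduce
  rw [e0, hq, tiltKern_ofReal hΦ₁ hΦ₂, tiltPt_ofReal]
  simp only [Complex.ofReal_cosh]

theorem differentiableOn_tiltInt (hħ : 0 < ħ) (hF₁ : Differentiable ℂ F₁) (hF₂ : Differentiable ℂ F₂)
    (hg₁ : HasGrowth ħ F₁) (hg₂ : HasGrowth ħ F₂) {R c θ B : ℝ} (hR : 0 < R) (hθ : 0 < θ)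
    (hθ' : θ ≤ Real.pi / 4) (hc : R * Real.sin θ + 2 * B + 2 ≤ c) :
    DifferentiableOn ℂ (tiltInt (m := m) (n := n) ħ F₁ F₂ R c θ) {q | ‖q.1‖ < B} := by
  have hpi := Real.pi_pos
  have hs0 : 0 < Real.sin θ := Real.sin_pos_of_pos_of_lt_pi hθ (by linarith)
  have hcq : ∀ q : (Fin (m + n + 1) → ℂ) × ℂ × (Fin (m + n + 1 + 1) → ℂ), ‖q.1‖ < B →
      R * Real.sin θ + 2 * ‖q.1‖ + 2 ≤ c := fun q hq => by linarith
  refine differentiableOn_integral (isOpen_lt (by fun_prop) continuous_const) ?_ ?_ ?_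
  · intro t q (hq : ‖q.1‖ < B)
    have hq' := hcq q hq
    refine DifferentiableAt.differentiableWithinAt ?_
    have h1 := differentiableAt_kern_param hħ hF₁ hF₂
      (E := (Fin (m + n + 1) → ℂ) × ℂ × (Fin (m + n + 1 + 1) → ℂ)) (e₀ := q) (Y := fun q => q.1)
      (Z := fun q => q.2.1) (X := fun q => q.2.2) (P := fun _ => tiltPt R c (ang (fun _ => θ) t))
      differentiable_fst.differentiableAt (differentiable_fst.comp differentiable_snd).differentiableAt
      (differentiable_snd.comp differentiable_snd).differentiableAt (differentiableAt_const _)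
      fun i b => tiltPt_separated' (ϑ := fun _ => θ) hR (le_refl ‖q.1‖) hθ.le hθ' hq' t b
    exact h1.const_mul _
  · intro q (hq : ‖q.1‖ < B)
    have hq' := hcq q hq
    refine Continuous.aestronglyMeasurable (continuous_iff_continuousAt.2 fun t => ?_)
    have h1 : ContinuousAt (tiltKern ħ F₁ F₂ R c q) (ang (fun _ => θ) t) :=
      (differentiableAt_tiltKern hħ hF₁ hF₂ hR q _ t (fun _ => hθ.le) (fun _ => hθ')
        fun _ => hq').continuousAt
    exact ContinuousAt.comp (g := tiltKern ħ F₁ F₂ R c q) (f := ang fun _ => θ) h1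
      (continuous_ang _).continuousAt
  · intro q₀ hq₀
    have hB : 0 ≤ B := (norm_nonneg _).trans hq₀.le
    obtain ⟨K, h⟩ := exists_tiltKern_le_exp_neg (m := m) (n := n) hħ hg₁ hg₂ hR c (‖q₀.2.2‖ + 1) B
      (‖q₀.2.1‖ + 1) hB (by positivity) hs0
    refine ⟨fun t => Real.exp K * Real.exp (-1 * ∑ i, Real.cosh (t i)), ?_, ?_⟩
    · exact (integrable_exp_neg_sum_cosh one_pos).const_mul _
    · have h1 : ∀ᶠ q : (Fin (m + n + 1) → ℂ) × ℂ × (Fin (m + n + 1 + 1) → ℂ) in 𝓝 q₀, ‖q.1‖ < B :=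
        (isOpen_lt (by fun_prop) continuous_const).mem_nhds hq₀
      have h2 : ∀ᶠ q : (Fin (m + n + 1) → ℂ) × ℂ × (Fin (m + n + 1 + 1) → ℂ) in 𝓝 q₀,
          ‖q.2.1‖ < ‖q₀.2.1‖ + 1 :=
        (isOpen_lt (by fun_prop) continuous_const).mem_nhds (by simp)
      have h3 : ∀ᶠ q : (Fin (m + n + 1) → ℂ) × ℂ × (Fin (m + n + 1 + 1) → ℂ) in 𝓝 q₀,
          ‖q.2.2‖ < ‖q₀.2.2‖ + 1 :=
        (isOpen_lt (by fun_prop) continuous_const).mem_nhds (by simp)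
      filter_upwards [h1, h2, h3] with q a1 a2 a3 t
      refine (h q a1.le a2.le a3.le _ t (fun _ => hθ.le) (fun _ => hθ') (fun _ => le_rfl) fun _ => hc).trans_eq ?_
      rw [← Real.exp_add]; ring_nf

end Tilt

section Glue
variable {ħ : ℝ} {m n : ℕ} {F₁ : (Fin m → ℂ) × ℂ × (Fin (m + 1) → ℂ) → ℂ}
  {F₂ : (Fin n → ℂ) × ℂ × (Fin (n + 1) → ℂ) → ℂ}
  {Φ₁ : (Fin m → ℂ) → ℂ → (Fin (m + 1) → ℝ) → ℂ} {Φ₂ : (Fin n → ℂ) → ℂ → (Fin (n + 1) → ℝ) → ℂ}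

/-- An entire extension of `Φ` to complex positions, of controlled growth and symmetric in the
spectral variables. -/
structure IsGoodExtension (ħ : ℝ) {N : ℕ} (Φ : (Fin N → ℂ) → ℂ → (Fin (N + 1) → ℝ) → ℂ)
    (F : (Fin N → ℂ) × ℂ × (Fin (N + 1) → ℂ) → ℂ) : Prop where
  differentiable : Differentiable ℂ F
  eq : ∀ y ε x, F (y, ε, fun a => (x a : ℂ)) = Φ y ε x
  growth : HasGrowth ħ F

theorem IsGoodExtension.differentiable_real {N : ℕ} {Φ : (Fin N → ℂ) → ℂ → (Fin (N + 1) → ℝ) → ℂ}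
    {F : (Fin N → ℂ) × ℂ × (Fin (N + 1) → ℂ) → ℂ} (h : IsGoodExtension ħ Φ F) (x : Fin (N + 1) → ℝ) :
    Differentiable ℂ fun q : (Fin N → ℂ) × ℂ => Φ q.1 q.2 x := by
  simp only [← h.eq]
  exact h.differentiable.comp (f := fun q : (Fin N → ℂ) × ℂ => (q.1, q.2, fun a => (x a : ℂ)))
    (by fun_prop)

theorem differentiable_tiltInt_pos (hħ : 0 < ħ) (e₁ : IsGoodExtension ħ Φ₁ F₁)
    (e₂ : IsGoodExtension ħ Φ₂ F₂) {R c θ : ℝ} (hR : 0 < R) (hθ : 0 < θ) (hθ' : θ ≤ Real.pi / 4)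
    (y : Fin (m + n + 1) → ℂ) (ε : ℂ) (hc : R * Real.sin θ + 2 * ‖y‖ + 3 ≤ c) :
    Differentiable ℂ fun x => tiltInt ħ F₁ F₂ R c θ (y, ε, x) := by
  intro x
  have hy : ‖y‖ < ‖y‖ + 1 / 2 := by linarith
  have hc' : R * Real.sin θ + 2 * (‖y‖ + 1 / 2) + 2 ≤ c := by linarith
  have h := (differentiableOn_tiltInt hħ e₁.differentiable e₂.differentiable e₁.growth e₂.growth hR hθ hθ'
    hc').differentiableAt (x := (y, ε, x))
    ((isOpen_lt (by fun_prop) continuous_const).mem_nhds hy)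
  exact DifferentiableAt.comp (g := tiltInt ħ F₁ F₂ R c θ) (f := fun x => (y, ε, x)) x h (by fun_prop)

theorem tiltInt_eq_tiltInt (hħ : 0 < ħ) (e₁ : IsGoodExtension ħ Φ₁ F₁)
    (e₂ : IsGoodExtension ħ Φ₂ F₂) (h₁ : HasStripBounds ħ Φ₁) (h₂ : HasStripBounds ħ Φ₂)
    {R c θ R' c' θ' : ℝ} (hR : 0 < R) (hθ : 0 < θ) (hθ4 : θ ≤ Real.pi / 4)
    (hR' : 0 < R') (hθ' : 0 < θ') (hθ4' : θ' ≤ Real.pi / 4)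
    (y : Fin (m + n + 1) → ℂ) (hc : R * Real.sin θ + 2 * ‖y‖ + 3 ≤ c)
    (hc' : R' * Real.sin θ' + 2 * ‖y‖ + 3 ≤ c') (ε : ℂ) (x : Fin (m + n + 1 + 1) → ℂ) :
    tiltInt ħ F₁ F₂ R c θ (y, ε, x) = tiltInt ħ F₁ F₂ R' c' θ' (y, ε, x) := by
  refine congrFun (eq_of_eq_on_real (differentiable_tiltInt_pos hħ e₁ e₂ hR hθ hθ4 y ε hc)
    (differentiable_tiltInt_pos hħ e₁ e₂ hR' hθ' hθ4' y ε hc') fun x => ?_) x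
  have hlt : ∀ {R c θ : ℝ}, 0 < R → 0 < θ → θ ≤ Real.pi / 4 → R * Real.sin θ + 2 * ‖y‖ + 3 ≤ c →
      ∀ k, |(y k).im| < c := fun {R c θ} hR hθ hθ4 hc k => by
    have h1 := (Complex.abs_im_le_norm (y k)).trans (norm_le_pi_norm y k)
    have h2 : 0 < Real.sin θ := Real.sin_pos_of_pos_of_lt_pi hθ (by linarith [Real.pi_pos])
    have h3 : 0 < R * Real.sin θ := by positivity
    linarith [norm_nonneg y]
  rw [tiltInt_eq hħ e₁.differentiable e₂.differentiable e₁.growth e₂.growth e₁.eq e₂.eq h₁ h₂ hR hθ hθ4 y ε x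
      (by linarith), tiltInt_eq hħ e₁.differentiable e₂.differentiable e₁.growth e₂.growth e₁.eq e₂.eq h₁ h₂
      hR' hθ' hθ4' y ε x (by linarith)]
  exact integral_kern_flat_eq hħ e₁.differentiable_real e₂.differentiable_real h₁ h₂ y ε x
    (hlt hR hθ hθ4 hc) (hlt hR' hθ' hθ4' hc')

/-- The tilted integral, with a contour adapted to `y`. -/
def extension (ħ : ℝ) {m n : ℕ} (F₁ : (Fin m → ℂ) × ℂ × (Fin (m + 1) → ℂ) → ℂ)
    (F₂ : (Fin n → ℂ) × ℂ × (Fin (n + 1) → ℂ) → ℂ)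
    (q : (Fin (m + n + 1) → ℂ) × ℂ × (Fin (m + n + 1 + 1) → ℂ)) : ℂ :=
  tiltInt ħ F₁ F₂ 1 (2 * ‖q.1‖ + 4) (Real.pi / 4) q

theorem extension_eq (hħ : 0 < ħ) (e₁ : IsGoodExtension ħ Φ₁ F₁)
    (e₂ : IsGoodExtension ħ Φ₂ F₂) (h₁ : HasStripBounds ħ Φ₁) (h₂ : HasStripBounds ħ Φ₂)
    {R c θ : ℝ} (hR : 0 < R) (hθ : 0 < θ) (hθ4 : θ ≤ Real.pi / 4)
    (q : (Fin (m + n + 1) → ℂ) × ℂ × (Fin (m + n + 1 + 1) → ℂ))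
    (hc : R * Real.sin θ + 2 * ‖q.1‖ + 3 ≤ c) :
    extension ħ F₁ F₂ q = tiltInt ħ F₁ F₂ R c θ q :=
  tiltInt_eq_tiltInt hħ e₁ e₂ h₁ h₂ one_pos (by positivity) le_rfl hR hθ hθ4 q.1
    (by linarith [Real.sin_le_one (Real.pi / 4)]) hc q.2.1 q.2.2

theorem differentiable_extension (hħ : 0 < ħ) (e₁ : IsGoodExtension ħ Φ₁ F₁)
    (e₂ : IsGoodExtension ħ Φ₂ F₂) (h₁ : HasStripBounds ħ Φ₁) (h₂ : HasStripBounds ħ Φ₂) :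
    Differentiable ℂ (extension ħ F₁ F₂) := by
  intro q
  have hs := Real.sin_le_one (Real.pi / 4)
  have hopen : IsOpen {p : (Fin (m + n + 1) → ℂ) × ℂ × (Fin (m + n + 1 + 1) → ℂ) | ‖p.1‖ < ‖q.1‖ + 1} :=
    isOpen_lt (by fun_prop) continuous_const
  have hmem : {p : (Fin (m + n + 1) → ℂ) × ℂ × (Fin (m + n + 1 + 1) → ℂ) | ‖p.1‖ < ‖q.1‖ + 1} ∈ 𝓝 q :=
    hopen.mem_nhds (by simp)
  have h := (differentiableOn_tiltInt hħ e₁.differentiable e₂.differentiable e₁.growth e₂.growth one_pos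
    (θ := Real.pi / 4) (by positivity) le_rfl (B := ‖q.1‖ + 1) (c := 2 * ‖q.1‖ + 6)
    (by linarith)).differentiableAt hmem
  refine h.congr_of_eventuallyEq (mem_of_superset hmem fun p (hp : ‖p.1‖ < ‖q.1‖ + 1) => ?_)
  exact extension_eq hħ e₁ e₂ h₁ h₂ one_pos (by positivity) le_rfl p (by linarith)

theorem extension_ofReal (hħ : 0 < ħ) (e₁ : IsGoodExtension ħ Φ₁ F₁)
    (e₂ : IsGoodExtension ħ Φ₂ F₂) (h₁ : HasStripBounds ħ Φ₁) (h₂ : HasStripBounds ħ Φ₂)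
    (y : Fin (m + n + 1) → ℂ) (ε : ℂ) (x : Fin (m + n + 1 + 1) → ℝ) {α : ℝ} (hα : ∀ k, |(y k).im| < α) :
    extension ħ F₁ F₂ (y, ε, fun a => (x a : ℂ)) =
      ∫ u, kern ħ (fun w e => Φ₁ w e (headPos x)) (fun z e => Φ₂ z e (tailPos x)) y ε (flat α u) := by
  have h3 := Real.sin_le_one (Real.pi / 4)
  rw [extension, tiltInt_eq hħ e₁.differentiable e₂.differentiable e₁.growth e₂.growth e₁.eq e₂.eq h₁ h₂
    one_pos (by positivity) le_rfl y ε x (by linarith)]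
  refine integral_kern_flat_eq hħ e₁.differentiable_real e₂.differentiable_real h₁ h₂ y ε x (fun k => ?_) hα
  have h1 := (Complex.abs_im_le_norm (y k)).trans (norm_le_pi_norm y k)
  dsimp only
  linarith [norm_nonneg y]

theorem kern_comp_perm (A : (Fin m → ℂ) → ℂ → ℂ) (B : (Fin n → ℂ) → ℂ → ℂ)
    (y : Fin (m + n + 1) → ℂ) (ε : ℂ) (p : Fin m ⊕ Fin n → ℂ) (σ : Equiv.Perm (Fin (m + n + 1))) :
    kern ħ A B (fun k => y (σ k)) ε p = kern ħ A B y ε p := by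
  have h1 : ∑ k, y (σ k) = ∑ k, y k := Equiv.sum_comp σ y
  have h2 : ∀ f : ℂ → ℂ, ∏ b, f (y (σ b)) = ∏ b, f (y b) := fun f => Equiv.prod_comp σ fun b => f (y b)
  have h3 : ∀ u, ∏ b, Complex.Gamma ((y (σ b) - u) / (Complex.I * ħ)) * (ħ : ℂ) ^ (Complex.I / ħ * (u - y (σ b))) =
      ∏ b, Complex.Gamma ((y b - u) / (Complex.I * ħ)) * (ħ : ℂ) ^ (Complex.I / ħ * (u - y b)) := fun u =>
    h2 fun v => Complex.Gamma ((v - u) / (Complex.I * ħ)) * (ħ : ℂ) ^ (Complex.I / ħ * (u - v))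
  have h4 : ∀ u, ∏ b, Complex.Gamma ((u - y (σ b)) / (Complex.I * ħ)) * (ħ : ℂ) ^ (Complex.I / ħ * (y (σ b) - u)) =
      ∏ b, Complex.Gamma ((u - y b) / (Complex.I * ħ)) * (ħ : ℂ) ^ (Complex.I / ħ * (y b - u)) := fun u =>
    h2 fun v => Complex.Gamma ((u - v) / (Complex.I * ħ)) * (ħ : ℂ) ^ (Complex.I / ħ * (v - u))
  simp only [kern, weight, h1, h3, h4]

theorem extension_comp_perm (y : Fin (m + n + 1) → ℂ) (ε : ℂ) (x : Fin (m + n + 1 + 1) → ℂ)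
    (σ : Equiv.Perm (Fin (m + n + 1))) :
    extension ħ F₁ F₂ (fun k => y (σ k), ε, x) = extension ħ F₁ F₂ (y, ε, x) := by
  have h : ‖fun k => y (σ k)‖ = ‖y‖ := by
    refine le_antisymm ((pi_norm_le_iff_of_nonneg (norm_nonneg _)).2 fun k => norm_le_pi_norm y _)
      ((pi_norm_le_iff_of_nonneg (norm_nonneg _)).2 fun k => ?_)
    have := norm_le_pi_norm (fun k => y (σ k)) (σ.symm k)
    simpa using this
  simp only [extension, tiltInt, tiltKern, h, kern_comp_perm]

end Glue

theorem exp_sub_exp_eq {ħ : ℝ} (hħ : 0 < ħ) {m n : ℕ} (i : Fin m ⊕ Fin n) (p y : ℂ) :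
    Complex.exp (2 * Real.pi * p / ħ) - Complex.exp (2 * Real.pi * y / ħ) =
      -sgn i * 2 * Complex.I * Complex.exp (Real.pi * (p + y) / ħ) *
        Complex.sin (Real.pi * (sgn i * (y - p) / (Complex.I * ħ))) := by
  have hne : (ħ : ℂ) ≠ 0 := by exact_mod_cast hħ.ne'
  have hI := Complex.I_mul_I
  rw [Complex.sin]
  have e1 : -(Real.pi * (sgn i * (y - p) / (Complex.I * ħ))) * Complex.I = Real.pi * (sgn i * (p - y)) / ħ := by
    field_simp; ring
  have e2 : (Real.pi * (sgn i * (y - p) / (Complex.I * ħ))) * Complex.I = Real.pi * (sgn i * (y - p)) / ħ := by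
    field_simp
  rw [e1, e2]
  have a1 : Complex.exp (2 * Real.pi * p / ħ) = Complex.exp (Real.pi * (p + y) / ħ) *
      Complex.exp (Real.pi * (p - y) / ħ) := by rw [← Complex.exp_add]; congr 1; field_simp; ring
  have a2 : Complex.exp (2 * Real.pi * y / ħ) = Complex.exp (Real.pi * (p + y) / ħ) *
      Complex.exp (Real.pi * (y - p) / ħ) := by rw [← Complex.exp_add]; congr 1; field_simp; ring
  rw [a1, a2]
  have hI2 := Complex.I_sq
  cases i with
  | inl a =>
    simp only [sgn, Sum.elim_inl, Complex.ofReal_one, one_mul]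
    linear_combination (Complex.exp (Real.pi * (p + y) / ħ) * (Complex.exp (Real.pi * (p - y) / ħ) -
      Complex.exp (Real.pi * (y - p) / ħ))) * hI2
  | inr a =>
    simp only [sgn, Sum.elim_inr, Complex.ofReal_neg, Complex.ofReal_one, neg_one_mul, neg_sub, neg_neg, one_mul]
    linear_combination (Complex.exp (Real.pi * (p + y) / ħ) * (Complex.exp (Real.pi * (p - y) / ħ) -
      Complex.exp (Real.pi * (y - p) / ħ))) * hI2

/-- The entire function `Γ(s)(e^{2πp/ħ} - e^{2πy/ħ})`, `s = ±(y - p)/(iħ)`. -/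
def regGamma (ħ : ℝ) {m n : ℕ} (i : Fin m ⊕ Fin n) (p y : ℂ) : ℂ :=
  -sgn i * 2 * Complex.I * Real.pi * Complex.exp (Real.pi * (p + y) / ħ) *
    (Complex.Gamma (1 - sgn i * (y - p) / (Complex.I * ħ)))⁻¹

theorem Gamma_mul_exp_sub_exp {ħ : ℝ} (hħ : 0 < ħ) {m n : ℕ} (i : Fin m ⊕ Fin n) (p y : ℂ)
    (h : 0 < (sgn i * (y - p) / (Complex.I * ħ)).re ∨ (sgn i * (y - p) / (Complex.I * ħ)).im ≠ 0) :
    Complex.Gamma (sgn i * (y - p) / (Complex.I * ħ)) *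
      (Complex.exp (2 * Real.pi * p / ħ) - Complex.exp (2 * Real.pi * y / ħ)) = regGamma ħ i p y := by
  rw [exp_sub_exp_eq hħ i, regGamma]
  linear_combination (-sgn i * 2 * Complex.I * Complex.exp (Real.pi * (p + y) / ħ)) * Gamma_mul_sin h

theorem prod_Ioi_sub_eq_sum {m N : ℕ} (S : Fin m → Finset (Fin N)) (hS : ∀ j, (S j).card = j)
    (q : Fin m → ℂ) (Q : Fin N → ℂ) : ∏ i, ∏ j ∈ Finset.Ioi i, (q j - q i) =
      ∑ σ : Equiv.Perm (Fin m), (Equiv.Perm.sign σ : ℂ) * ∏ i, ∏ b ∈ S (σ i), (q i - Q b) := by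
  rw [← Matrix.det_vandermonde]
  set P : Fin m → Polynomial ℂ := fun j => ∏ b ∈ S j, (Polynomial.X - Polynomial.C (Q b)) with hP
  rw [Matrix.det_eval_matrixOfPolynomials_eq_det_vandermonde q P ?_ ?_, ← Matrix.det_transpose, Matrix.det_apply]
  · refine Finset.sum_congr rfl fun σ _ => ?_
    rw [Units.smul_def, zsmul_eq_mul]
    simp [hP, Polynomial.eval_prod]
  · intro j
    rw [hP, Polynomial.natDegree_prod_of_monic _ _ fun b _ => Polynomial.monic_X_sub_C _]
    simp [hS]
  · intro j
    exact Polynomial.monic_prod_of_monic _ _ fun b _ => Polynomial.monic_X_sub_C _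

/-- The reciprocal Gamma functions of differences within a block, up to a Vandermonde product. -/
def smoothPart (ħ : ℝ) {m : ℕ} (w : Fin m → ℂ) : ℂ :=
  ∏ a, ∏ b ∈ Finset.Ioi a, ((w a - w b) / (Complex.I * ħ) / (2 * Real.pi * Complex.I)) *
    Complex.exp (-(Real.pi * (w b + w a) / ħ))

theorem diagPart_eq {ħ : ℝ} (hħ : 0 < ħ) {m : ℕ} (w : Fin m → ℂ) : diagPart ħ w = smoothPart ħ w *
    ∏ a, ∏ b ∈ Finset.Ioi a, (Complex.exp (2 * Real.pi * w b / ħ) - Complex.exp (2 * Real.pi * w a / ħ)) := by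
  have h1 : diagPart ħ w = ∏ a, ∏ b ∈ Finset.Ioi a, (Complex.Gamma ((w a - w b) / (Complex.I * ħ)))⁻¹ *
      (Complex.Gamma ((w b - w a) / (Complex.I * ħ)))⁻¹ := by
    rw [Finset.prod_prod_Ioi_mul_eq_prod_prod_off_diag
      (fun b a => (Complex.Gamma ((w a - w b) / (Complex.I * ħ)))⁻¹), diagPart, Finset.prod_sigma']
    refine Finset.prod_bij' (fun p _ => ⟨p.1, p.2⟩) (fun p _ => (p.1, p.2)) ?_ ?_ ?_ ?_ ?_ <;> simp +contextual [eq_comm]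
  have hpi : (Real.pi : ℂ) ≠ 0 := by exact_mod_cast Real.pi_ne_zero
  rw [h1, smoothPart, ← Finset.prod_mul_distrib]
  refine Finset.prod_congr rfl fun a _ => ?_
  rw [← Finset.prod_mul_distrib]
  refine Finset.prod_congr rfl fun b _ => ?_
  have e1 : (w b - w a) / (Complex.I * ħ) = -((w a - w b) / (Complex.I * ħ)) := by ring
  rw [e1, inv_Gamma_mul_inv_Gamma_neg]
  have e2 := exp_sub_exp_eq hħ (Sum.inl 0 : Fin 1 ⊕ Fin 0) (w b) (w a)
  simp only [sgn, Sum.elim_inl, Complex.ofReal_one, one_mul] at e2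
  rw [e2, Complex.exp_neg]
  have := Complex.exp_ne_zero (Real.pi * (w b + w a) / ħ)
  field_simp

/-- The Gamma functions with poles in the weight, with the poles belonging to `kill i` removed. -/
def killPart (ħ : ℝ) {m n N : ℕ} (kill : Fin m ⊕ Fin n → Finset (Fin N)) (p : Fin m ⊕ Fin n → ℂ)
    (y : Fin N → ℂ) : ℂ :=
  ∏ i, ∏ b, if b ∈ kill i then regGamma ħ i (p i) (y b)
    else Complex.Gamma (sgn i * (y b - p i) / (Complex.I * ħ))

theorem polePart_mul_prod {ħ : ℝ} (hħ : 0 < ħ) {m n N : ℕ} (kill : Fin m ⊕ Fin n → Finset (Fin N))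
    (p : Fin m ⊕ Fin n → ℂ) (y : Fin N → ℂ)
    (h : ∀ i b, 0 < sgn i * ((y b).im - (p i).im) ∨ (y b).re - (p i).re ≠ 0) :
    polePart ħ p y * ∏ i, ∏ b ∈ kill i,
      (Complex.exp (2 * Real.pi * p i / ħ) - Complex.exp (2 * Real.pi * y b / ħ)) =
      killPart ħ kill p y := by
  rw [polePart, killPart, ← Finset.prod_mul_distrib]
  refine Finset.prod_congr rfl fun i _ => ?_
  rw [← Finset.prod_ite_mem_eq (kill i), ← Finset.prod_mul_distrib]
  refine Finset.prod_congr rfl fun b _ => ?_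
  split_ifs with hb
  · refine Gamma_mul_exp_sub_exp hħ i _ _ ?_
    rw [div_I_mul_re, div_I_mul_im]
    rcases h i b with h | h
    · left
      rw [Complex.im_ofReal_mul, Complex.sub_im]
      positivity
    · right
      rw [Complex.re_ofReal_mul, Complex.sub_re]
      have : sgn i ≠ 0 := by
        intro h0; have := abs_sgn i; rw [h0] at this; simp at this
      simp only [ne_eq, div_eq_zero_iff, neg_eq_zero, mul_eq_zero, hħ.ne', or_false, this, false_or]
      exact h
  · rw [mul_one]

/-- A term of the expansion of the integrand. -/
def termKern (ħ : ℝ) {m n : ℕ} (F₁ : (Fin m → ℂ) × ℂ × (Fin (m + 1) → ℂ) → ℂ)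
    (F₂ : (Fin n → ℂ) × ℂ × (Fin (n + 1) → ℂ) → ℂ) (kill : Fin m ⊕ Fin n → Finset (Fin (m + n + 1)))
    (y : Fin (m + n + 1) → ℂ) (ε : ℂ) (x : Fin (m + n + 1 + 1) → ℂ) (p : Fin m ⊕ Fin n → ℂ) : ℂ :=
  outerPart ħ F₁ F₂ y ε x p * (smoothPart ħ (fun a => p (.inl a)) *
    smoothPart ħ (fun b => p (.inr b)) * killPart ħ kill p y)

section Term
variable {ħ : ℝ} {m n : ℕ} {F₁ : (Fin m → ℂ) × ℂ × (Fin (m + 1) → ℂ) → ℂ}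
  {F₂ : (Fin n → ℂ) × ℂ × (Fin (n + 1) → ℂ) → ℂ}

theorem kern_eq_sum_termKern (hħ : 0 < ħ) (S₁ : Fin m → Finset (Fin (m + n + 1)))
    (hS₁ : ∀ j, (S₁ j).card = j) (S₂ : Fin n → Finset (Fin (m + n + 1))) (hS₂ : ∀ j, (S₂ j).card = j)
    (y : Fin (m + n + 1) → ℂ) (ε : ℂ) (x : Fin (m + n + 1 + 1) → ℂ) (p : Fin m ⊕ Fin n → ℂ)
    (h : ∀ i b, 0 < sgn i * ((y b).im - (p i).im) ∨ (y b).re - (p i).re ≠ 0) :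
    kern ħ (fun w e => F₁ (w, e, headC x)) (fun z e => F₂ (z, e, tailC x)) y ε p =
      ∑ σ : Equiv.Perm (Fin m) × Equiv.Perm (Fin n),
        ((Equiv.Perm.sign σ.1 : ℂ) * (Equiv.Perm.sign σ.2 : ℂ)) *
          termKern ħ F₁ F₂ (Sum.elim (fun a => S₁ (σ.1 a)) fun b => S₂ (σ.2 b)) y ε x p := by
  have h1 := prod_Ioi_sub_eq_sum S₁ hS₁ (fun a => Complex.exp (2 * Real.pi * p (.inl a) / ħ))
    fun b => Complex.exp (2 * Real.pi * y b / ħ)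
  have h2 := prod_Ioi_sub_eq_sum S₂ hS₂ (fun a => Complex.exp (2 * Real.pi * p (.inr a) / ħ))
    fun b => Complex.exp (2 * Real.pi * y b / ħ)
  rw [kern_eq_outerPart, diagPart_eq hħ, diagPart_eq hħ, h1, h2, Fintype.sum_prod_type]
  simp only [Finset.mul_sum, Finset.sum_mul]
  rw [Finset.sum_comm]
  refine Finset.sum_congr rfl fun σ _ => Finset.sum_congr rfl fun σ' _ => ?_
  rw [termKern, ← polePart_mul_prod hħ _ p y h, Fintype.prod_sum_type]
  simp only [Sum.elim_inl, Sum.elim_inr]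
  ring

theorem exists_regGamma_growth (hħ : 0 < ħ) (m n : ℕ) : ∃ C : ℝ, 0 ≤ C ∧ ∀ (i : Fin m ⊕ Fin n) (p y : ℂ) (ρ : ℝ),
    2 ≤ ρ → ‖p‖ ≤ ρ → ‖y‖ ≤ ρ →
    ‖regGamma ħ i p y‖ ≤ Real.exp (sgn i * (y.im - p.im) / ħ * Real.log ρ + C * ρ) := by
  obtain ⟨C, hC, h⟩ := exists_norm_inv_Gamma_le (K := 1 + 2 / ħ) (by positivity)
  have hpi := Real.pi_pos
  refine ⟨2 * Real.pi + 2 * Real.pi / ħ + C, by positivity, fun i p y ρ hρ hp hy => ?_⟩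
  have hlog : 0 ≤ Real.log ρ := Real.log_nonneg (by linarith)
  have h1 : ‖-sgn i * 2 * Complex.I * Real.pi‖ ≤ Real.exp (2 * Real.pi * ρ) := by
    rw [norm_mul, norm_mul, norm_mul, norm_neg, Complex.norm_real, Real.norm_eq_abs, abs_sgn, Complex.norm_I,
      Complex.norm_real, Real.norm_of_nonneg hpi.le, Complex.norm_ofNat]
    have := Real.add_one_le_exp (2 * Real.pi * ρ)
    nlinarith
  have h2 : ‖Complex.exp (Real.pi * (p + y) / ħ)‖ ≤ Real.exp (2 * Real.pi / ħ * ρ) := by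
    refine (Complex.norm_exp_le_exp_norm _).trans (Real.exp_le_exp.2 ?_)
    rw [norm_div, norm_mul, Complex.norm_real, Complex.norm_real, Real.norm_of_nonneg hpi.le,
      Real.norm_of_nonneg hħ.le]
    calc _ ≤ Real.pi * (ρ + ρ) / ħ := by
          gcongr
          exact (norm_add_le _ _).trans (by linarith)
      _ = _ := by ring
  have h3 : ‖(Complex.Gamma (1 - sgn i * (y - p) / (Complex.I * ħ)))⁻¹‖ ≤
      Real.exp (sgn i * (y.im - p.im) / ħ * Real.log ρ + C * ρ) := by
    refine (h ρ hρ _ ?_).trans (Real.exp_le_exp.2 ?_)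
    · refine (norm_sub_le _ _).trans ?_
      rw [norm_div_I_mul hħ, norm_mul, Complex.norm_real, Real.norm_eq_abs, abs_sgn, one_mul, norm_one, add_mul,
        one_mul, div_mul_eq_mul_div]
      have := norm_sub_le y p
      gcongr <;> linarith
    · rw [Complex.sub_re, div_I_mul_re, Complex.im_ofReal_mul, Complex.sub_im, Complex.one_re]
      gcongr
      linarith
  rw [regGamma]
  refine (norm_mul_le_exp (norm_mul_le_exp h1 h2) h3).trans_eq ?_
  congr 1; ring

theorem exists_killPart_growth (hħ : 0 < ħ) (m n N : ℕ) : ∃ C : ℝ, 0 ≤ C ∧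
    ∀ (kill : Fin m ⊕ Fin n → Finset (Fin N)) (p : Fin m ⊕ Fin n → ℂ) (y : Fin N → ℂ) (ρ : ℝ),
      2 ≤ ρ → ‖p‖ ≤ ρ → ‖y‖ ≤ ρ →
      (∀ i, ∀ b ∉ kill i, 1 ≤ sgn i * ((y b).im - (p i).im) ∨ 1 ≤ |(y b).re - (p i).re|) →
      ‖killPart ħ kill p y‖ ≤ Real.exp (C * ρ +
        (∑ i, ∑ b, sgn i * ((y b).im - (p i).im)) / ħ * Real.log ρ) := by
  obtain ⟨C, hC, h⟩ := exists_norm_Gamma_le (K := 2 / ħ) (δ := 1 / ħ) (by positivity) (by positivity)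
  obtain ⟨C', hC', h'⟩ := exists_regGamma_growth hħ m n
  refine ⟨Fintype.card (Fin m ⊕ Fin n) * (N * (C + C')), by positivity, fun kill p y ρ hρ hp hy hs => ?_⟩
  refine (norm_prod_le_exp _ _ (fun i => ∑ b, (sgn i * ((y b).im - (p i).im) / ħ * Real.log ρ + (C + C') * ρ))
    fun i _ => norm_prod_le_exp _ _ _ fun b _ => ?_).trans_eq ?_
  · have hpi := (norm_le_pi_norm p i).trans hp
    have hyb := (norm_le_pi_norm y b).trans hy
    split_ifs with hb
    · refine (h' i _ _ ρ hρ hpi hyb).trans (Real.exp_le_exp.2 ?_)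
      gcongr
      linarith
    · refine (h ρ hρ _ ?_ ?_).trans (Real.exp_le_exp.2 ?_)
      · rw [norm_div_I_mul hħ, div_mul_eq_mul_div, norm_mul, Complex.norm_real, Real.norm_eq_abs, abs_sgn,
          one_mul]
        gcongr
        exact (norm_sub_le _ _).trans (by linarith)
      · rw [div_I_mul_re, div_I_mul_im, Complex.im_ofReal_mul, Complex.re_ofReal_mul, abs_div, abs_neg, abs_mul,
          abs_sgn, one_mul, abs_of_pos hħ, Complex.sub_im, Complex.sub_re]
        refine (hs i b hb).imp (fun h => ?_) fun h => ?_ <;> gcongr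
      · rw [div_I_mul_re, Complex.im_ofReal_mul, Complex.sub_im]
        gcongr
        linarith
  · congr 1
    simp only [Finset.sum_add_distrib, Finset.sum_const, Finset.card_univ, nsmul_eq_mul,
      Fintype.card_fin, Finset.sum_div, Finset.sum_mul]
    ring

theorem exists_smoothPart_growth (hħ : 0 < ħ) (m : ℕ) : ∃ C : ℝ, 0 ≤ C ∧ ∀ (w : Fin m → ℂ) (ρ : ℝ),
    0 ≤ ρ → ‖w‖ ≤ ρ → ‖smoothPart ħ w‖ ≤ Real.exp (C * ρ) := by
  have hpi := Real.pi_pos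
  refine ⟨m * (m * (1 / ħ + 2 * Real.pi / ħ)), by positivity, fun w ρ hρ hw => ?_⟩
  refine (norm_prod_le_exp _ _ (fun a => ∑ b ∈ Finset.Ioi a, (1 / ħ + 2 * Real.pi / ħ) * ρ)
    fun a _ => norm_prod_le_exp _ _ _ fun b _ => ?_).trans (Real.exp_le_exp.2 ?_)
  · have ha := (norm_le_pi_norm w a).trans hw
    have hb := (norm_le_pi_norm w b).trans hw
    rw [add_mul]
    refine norm_mul_le_exp ?_ ?_
    · rw [norm_div, norm_div_I_mul hħ, norm_mul, norm_mul, Complex.norm_I, Complex.norm_real,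
        Real.norm_of_nonneg hpi.le, Complex.norm_ofNat, mul_one]
      have h1 : ‖w a - w b‖ ≤ 2 * ρ := (norm_sub_le _ _).trans (by linarith)
      have h2 := Real.add_one_le_exp (1 / ħ * ρ)
      have h3 : ‖w a - w b‖ / ħ / (2 * Real.pi) ≤ 1 / ħ * ρ := by
        rw [div_le_iff₀ (by positivity)]
        calc _ ≤ 2 * ρ / ħ := by gcongr
          _ = 1 / ħ * ρ * (2 * 1) := by ring
          _ ≤ _ := by
            gcongr
            linarith [Real.pi_gt_three]
      linarith
    · refine (Complex.norm_exp_le_exp_norm _).trans (Real.exp_le_exp.2 ?_)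
      rw [norm_neg, norm_div, norm_mul, Complex.norm_real, Complex.norm_real, Real.norm_of_nonneg hpi.le,
        Real.norm_of_nonneg hħ.le]
      calc _ ≤ Real.pi * (ρ + ρ) / ħ := by
            gcongr
            exact (norm_add_le _ _).trans (by linarith)
        _ = _ := by ring
  · have h : ∀ a : Fin m, ∑ b ∈ Finset.Ioi a, (1 / ħ + 2 * Real.pi / ħ) * ρ ≤ m * ((1 / ħ + 2 * Real.pi / ħ) * ρ) := by
      intro a
      rw [Finset.sum_const, nsmul_eq_mul]
      have : ((Finset.Ioi a).card : ℝ) ≤ m := by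
        exact_mod_cast (Finset.card_le_univ _).trans_eq (Fintype.card_fin m)
      gcongr
    refine (Finset.sum_le_sum fun a _ => h a).trans_eq ?_
    simp only [Finset.sum_const, Finset.card_univ, nsmul_eq_mul, Fintype.card_fin]
    ring

theorem exists_growthAt_termKern (hħ : 0 < ħ) (h₁ : HasGrowth ħ F₁) (h₂ : HasGrowth ħ F₂) (X : ℝ) {κ : ℝ}
    (hκ : 0 < κ) : ∃ C : ℝ, 0 ≤ C ∧ ∀ kill y ε x (p : Fin m ⊕ Fin n → ℂ), ‖x‖ ≤ X →
      (∀ i, ∀ b ∉ kill i, 1 ≤ sgn i * ((y b).im - (p i).im) ∨ 1 ≤ |(y b).re - (p i).re|) →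
      GrowthAt ħ C κ y ε p (termKern ħ F₁ F₂ kill y ε x p) := by
  obtain ⟨C₁, hC₁, b₁⟩ := exists_outerPart_growth hħ h₁ h₂ X hκ
  obtain ⟨C₂, hC₂, b₂⟩ := exists_smoothPart_growth hħ m
  obtain ⟨C₃, hC₃, b₃⟩ := exists_smoothPart_growth hħ n
  obtain ⟨C₄, hC₄, b₄⟩ := exists_killPart_growth hħ m n (m + n + 1)
  refine ⟨C₁ + C₂ + C₃ + C₄, by positivity, fun kill y ε x p hx hs ρ hp hy => ?_⟩
  have hp0 := norm_nonneg p
  have hnw : ‖fun a => p (.inl a)‖ ≤ ‖p‖ :=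
    (pi_norm_le_iff_of_nonneg hp0).2 fun a => norm_le_pi_norm p _
  have hnz : ‖fun a => p (.inr a)‖ ≤ ‖p‖ :=
    (pi_norm_le_iff_of_nonneg hp0).2 fun a => norm_le_pi_norm p _
  refine (norm_mul_le_exp (b₁ y ε x p ρ hx hp hy) (norm_mul_le_exp (norm_mul_le_exp
    (b₂ _ ρ (by linarith) (by linarith)) (b₃ _ ρ (by linarith) (by linarith)))
    (b₄ kill p y ρ (by linarith) (by linarith) hy hs))).trans (Real.exp_le_exp.2 ?_)
  rw [← energy_eq]
  have : 0 ≤ (C₂ + C₃ + C₄) * ‖ε‖ := by positivity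
  refine le_of_eq_of_le ?_ (add_le_add_left (b := C₁ * (ρ + ‖ε‖) + (C₂ + C₃ + C₄) * ρ) (by linarith) _)
  ring

theorem differentiableAt_regGamma {E : Type*} [NormedAddCommGroup E] [NormedSpace ℂ E] (i : Fin m ⊕ Fin n)
    {p : E → ℂ} (y : ℂ) {e₀ : E} (hp : DifferentiableAt ℂ p e₀) :
    DifferentiableAt ℂ (fun e => regGamma ħ i (p e) y) e₀ := by
  unfold regGamma
  refine DifferentiableAt.mul (DifferentiableAt.mul (differentiableAt_const _) ?_) (differentiableAt_inv_Gamma ?_)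
  · exact (differentiableAt_div_const ((hp.add_const _).const_mul _) _).cexp
  · exact (differentiableAt_div_const ((hp.const_sub _).const_mul _) _).const_sub _

theorem differentiableAt_termKern (hħ : 0 < ħ) (hF₁ : Differentiable ℂ F₁) (hF₂ : Differentiable ℂ F₂)
    (kill : Fin m ⊕ Fin n → Finset (Fin (m + n + 1)))
    (y : Fin (m + n + 1) → ℂ) (ε : ℂ) (x : Fin (m + n + 1 + 1) → ℂ) {p : Fin m ⊕ Fin n → ℂ}
    (h : ∀ i, ∀ b ∉ kill i, 0 < sgn i * ((y b).im - (p i).im) ∨ (y b).re - (p i).re ≠ 0) :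
    DifferentiableAt ℂ (termKern ħ F₁ F₂ kill y ε x) p := by
  have hid : DifferentiableAt ℂ (fun p : Fin m ⊕ Fin n → ℂ => p) p := differentiableAt_fun_id
  unfold termKern
  refine DifferentiableAt.mul ?_ (DifferentiableAt.mul (DifferentiableAt.mul ?_ ?_) ?_)
  · unfold outerPart
    refine DifferentiableAt.mul (DifferentiableAt.mul ?_ ?_) (((differentiableAt_const _).mul
      (differentiableAt_powPart hħ hid (differentiableAt_const _))).mul (differentiableAt_crossPart hid))
    · exact (hF₁ _).comp p (f := fun p : Fin m ⊕ Fin n → ℂ =>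
        ((fun a => p (.inl a)), ∑ k, y k - ∑ b, p (.inr b), headC x)) (by fun_prop)
    · exact (hF₂ _).comp p (f := fun p : Fin m ⊕ Fin n → ℂ =>
        ((fun a => p (.inr a)), ε - ∑ k, y k + ∑ b, p (.inr b), tailC x)) (by fun_prop)
  · unfold smoothPart
    exact differentiableAt_prod fun a _ => differentiableAt_prod fun b _ => by
      refine DifferentiableAt.mul (differentiableAt_div_const (differentiableAt_div_const (by fun_prop) _) _) ?_
      exact (differentiableAt_div_const (by fun_prop) _).neg.cexp
  · unfold smoothPart
    exact differentiableAt_prod fun a _ => differentiableAt_prod fun b _ => by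
      refine DifferentiableAt.mul (differentiableAt_div_const (differentiableAt_div_const (by fun_prop) _) _) ?_
      exact (differentiableAt_div_const (by fun_prop) _).neg.cexp
  · unfold killPart
    refine differentiableAt_prod fun i _ => differentiableAt_prod fun b _ => ?_
    split_ifs with hb
    · exact differentiableAt_regGamma i _ (differentiableAt_apply i p)
    · refine DifferentiableAt.comp (g := Complex.Gamma) p (Complex.differentiableAt_Gamma _ ?_)
        (differentiableAt_div_const (((differentiableAt_apply i p).const_sub _).const_mul _) _)
      intro k hk
      have hre := congrArg Complex.re hk
      have him := congrArg Complex.im hk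
      rw [div_I_mul_re, Complex.im_ofReal_mul, Complex.sub_im] at hre
      rw [div_I_mul_im, Complex.re_ofReal_mul, Complex.sub_re] at him
      simp only [Complex.neg_re, Complex.natCast_re, Complex.neg_im, Complex.natCast_im, neg_zero] at hre him
      rcases h i b hb with h | h
      · have h1 : 0 < sgn i * ((y b).im - (p i).im) / ħ := by positivity
        have : (0:ℝ) ≤ k := by positivity
        linarith
      · have : sgn i ≠ 0 := by
          intro h0; have := abs_sgn i; rw [h0] at this; simp at this
        simp [hħ.ne', this] at him
        exact h him

end Term

/-- The first `m` of `m + n + 1` indices. -/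
def lo {m n : ℕ} (a : Fin m) : Fin (m + n + 1) := ⟨a, by omega⟩

/-- The last `n` of `m + n + 1` indices. -/
def hi {m n : ℕ} (b : Fin n) : Fin (m + n + 1) := ⟨m + 1 + b, by omega⟩

/-- The index between the first `m` and the last `n` of `m + n + 1` indices. -/
def mid {m n : ℕ} : Fin (m + n + 1) := ⟨m, by omega⟩

theorem sum_lo_mid_hi {m n : ℕ} (f : Fin (m + n + 1) → ℝ) :
    ∑ k, f k = ∑ a, f (lo a) + f mid + ∑ b, f (hi b) := by
  have h : m + (1 + n) = m + n + 1 := by omega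
  rw [← (finCongr h).sum_comp f, Fin.sum_univ_add, Fin.sum_univ_add, ← add_assoc]
  congr 1
  · congr 1
    rw [Fin.sum_univ_one]
    exact congrArg f (Fin.ext (by simp [mid]))
  · exact Finset.sum_congr rfl fun b _ => congrArg f (Fin.ext (by simp [hi]; omega))

theorem energy_sorted {m n : ℕ} {Y : Fin (m + n + 1) → ℝ} (hY : Monotone Y) :
    energy Y (Sum.elim (fun a => Y (lo a)) fun b => -Y (hi b)) = spread Y := by
  have h1 : ∀ a : Fin m, Y (lo a) ≤ Y (mid (n := n)) := fun a => hY (by simp [lo, mid, Fin.le_def])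
  have h2 : ∀ b : Fin n, Y (mid (m := m)) ≤ Y (hi b) := fun b => hY (by simp [hi, mid, Fin.le_def]; omega)
  have h3 : ∀ (a : Fin m) (b : Fin n), Y (lo a) ≤ Y (hi b) := fun a b => (h1 a).trans (h2 b)
  have e1 : ∀ a : Fin m, |Y (lo a) - Y mid| = Y mid - Y (lo a) := fun a => by
    rw [abs_sub_comm, abs_of_nonneg]; linarith [h1 a]
  have e1' : ∀ a : Fin m, |Y mid - Y (lo a)| = Y mid - Y (lo a) := fun a => by
    rw [abs_of_nonneg]; linarith [h1 a]
  have e2 : ∀ b : Fin n, |Y mid - Y (hi b)| = Y (hi b) - Y mid := fun b => by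
    rw [abs_sub_comm, abs_of_nonneg]; linarith [h2 b]
  have e2' : ∀ b : Fin n, |Y (hi b) - Y mid| = Y (hi b) - Y mid := fun b => by
    rw [abs_of_nonneg]; linarith [h2 b]
  have e3 : ∀ (a : Fin m) (b : Fin n), |Y (lo a) - Y (hi b)| = Y (hi b) - Y (lo a) := fun a b => by
    rw [abs_sub_comm, abs_of_nonneg]; linarith [h3 a b]
  have e3' : ∀ (a : Fin m) (b : Fin n), |Y (hi b) - Y (lo a)| = Y (hi b) - Y (lo a) := fun a b => by
    rw [abs_of_nonneg]; linarith [h3 a b]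
  unfold energy
  simp only [Sum.elim_inl, Sum.elim_inr, spread_neg]
  unfold spread
  simp only [sum_lo_mid_hi, e1, e1', e2, e2', e3, e3', Finset.sum_add_distrib, Finset.sum_sub_distrib,
    Finset.sum_const, Finset.card_univ, Fintype.card_fin, nsmul_eq_mul, sub_self, abs_zero,
    Finset.sum_neg_distrib, ← Finset.mul_sum]
  ring

theorem spread_sub_const {N : ℕ} (Y : Fin N → ℝ) (K : ℝ) : spread (fun a => Y a - K) = spread Y := by
  simp [spread]

theorem energy_sorted_perm {m n : ℕ} {Y : Fin (m + n + 1) → ℝ} (hY : Monotone Y) (σ : Equiv.Perm (Fin m))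
    (σ' : Equiv.Perm (Fin n)) (K : ℝ) :
    energy Y (fun i => Sum.elim (fun a => Y (lo (σ a))) (fun b => -Y (hi (σ' b))) i - K) =
      spread Y + (m * (m + 1) + n * (n + 1)) * K := by
  rw [← energy_sorted hY]
  unfold energy
  simp only [Sum.elim_inl, Sum.elim_inr, spread_sub_const, Finset.sum_sub_distrib, spread_neg]
  rw [spread_comp (fun a => Y (lo a)) σ, spread_comp (fun b => Y (hi b)) σ',
    Equiv.sum_comp σ fun a => Y (lo a), Equiv.sum_comp σ' fun b => -Y (hi b)]
  simp only [Finset.sum_const, Finset.card_univ, Fintype.card_fin, nsmul_eq_mul]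
  ring

theorem spread_im_le {N : ℕ} (y : Fin N → ℂ) : spread (fun k => (y k).im) ≤ N ^ 2 * ‖y‖ := by
  have h : ∀ a b, |(y a).im - (y b).im| ≤ 2 * ‖y‖ := fun a b => by
    rw [← Complex.sub_im]
    refine (Complex.abs_im_le_norm _).trans ((norm_sub_le _ _).trans ?_)
    linarith [norm_le_pi_norm y a, norm_le_pi_norm y b]
  unfold spread
  have := Finset.sum_le_sum fun a (_ : a ∈ Finset.univ) => Finset.sum_le_sum fun b (_ : b ∈ Finset.univ) => h a b
  simp only [Finset.sum_const, Finset.card_univ, Fintype.card_fin, nsmul_eq_mul] at this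
  linarith

theorem tiltPt_separated_of_le {m n N : ℕ} {R c r κ : ℝ} (hR : 0 < R) {y : Fin N → ℂ} (hy : ‖y‖ + 1 ≤ r)
    {ϑ : Fin m ⊕ Fin n → ℝ} {i : Fin m ⊕ Fin n} (h0 : 0 ≤ Real.sin (ϑ i)) (hκ : 0 ≤ κ)
    (h1 : Real.sin (ϑ i) ≤ κ * Real.cos (ϑ i)) (hcos : 0 ≤ Real.cos (ϑ i)) (t : Fin m ⊕ Fin n → ℝ) {b : Fin N}
    (hb : R * Real.sin (ϑ i) - c + κ * r + 1 ≤ sgn i * (y b).im) :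
    1 ≤ sgn i * ((y b).im - (tiltPt R c (ang ϑ t) i).im) ∨
      1 ≤ |(y b).re - (tiltPt R c (ang ϑ t) i).re| := by
  by_contra! h
  obtain ⟨ha, hb'⟩ := h
  have hre := (Complex.abs_re_le_norm (y b)).trans (norm_le_pi_norm y b)
  rw [mul_sub, sgn_mul_tiltPt_ang_im] at ha
  rw [tiltPt_ang_re] at hb'
  have h2 : |R * (Real.sinh (t i) * Real.cos (ϑ i))| ≤ r := by
    have := abs_sub_abs_le_abs_sub (R * (Real.sinh (t i) * Real.cos (ϑ i))) (y b).re
    rw [abs_sub_comm] at this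
    linarith
  rw [abs_mul, abs_mul, abs_of_pos hR, abs_of_nonneg hcos] at h2
  have h3 : R * Real.sin (ϑ i) * Real.cosh (t i) ≤ R * Real.sin (ϑ i) + κ * r := by
    have h4 := cosh_le_one_add_abs_sinh (t i)
    calc _ ≤ R * Real.sin (ϑ i) * (1 + |Real.sinh (t i)|) := by gcongr
      _ = R * Real.sin (ϑ i) + R * (|Real.sinh (t i)| * Real.sin (ϑ i)) := by ring
      _ ≤ R * Real.sin (ϑ i) + R * (|Real.sinh (t i)| * (κ * Real.cos (ϑ i))) := by gcongr
      _ = R * Real.sin (ϑ i) + κ * (R * (|Real.sinh (t i)| * Real.cos (ϑ i))) := by ring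
      _ ≤ _ := by gcongr
  linarith

set_option maxHeartbeats 1600000 in
theorem exists_jacobian_mul_le_of_energy_le {ħ : ℝ} (hħ : 0 < ħ) (m n : ℕ) {C σ : ℝ} (hC : 0 ≤ C)
    (hσ : 0 < σ) (hσ1 : σ ≤ 1) : ∃ C' : ℝ, 0 ≤ C' ∧ ∀ (y : Fin (m + n + 1) → ℂ) (ε : ℂ)
      (ϑ t g : Fin m ⊕ Fin n → ℝ) (v : ℂ),
      (∀ i, 4 * (1 + ‖y‖) / σ * Real.sin (ϑ i) = 7 * (1 + ‖y‖) + g i) →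
      (∀ i, 4 * (1 + ‖y‖) ≤ 7 * (1 + ‖y‖) + g i) →
      energy (fun k => (y k).im) g ≤ spread (fun k => (y k).im) +
        (m * (m + 1) + n * (n + 1)) * (1 + 4 * σ * (1 + ‖y‖)) →
      GrowthAt ħ C (σ ^ 2 / (9 + 4 * (m + n))) y ε
        (tiltPt (4 * (1 + ‖y‖) / σ) (7 * (1 + ‖y‖)) (ang ϑ t)) v →
      ‖(∏ i, ((4 * (1 + ‖y‖) / σ : ℝ) : ℂ) * Complex.cosh (ang ϑ t i)) * v‖ ≤
        Real.exp (C' * (1 + ‖y‖ + ‖ε‖) + (spread (fun k => (y k).im) +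
          (4 * (m * (m + 1) + n * (n + 1)) + 1) * σ * ‖y‖) / ħ * Real.log (2 + ‖y‖)) *
          Real.exp (-1 * ∑ i, Real.cosh (t i)) := by
  set A : ℝ := m * (m + 1) + n * (n + 1) with hA
  set k : ℝ := m + n with hk
  have hA0 : 0 ≤ A := by positivity
  have hk0 : 0 ≤ k := by positivity
  set κ := σ ^ 2 / (9 + 4 * k) with hκ
  set l₀ := 9 + 4 * k / σ with hl₀
  set S : ℝ := (m + n + 1) ^ 2 + A + (4 * A + 1) with hS
  set a := 1 + C + σ / 4 + (S + 7 * σ / 4 * l₀) / ħ with ha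
  have ha0 : 0 ≤ a := by positivity
  set s := 7 * σ / 4 / ħ with hs
  have hs0 : 0 < s := by positivity
  set K := a * Real.exp (a / s) with hK
  refine ⟨C + K + 2 * ((A + (4 * A + 1) * σ) / ħ), by positivity, fun y ε ϑ t g v hg hg4 hen hv => ?_⟩
  have hy0 := norm_nonneg y
  set r := 1 + ‖y‖ with hr
  have hr1 : 1 ≤ r := by linarith
  set R := 4 * r / σ with hR
  have hR0 : 0 < R := by positivity
  set χ := ∑ i, Real.cosh (t i) with hχ
  set u := ∑ i, (Real.cosh (t i) - 1) with hu
  have huχ : χ = u + k := by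
    rw [hu, hχ, Finset.sum_sub_distrib]; simp [hk]
  have hu0 : 0 ≤ u := Finset.sum_nonneg fun i _ => by linarith [Real.one_le_cosh (t i)]
  have hχ0 : 0 ≤ χ := by linarith
  set l := 9 + 4 * χ / σ with hl
  have hl9 : 9 ≤ l := by
    have : 0 ≤ 4 * χ / σ := by positivity
    linarith
  have hlog_l : 0 ≤ Real.log l := Real.log_nonneg (by linarith)
  have hlog_l' : Real.log l ≤ l := (Real.log_le_sub_one_of_pos (by linarith)).trans (by linarith)
  have hlog_r : 0 ≤ Real.log r := Real.log_nonneg hr1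
  have hρ : 9 * r + R * χ = r * l := by rw [hR, hl]; ring
  have hlogρ : Real.log (r * l) = Real.log r + Real.log l := Real.log_mul (by linarith) (by linarith)
  have hrl : r ≤ r * l := le_mul_of_one_le_right (by linarith) (by linarith)
  have hp := norm_tiltPt_ang_le (c := 7 * r) hR0.le ϑ t
  rw [abs_of_nonneg (by linarith : 0 ≤ 7 * r)] at hp
  have hv' := hv (r * l) (by linarith) (by linarith)
  refine (norm_mul_le_exp (norm_jacobian_le hR0.le ϑ t) hv').trans ?_
  rw [← Real.exp_add]
  refine Real.exp_le_exp.2 ?_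
  have hh : (fun i => sgn i * (tiltPt R (7 * r) (ang ϑ t) i).im) =
      fun i => g i + (7 * r + g i) * (Real.cosh (t i) - 1) := by
    funext i
    rw [sgn_mul_tiltPt_ang_im, hg i]; ring
  rw [hh]
  have hE := energy_add_le (fun k => (y k).im) g (fun i => (7 * r + g i) * (Real.cosh (t i) - 1))
    fun i => mul_nonneg (by linarith [hg4 i]) (by linarith [Real.one_le_cosh (t i)])
  have hsum : 4 * r * u ≤ ∑ i, (7 * r + g i) * (Real.cosh (t i) - 1) := by
    rw [hu, Finset.mul_sum]
    refine Finset.sum_le_sum fun i _ => mul_le_mul_of_nonneg_right (hg4 i) ?_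
    linarith [Real.one_le_cosh (t i)]
  set G := spread fun k => (y k).im with hG
  have hG0 : 0 ≤ G := spread_nonneg _
  have hGN : G ≤ (m + n + 1) ^ 2 * ‖y‖ := by
    have := spread_im_le y
    push_cast at this
    exact this
  have hκl : κ * (r * l) ≤ r * σ + r * u := by
    have e : κ * (r * l) = r * (σ * ((9 * σ + 4 * k) / (9 + 4 * k))) + r * u * (4 * σ / (9 + 4 * k)) := by
      rw [hκ, hl, huχ]; field_simp; ring
    rw [e]
    have h1 : (9 * σ + 4 * k) / (9 + 4 * k) ≤ 1 := by
      rw [div_le_one (by positivity)]; linarith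
    have h2 : 4 * σ / (9 + 4 * k) ≤ 1 := by
      rw [div_le_one (by positivity)]; linarith
    have h3 : r * (σ * ((9 * σ + 4 * k) / (9 + 4 * k))) ≤ r * (σ * 1) := by gcongr
    have h4 : r * u * (4 * σ / (9 + 4 * k)) ≤ r * u * 1 := by gcongr
    linarith
  set P := G + A + (4 * A + 1) * σ * r with hP
  have hP0 : 0 ≤ P := by positivity
  have hPS : P ≤ S * r := by
    have h1 : (4 * A + 1) * σ * r ≤ (4 * A + 1) * 1 * r := by gcongr
    have h2 : A ≤ A * r := le_mul_of_one_le_right hA0 hr1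
    have h3 : ((m:ℝ) + n + 1) ^ 2 * ‖y‖ ≤ (m + n + 1) ^ 2 * r := by gcongr; linarith
    rw [hP, hS]; linarith
  have hbr : energy (fun k => (y k).im) (fun i => g i + (7 * r + g i) * (Real.cosh (t i) - 1)) + κ * (r * l) ≤
      P - 7 * (r * u) := by
    rw [hP]
    linarith
  have hru : 0 ≤ r * u := by positivity
  have h1 : (energy (fun k => (y k).im) (fun i => g i + (7 * r + g i) * (Real.cosh (t i) - 1)) + κ * (r * l)) / ħ *
      Real.log (r * l) ≤ P / ħ * Real.log r + r * ((S - 7 * u) / ħ * Real.log l) := by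
    rw [hlogρ]
    have q1 : (energy (fun k => (y k).im) (fun i => g i + (7 * r + g i) * (Real.cosh (t i) - 1)) + κ * (r * l)) / ħ *
      (Real.log r + Real.log l) ≤ (P - 7 * (r * u)) / ħ * (Real.log r + Real.log l) := by gcongr
    have q2 : (P - 7 * (r * u)) / ħ * Real.log r ≤ P / ħ * Real.log r := by gcongr; linarith
    have q3 : (P - 7 * (r * u)) / ħ * Real.log l ≤ (S * r - 7 * (r * u)) / ħ * Real.log l := by gcongr
    have q4 : (S * r - 7 * (r * u)) / ħ * Real.log l = r * ((S - 7 * u) / ħ * Real.log l) := by ring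
    linarith
  have h2 : (S - 7 * u) / ħ * Real.log l ≤ (S + 7 * σ / 4 * l₀) / ħ * l - s * l * Real.log l := by
    have e : (S - 7 * u) / ħ * Real.log l = (S + 7 * σ / 4 * l₀) / ħ * Real.log l - s * l * Real.log l := by
      rw [hs, hl₀, hl, huχ]; field_simp; ring
    rw [e]
    gcongr
  have h3 : χ ≤ σ / 4 * l := by
    rw [hl, mul_add]
    have : σ / 4 * (4 * χ / σ) = χ := by field_simp
    linarith
  have key := mul_sub_mul_log_le ha0 hs0 (by linarith : 1 ≤ l)
  have h4 : R * χ + C * (r * l) + χ + r * ((S - 7 * u) / ħ * Real.log l) ≤ r * K := by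
    have q1 : R * χ ≤ r * l := by linarith
    have q2 : χ ≤ r * (σ / 4 * l) := h3.trans (le_mul_of_one_le_left (hχ0.trans h3) hr1)
    have q3 : r * ((S - 7 * u) / ħ * Real.log l) ≤ r * ((S + 7 * σ / 4 * l₀) / ħ * l - s * l * Real.log l) := by gcongr
    have q4 : r * (a * l - s * l * Real.log l) ≤ r * K := by gcongr
    have q5 : r * (a * l - s * l * Real.log l) = r * l + C * (r * l) + r * (σ / 4 * l) +
      r * ((S + 7 * σ / 4 * l₀) / ħ * l - s * l * Real.log l) := by rw [ha]; ring
    linarith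
  set ℓ := Real.log (2 + ‖y‖) with hℓ
  have hrℓ : Real.log r ≤ ℓ := Real.log_le_log (by linarith) (by linarith)
  have hℓ2 : ℓ ≤ 2 * r := (Real.log_le_sub_one_of_pos (by linarith)).trans (by linarith)
  have h5 : P / ħ * Real.log r ≤ (G + (4 * A + 1) * σ * ‖y‖) / ħ * ℓ + 2 * ((A + (4 * A + 1) * σ) / ħ) * r := by
    calc P / ħ * Real.log r ≤ P / ħ * ℓ := by gcongr
      _ = (G + (4 * A + 1) * σ * ‖y‖) / ħ * ℓ + (A + (4 * A + 1) * σ) / ħ * ℓ := by rw [hP, hr]; ring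
      _ ≤ (G + (4 * A + 1) * σ * ‖y‖) / ħ * ℓ + (A + (4 * A + 1) * σ) / ħ * (2 * r) := by gcongr
      _ = _ := by ring
  have h6 : C * (r * l + ‖ε‖) = C * (r * l) + C * ‖ε‖ := by ring
  have h7 : C * ‖ε‖ + r * K + 2 * ((A + (4 * A + 1) * σ) / ħ) * r ≤
      (C + K + 2 * ((A + (4 * A + 1) * σ) / ħ)) * (r + ‖ε‖) := by
    have : 0 ≤ (K + 2 * ((A + (4 * A + 1) * σ) / ħ)) * ‖ε‖ + C * r := by positivity
    linarith
  linarith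

section Term
variable {ħ : ℝ} {m n : ℕ} {F₁ : (Fin m → ℂ) × ℂ × (Fin (m + 1) → ℂ) → ℂ}
  {F₂ : (Fin n → ℂ) × ℂ × (Fin (n + 1) → ℂ) → ℂ}
  {Φ₁ : (Fin m → ℂ) → ℂ → (Fin (m + 1) → ℝ) → ℂ} {Φ₂ : (Fin n → ℂ) → ℂ → (Fin (n + 1) → ℝ) → ℂ}

/-- A term of the expansion of the integrand on tilted contours, including the Jacobian. -/
def tiltTerm (ħ : ℝ) {m n : ℕ} (F₁ : (Fin m → ℂ) × ℂ × (Fin (m + 1) → ℂ) → ℂ)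
    (F₂ : (Fin n → ℂ) × ℂ × (Fin (n + 1) → ℂ) → ℂ) (kill : Fin m ⊕ Fin n → Finset (Fin (m + n + 1)))
    (R c : ℝ) (y : Fin (m + n + 1) → ℂ) (ε : ℂ) (x : Fin (m + n + 1 + 1) → ℂ)
    (τ : Fin m ⊕ Fin n → ℂ) : ℂ :=
  (∏ i, (R : ℂ) * Complex.cosh (τ i)) * termKern ħ F₁ F₂ kill y ε x (tiltPt R c τ)

theorem integral_tiltTerm_eq (hħ : 0 < ħ) (hF₁ : Differentiable ℂ F₁) (hF₂ : Differentiable ℂ F₂)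
    (h₁ : HasGrowth ħ F₁) (h₂ : HasGrowth ħ F₂) (kill : Fin m ⊕ Fin n → Finset (Fin (m + n + 1)))
    {R : ℝ} (hR : 0 < R) (c : ℝ) (y : Fin (m + n + 1) → ℂ) (ε : ℂ) (x : Fin (m + n + 1 + 1) → ℂ) {θ : ℝ}
    (hθ : 0 < θ) (ϑ : Fin m ⊕ Fin n → ℝ) (hϑ : ∀ i, θ ≤ ϑ i) (hϑ' : ∀ i, ϑ i ≤ Real.pi / 4)
    (hsep : ∀ ϑ' t : Fin m ⊕ Fin n → ℝ, (∀ i, θ ≤ ϑ' i ∧ ϑ' i ≤ ϑ i) → ∀ i, ∀ b ∉ kill i,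
      1 ≤ sgn i * ((y b).im - (tiltPt R c (ang ϑ' t) i).im) ∨
      1 ≤ |(y b).re - (tiltPt R c (ang ϑ' t) i).re|) :
    (Integrable fun t => tiltTerm ħ F₁ F₂ kill R c y ε x (ang (fun _ => θ) t)) ∧
    ∫ t, tiltTerm ħ F₁ F₂ kill R c y ε x (ang (fun _ => θ) t) =
      ∫ t, tiltTerm ħ F₁ F₂ kill R c y ε x (ang ϑ t) := by
  have hpi := Real.pi_pos
  have hs0 : 0 < Real.sin θ ∨ IsEmpty (Fin m ⊕ Fin n) := by
    rcases isEmpty_or_nonempty (Fin m ⊕ Fin n) with h | ⟨⟨i⟩⟩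
    · exact Or.inr h
    · exact Or.inl (Real.sin_pos_of_pos_of_lt_pi hθ (by linarith [hϑ i, hϑ' i]))
  set σ := if 0 < Real.sin θ then Real.sin θ else 1 with hσ
  have hσ0 : 0 < σ := by rw [hσ]; split_ifs with h; exacts [h, one_pos]
  have hσϑ : ∀ ϑ' : Fin m ⊕ Fin n → ℝ, (∀ i, θ ≤ ϑ' i ∧ ϑ' i ≤ ϑ i) → ∀ i, σ ≤ Real.sin (ϑ' i) := by
    intro ϑ' h i
    have hs : 0 < Real.sin θ := hs0.resolve_right fun h => h.elim i
    rw [hσ, if_pos hs]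
    exact Real.sin_le_sin_of_le_of_le_pi_div_two (by linarith) (by linarith [(h i).2, hϑ' i]) (h i).1
  obtain ⟨C, hC, hg⟩ := exists_growthAt_termKern hħ h₁ h₂ ‖x‖ hσ0
  obtain ⟨K, hK⟩ := exists_jacobian_mul_le_exp_neg hħ m n hC hR c ‖y‖ ‖ε‖ (norm_nonneg _) (norm_nonneg _)
    hσ0 le_rfl
  have hbound : ∀ ϑ' t : Fin m ⊕ Fin n → ℝ, (∀ i, θ ≤ ϑ' i ∧ ϑ' i ≤ ϑ i) →
      ‖tiltTerm ħ F₁ F₂ kill R c y ε x (ang ϑ' t)‖ ≤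
        Real.exp K * (2 / 1) ^ Fintype.card (Fin m ⊕ Fin n) * cauchyWeight t := by
    intro ϑ' t h
    refine (hK y ε le_rfl le_rfl ϑ' t (fun i => hθ.le.trans (h i).1) (fun i => (h i).2.trans (hϑ' i))
      (hσϑ ϑ' h) _ (hg kill y ε x _ le_rfl (hsep ϑ' t h))).trans ?_
    have := exp_neg_sum_cosh_le one_pos t
    rw [mul_assoc, sub_eq_add_neg, Real.exp_add, ← neg_one_mul]
    gcongr
  have hdiff : ∀ ϑ' t : Fin m ⊕ Fin n → ℝ, (∀ i, θ ≤ ϑ' i ∧ ϑ' i ≤ ϑ i) →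
      DifferentiableAt ℂ (tiltTerm ħ F₁ F₂ kill R c y ε x) (ang ϑ' t) := by
    intro ϑ' t h
    unfold tiltTerm
    refine DifferentiableAt.mul ?_ (DifferentiableAt.comp (g := termKern ħ F₁ F₂ kill y ε x) _
      (differentiableAt_termKern hħ hF₁ hF₂ kill y ε x ?_) (differentiable_tiltPt R c _))
    · exact differentiableAt_prod fun i _ =>
        ((Complex.differentiable_cosh.comp (differentiable_apply i)) _).const_mul _
    · exact fun i b hb => (hsep ϑ' t h i b hb).imp (fun h => one_pos.trans_le h) fun h h' => by
        rw [h', abs_zero] at h; exact absurd h (by norm_num)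
  have hbase : ∀ i, θ ≤ (fun _ : Fin m ⊕ Fin n => θ) i ∧ (fun _ : Fin m ⊕ Fin n => θ) i ≤ ϑ i :=
    fun i => ⟨le_rfl, hϑ i⟩
  refine ⟨?_, ?_⟩
  · refine ((integrable_cauchyWeight (ι := Fin m ⊕ Fin n)).const_mul
      (Real.exp K * (2 / 1) ^ Fintype.card (Fin m ⊕ Fin n))).mono' ?_
      (Eventually.of_forall fun t => hbound _ t hbase)
    refine Continuous.aestronglyMeasurable (continuous_iff_continuousAt.2 fun t => ?_)
    exact ContinuousAt.comp (g := tiltTerm ħ F₁ F₂ kill R c y ε x) (f := ang fun _ => θ)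
      (hdiff _ t hbase).continuousAt (continuous_ang _).continuousAt
  · set base : Fin m ⊕ Fin n → ℂ := fun i => ((θ * sgn i : ℝ) : ℂ) * Complex.I with hbase'
    have hpt : ∀ (τ : ℝ) (t : Fin m ⊕ Fin n → ℝ),
        (fun i => (t i : ℂ) + ((τ * ((ϑ i - θ) * sgn i) : ℝ) : ℂ) * Complex.I) + base =
          ang (fun i => θ + τ * (ϑ i - θ)) t := by
      intro τ t; funext i
      simp only [hbase', ang, Pi.add_apply]
      push_cast; ring
    have hbox : ∀ τ ∈ Set.Icc (0:ℝ) 1, ∀ i, θ ≤ θ + τ * (ϑ i - θ) ∧ θ + τ * (ϑ i - θ) ≤ ϑ i := by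
      intro τ hτ i
      have := hϑ i
      constructor <;> nlinarith [hτ.1, hτ.2]
    have := integral_shift (fun i => (ϑ i - θ) * sgn i) zero_le_one
      (fun q => tiltTerm ħ F₁ F₂ kill R c y ε x (q + base))
      (Real.exp K * (2 / 1) ^ Fintype.card (Fin m ⊕ Fin n))
      (fun t τ hτ => by
        refine DifferentiableAt.comp (g := tiltTerm ħ F₁ F₂ kill R c y ε x) _ ?_
          (differentiableAt_fun_id.add_const base)
        rw [hpt]
        exact hdiff _ t (hbox τ hτ))
      (fun t τ hτ => by
        rw [hpt]
        exact hbound _ t (hbox τ hτ))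
    simp only [hpt] at this
    simpa using this

set_option maxHeartbeats 1000000 in
theorem exists_extension_growth_of_monotone (hħ : 0 < ħ) (e₁ : IsGoodExtension ħ Φ₁ F₁)
    (e₂ : IsGoodExtension ħ Φ₂ F₂) (h₁ : HasStripBounds ħ Φ₁) (h₂ : HasStripBounds ħ Φ₂)
    (X : ℝ) {κ : ℝ} (hκ : 0 < κ) : ∃ C : ℝ, 0 ≤ C ∧ ∀ (y : Fin (m + n + 1) → ℂ) ε x,
      Monotone (fun k => (y k).im) → ‖x‖ ≤ X →
      ‖extension ħ F₁ F₂ (y, ε, x)‖ ≤ Real.exp (C * (1 + ‖y‖ + ‖ε‖) +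
        (spread (fun k => (y k).im) + κ * ‖y‖) / ħ * Real.log (2 + ‖y‖)) := by
  set A : ℝ := m * (m + 1) + n * (n + 1) with hA
  have hA0 : 0 ≤ A := by positivity
  set σ := min (1 / 4) (κ / (4 * A + 1)) with hσ
  have hσ0 : 0 < σ := lt_min (by norm_num) (by positivity)
  have hσ4 : σ ≤ 1 / 4 := min_le_left _ _
  have hσκ : (4 * A + 1) * σ ≤ κ := by
    have : σ ≤ κ / (4 * A + 1) := min_le_right _ _
    rwa [le_div_iff₀ (by positivity), mul_comm] at this
  obtain ⟨C₁, hC₁, hg⟩ := exists_growthAt_termKern hħ e₁.growth e₂.growth X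
    (κ := σ ^ 2 / (9 + 4 * (m + n))) (by positivity)
  obtain ⟨C₂, hC₂, hterm⟩ := exists_jacobian_mul_le_of_energy_le hħ m n hC₁ hσ0 (by linarith)
  set J := ∫ t : Fin m ⊕ Fin n → ℝ, Real.exp (-1 * ∑ i, Real.cosh (t i)) with hJ
  have hJ0 : 0 ≤ J := integral_nonneg fun t => (Real.exp_pos _).le
  set M : ℝ := ((Fintype.card (Equiv.Perm (Fin m) × Equiv.Perm (Fin n)) : ℕ) : ℝ) with hM
  have hM0 : 0 ≤ M := by positivity
  refine ⟨M * J + C₂, by positivity, fun y ε x hmono hx => ?_⟩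
  have hy0 := norm_nonneg y
  set r := 1 + ‖y‖ with hr
  set R := 4 * r / σ with hR
  have hR0 : 0 < R := by positivity
  set E := C₂ * (1 + ‖y‖ + ‖ε‖) + (spread (fun k => (y k).im) + (4 * A + 1) * σ * ‖y‖) / ħ * Real.log (2 + ‖y‖) with hE
  have hsin2 : 1 / 2 ≤ Real.sin (Real.pi / 4) := by
    rw [Real.sin_pi_div_four]
    have : (1:ℝ) ≤ √2 := Real.one_le_sqrt.2 (by norm_num)
    linarith
  have hpi := Real.pi_pos
  have harc : ∀ s : ℝ, s ≤ 1 / 2 → Real.arcsin s ≤ Real.pi / 4 := fun s hs => by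
    rw [Real.arcsin_le_iff_le_sin' ⟨by linarith, by linarith⟩]
    linarith
  set θ := Real.arcsin σ with hθ
  have hθ0 : 0 < θ := Real.arcsin_pos.2 hσ0
  have hθ4 : θ ≤ Real.pi / 4 := harc σ (by linarith)
  have hsinθ : Real.sin θ = σ := Real.sin_arcsin (by linarith) (by linarith)
  have hRσ : R * σ = 4 * r := by rw [hR]; field_simp
  set S₁ : Fin m → Finset (Fin (m + n + 1)) := fun j => Finset.Iio (lo j) with hS₁
  set S₂ : Fin n → Finset (Fin (m + n + 1)) := fun j => Finset.Ioi (hi j.rev) with hS₂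
  have hcard₁ : ∀ j, (S₁ j).card = j := fun j => by simp [hS₁, lo]
  have hcard₂ : ∀ j, (S₂ j).card = j := fun j => by simp [hS₂, hi]; omega
  have hone : ∀ s : Equiv.Perm (Fin m) × Equiv.Perm (Fin n),
      (Integrable fun t => tiltTerm ħ F₁ F₂ (Sum.elim (fun a => S₁ (s.1 a)) fun b => S₂ (s.2 b)) R (7 * r) y ε x
        (ang (fun _ => θ) t)) ∧
      ‖∫ t, tiltTerm ħ F₁ F₂ (Sum.elim (fun a => S₁ (s.1 a)) fun b => S₂ (s.2 b)) R (7 * r) y ε x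
        (ang (fun _ => θ) t)‖ ≤ Real.exp E * J := by
    intro s
    set kill := Sum.elim (fun a => S₁ (s.1 a)) fun b => S₂ (s.2 b) with hkill
    set G : Fin m ⊕ Fin n → ℝ := Sum.elim (fun a => (y (lo (s.1 a))).im)
      fun b => -(y (hi ((s.2.trans Fin.revPerm) b))).im with hG
    have him : ∀ b, |(y b).im| ≤ ‖y‖ := fun b => (Complex.abs_im_le_norm _).trans (norm_le_pi_norm y b)
    have hGy : ∀ i, |G i| ≤ ‖y‖ := by
      rintro (a | b)
      · exact him _
      · simp only [hG, Sum.elim_inr, abs_neg]; exact him _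
    have hGb : ∀ i, ∀ b ∉ kill i, G i ≤ sgn i * (y b).im := by
      rintro (a | a) b hb
      · simp only [hkill, Sum.elim_inl, hS₁, Finset.mem_Iio, not_lt] at hb
        simp only [hG, Sum.elim_inl, sgn, one_mul]
        exact hmono hb
      · simp only [hkill, Sum.elim_inr, hS₂, Finset.mem_Ioi, not_lt] at hb
        simp only [hG, Sum.elim_inr, sgn, neg_one_mul, neg_le_neg_iff]
        exact hmono hb
    set g : Fin m ⊕ Fin n → ℝ := fun i => G i - (1 + 4 * σ * r) with hgdef
    set ϑ : Fin m ⊕ Fin n → ℝ := fun i => Real.arcsin ((7 * r + g i) / R) with hϑ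
    have hg4 : ∀ i, 4 * r ≤ 7 * r + g i := fun i => by
      have := neg_abs_le (G i)
      have := hGy i
      simp only [hgdef]
      nlinarith
    have hg8 : ∀ i, 7 * r + g i ≤ 8 * r := fun i => by
      have := le_abs_self (G i)
      have := hGy i
      simp only [hgdef]
      nlinarith
    have hlow : ∀ i, σ ≤ (7 * r + g i) / R := fun i => by
      rw [le_div_iff₀ hR0, mul_comm, hRσ]; exact hg4 i
    have hupp : ∀ i, (7 * r + g i) / R ≤ 2 * σ := fun i => by
      rw [div_le_iff₀ hR0, mul_assoc, mul_comm σ, hRσ]; linarith [hg8 i]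
    have hsinϑ : ∀ i, Real.sin (ϑ i) = (7 * r + g i) / R := fun i =>
      Real.sin_arcsin (by linarith [hlow i]) (by linarith [hupp i])
    have hϑ4 : ∀ i, ϑ i ≤ Real.pi / 4 := fun i => harc _ (by linarith [hupp i])
    have hθϑ : ∀ i, θ ≤ ϑ i := fun i => Real.monotone_arcsin (hlow i)
    have hsep : ∀ ϑ' t : Fin m ⊕ Fin n → ℝ, (∀ i, θ ≤ ϑ' i ∧ ϑ' i ≤ ϑ i) → ∀ i, ∀ b ∉ kill i,
        1 ≤ sgn i * ((y b).im - (tiltPt R (7 * r) (ang ϑ' t) i).im) ∨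
        1 ≤ |(y b).re - (tiltPt R (7 * r) (ang ϑ' t) i).re| := by
      intro ϑ' t h i b hb
      have a0 : 0 ≤ ϑ' i := hθ0.le.trans (h i).1
      have a4 : ϑ' i ≤ Real.pi / 4 := (h i).2.trans (hϑ4 i)
      have hs0 : 0 ≤ Real.sin (ϑ' i) := Real.sin_nonneg_of_nonneg_of_le_pi a0 (by linarith)
      have hs1 : Real.sin (ϑ' i) ≤ (7 * r + g i) / R := by
        rw [← hsinϑ i]
        exact Real.sin_le_sin_of_le_of_le_pi_div_two (by linarith) (by linarith [hϑ4 i]) (h i).2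
      have hc : 1 / 2 ≤ Real.cos (ϑ' i) := by
        have h1 := sin_le_cos_of_le_pi_div_four a0 a4
        have h2 := Real.sin_sq_add_cos_sq (ϑ' i)
        nlinarith
      refine tiltPt_separated_of_le (r := r) (κ := 4 * σ) hR0 (by linarith) hs0 (by positivity) ?_ (by linarith) t ?_
      · nlinarith [hupp i]
      · have h1 : R * Real.sin (ϑ' i) ≤ 7 * r + g i := by
          rw [le_div_iff₀ hR0] at hs1; linarith
        have := hGb i b hb
        simp only [hgdef] at h1
        linarith
    obtain ⟨hint, heq⟩ := integral_tiltTerm_eq hħ e₁.differentiable e₂.differentiable e₁.growth e₂.growth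
      kill hR0 (7 * r) y ε x hθ0 ϑ hθϑ hϑ4 hsep
    refine ⟨hint, ?_⟩
    rw [heq, hJ, ← integral_const_mul]
    refine norm_integral_le_of_norm_le ((integrable_exp_neg_sum_cosh one_pos).const_mul _)
      (Eventually.of_forall fun t => ?_)
    refine hterm y ε ϑ t g _ (fun i => ?_) hg4 ?_ (hg kill y ε x _ hx (hsep ϑ t fun i => ⟨hθϑ i, le_rfl⟩))
    · rw [hsinϑ i]; exact mul_div_cancel₀ _ hR0.ne'
    · exact (energy_sorted_perm hmono s.1 (s.2.trans Fin.revPerm) (1 + 4 * σ * r)).le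
  have hc0 : R * Real.sin θ + 2 * ‖y‖ + 3 ≤ 7 * r := by rw [hsinθ, hRσ]; linarith
  have hext : extension ħ F₁ F₂ (y, ε, x) = ∑ s : Equiv.Perm (Fin m) × Equiv.Perm (Fin n),
      ((Equiv.Perm.sign s.1 : ℂ) * (Equiv.Perm.sign s.2 : ℂ)) *
        ∫ t, tiltTerm ħ F₁ F₂ (Sum.elim (fun a => S₁ (s.1 a)) fun b => S₂ (s.2 b)) R (7 * r) y ε x
          (ang (fun _ => θ) t) := by
    rw [extension_eq hħ e₁ e₂ h₁ h₂ hR0 hθ0 hθ4 (y, ε, x) hc0, tiltInt]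
    simp only [← integral_const_mul]
    rw [← integral_finsetSum _ fun s _ => (hone s).1.const_mul _]
    refine integral_congr_ae (Eventually.of_forall fun t => ?_)
    simp only [tiltKern, tiltTerm]
    rw [kern_eq_sum_termKern hħ S₁ hcard₁ S₂ hcard₂ y ε x _ fun i b =>
      tiltPt_separated' hR0 le_rfl hθ0.le hθ4 (by linarith) t b, Finset.mul_sum]
    exact Finset.sum_congr rfl fun s _ => by ring
  have hsign : ∀ {k : ℕ} (s : Equiv.Perm (Fin k)), ‖(Equiv.Perm.sign s : ℂ)‖ = 1 := fun s => by
    rcases Int.units_eq_one_or (Equiv.Perm.sign s) with h | h <;> simp [h]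
  rw [hext]
  calc _ ≤ ∑ s : Equiv.Perm (Fin m) × Equiv.Perm (Fin n), Real.exp E * J := by
        refine norm_sum_le_of_le _ fun s _ => ?_
        rw [norm_mul, norm_mul, hsign, hsign, one_mul, one_mul]
        exact (hone s).2
    _ = Real.exp E * (M * J) := by
        rw [Finset.sum_const, nsmul_eq_mul, Finset.card_univ]; ring
    _ ≤ Real.exp E * Real.exp (M * J * (1 + ‖y‖ + ‖ε‖)) := by
        have h1 := Real.add_one_le_exp (M * J * (1 + ‖y‖ + ‖ε‖))
        have h2 : 0 ≤ M * J * (‖y‖ + ‖ε‖) := by positivity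
        gcongr
        linarith
    _ ≤ _ := by
        rw [← Real.exp_add]
        refine Real.exp_le_exp.2 ?_
        have hlog : 0 ≤ Real.log (2 + ‖y‖) := Real.log_nonneg (by linarith)
        have : (spread (fun k => (y k).im) + (4 * A + 1) * σ * ‖y‖) / ħ * Real.log (2 + ‖y‖) ≤
            (spread (fun k => (y k).im) + κ * ‖y‖) / ħ * Real.log (2 + ‖y‖) := by gcongr
        linarith

theorem hasGrowth_extension (hħ : 0 < ħ) (e₁ : IsGoodExtension ħ Φ₁ F₁)
    (e₂ : IsGoodExtension ħ Φ₂ F₂) (h₁ : HasStripBounds ħ Φ₁) (h₂ : HasStripBounds ħ Φ₂) :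
    HasGrowth ħ (extension ħ F₁ F₂) := by
  intro X κ hκ
  obtain ⟨C, hC, h⟩ := exists_extension_growth_of_monotone hħ e₁ e₂ h₁ h₂ X hκ
  refine ⟨C, hC, fun y ε x hx => ?_⟩
  set s := Tuple.sort fun k => (y k).im with hs
  have hn : ‖fun k => y (s k)‖ = ‖y‖ := by
    refine le_antisymm ((pi_norm_le_iff_of_nonneg (norm_nonneg _)).2 fun k => norm_le_pi_norm y _)
      ((pi_norm_le_iff_of_nonneg (norm_nonneg _)).2 fun k => ?_)
    have := norm_le_pi_norm (fun k => y (s k)) (s.symm k)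
    simpa using this
  have := h (fun k => y (s k)) ε x (Tuple.monotone_sort fun k => (y k).im) hx
  rwa [extension_comp_perm, hn, spread_comp (fun k => (y k).im) s] at this

end Term

/-- The exponential estimate on all strips, uniformly in the chain of splittings. -/
def UniformStripBounds (ħ : ℝ) (N : ℕ) : Prop :=
  ∀ η : ℝ, ∃ C₁ C₂ : ℝ, ∃ M : ℕ, 0 ≤ C₁ ∧ 0 ≤ C₂ ∧ ∀ c : Chain N, StripBound ħ (Psi ħ c) η C₁ C₂ M

theorem UniformStripBounds.hasStripBounds {ħ : ℝ} {N : ℕ} (h : UniformStripBounds ħ N) (c : Chain N) :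
    HasStripBounds ħ (Psi ħ c) := fun η => by
  obtain ⟨C₁, C₂, M, h1, h2, h3⟩ := h η
  exact ⟨C₁, C₂, M, h1, h2, h3 c⟩

theorem exists_stripBound_node {ħ : ℝ} (hħ : 0 < ħ) {m n : ℕ} (u₁ : UniformStripBounds ħ m)
    (u₂ : UniformStripBounds ħ n) (e₁ : ∀ c : Chain m, ∃ F, IsGoodExtension ħ (Psi ħ c) F)
    (e₂ : ∀ c : Chain n, ∃ F, IsGoodExtension ħ (Psi ħ c) F) (η : ℝ) :
    ∃ C₁ C₂ : ℝ, ∃ M : ℕ, 0 ≤ C₁ ∧ 0 ≤ C₂ ∧ ∀ α hα (left : Chain m) (right : Chain n),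
      StripBound ħ (Psi ħ (.node α hα left right)) η C₁ C₂ M := by
  set H := max η 0 + 1 with hH
  have hH0 : 0 < H := by have := le_max_right η 0; linarith
  obtain ⟨C₁, C₂, M, hC₁, hC₂, hb₁⟩ := u₁ ((2 * m + 2 * n + 4) * H)
  obtain ⟨D₁, D₂, M', hD₁, hD₂, hb₂⟩ := u₂ ((2 * m + 2 * n + 4) * H)
  obtain ⟨K, M'', hK, h⟩ := exists_kern_flat_le_cauchyWeight hħ m n one_pos hH0
    (hC₁.trans (le_max_left C₁ D₁)) (C₂ := max C₂ D₂) (max M M')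
  set J := ∫ u : Fin m ⊕ Fin n → ℝ, cauchyWeight u with hJ
  have hJ0 : 0 ≤ J := integral_nonneg fun u => (cauchyWeight_pos u).le
  refine ⟨K * J, max C₂ D₂, M'', by positivity, hC₂.trans (le_max_left _ _), fun α hα left right => ?_⟩
  intro y ε x hy hε
  obtain ⟨F₁, hF₁⟩ := e₁ left
  obtain ⟨F₂, hF₂⟩ := e₂ right
  have hyH : ∀ k, |(y k).im| + 1 ≤ H := fun k => by linarith [hy k, le_max_left η 0]
  rw [Psi_node, integral_kern_flat_eq hħ hF₁.differentiable_real hF₂.differentiable_real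
    (u₁.hasStripBounds left) (u₂.hasStripBounds right) y ε x (hα y) (α' := H) fun k => by linarith [hyH k]]
  have hbound := h (Psi ħ left) (Psi ħ right)
    ((hb₁ left).mono le_rfl hC₁ (le_max_left _ _) (le_max_left _ _) (le_max_left _ _))
    ((hb₂ right).mono le_rfl hD₁ (le_max_right _ _) (le_max_right _ _) (le_max_right _ _)) y ε x H hyH le_rfl
    (by linarith [le_max_left η 0])
  have hc : 0 < Real.pi / (2 * ħ) := by have := Real.pi_pos; positivity
  refine (norm_integral_le_of_norm_le ((integrable_cauchyWeight (ι := Fin m ⊕ Fin n)).const_mul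
    (K * Real.exp (max C₂ D₂ * ∑ a, |x a|) * (1 + ∑ a, ‖y a‖) ^ M'' *
          Real.exp (-(Real.pi / (2 * ħ)) * ((∑ a, ∑ b, |(y a - y b).re|) / 2))))
    (Eventually.of_forall fun u => (hbound u).trans ?_)).trans_eq ?_
  · refine mul_le_mul_of_nonneg_left ?_ (by positivity)
    refine mul_le_of_le_one_left (cauchyWeight_pos u).le (Real.exp_le_one_iff.2 ?_)
    have : 0 ≤ ∑ i, max 0 (|u i| - (1 + ∑ a, ‖y a‖)) := Finset.sum_nonneg fun i _ => le_max_left _ _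
    nlinarith
  · rw [integral_const_mul, ← hJ]; ring

theorem isGoodExtension_node {ħ : ℝ} (hħ : 0 < ħ) {m n : ℕ} (u₁ : UniformStripBounds ħ m)
    (u₂ : UniformStripBounds ħ n) (α : (Fin (m + n + 1) → ℂ) → ℝ) (hα : ∀ y k, |(y k).im| < α y)
    {left : Chain m} {right : Chain n} {F₁ F₂} (e₁ : IsGoodExtension ħ (Psi ħ left) F₁)
    (e₂ : IsGoodExtension ħ (Psi ħ right) F₂) :
    IsGoodExtension ħ (Psi ħ (.node α hα left right)) (extension ħ F₁ F₂) where
  differentiable := differentiable_extension hħ e₁ e₂ (u₁.hasStripBounds _) (u₂.hasStripBounds _)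
  eq y ε x := by
    rw [Psi_node]
    exact extension_ofReal hħ e₁ e₂ (u₁.hasStripBounds _) (u₂.hasStripBounds _) y ε x (hα y)
  growth := hasGrowth_extension hħ e₁ e₂ (u₁.hasStripBounds _) (u₂.hasStripBounds _)

theorem stripBound_leaf {ħ : ℝ} (hħ : 0 < ħ) (η : ℝ) : StripBound ħ (Psi ħ .leaf) η 1 (|η| / ħ) 0 := by
  intro y ε x _ hε
  simp only [Psi, Complex.norm_exp, Finset.univ_eq_empty, Finset.sum_empty, pow_zero, zero_div, mul_zero,
    Real.exp_zero, mul_one, one_mul]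
  refine Real.exp_le_exp.2 ?_
  have e : (Complex.I * (ε / ħ) * x 0).re = -(ε.im / ħ * x 0) := by
    rw [Complex.re_mul_ofReal, Complex.I_mul_re, Complex.div_ofReal_im]; ring
  rw [e]
  refine (neg_le_abs _).trans ?_
  rw [abs_mul, abs_div, abs_of_pos hħ]
  have : |ε.im| ≤ |η| := hε.le.trans (le_abs_self η)
  have hx : |x 0| ≤ ∑ a, |x a| :=
    Finset.single_le_sum (f := fun a => |x a|) (fun a _ => abs_nonneg _) (Finset.mem_univ _)
  gcongr

theorem isGoodExtension_leaf {ħ : ℝ} (hħ : 0 < ħ) :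
    IsGoodExtension ħ (Psi ħ .leaf) fun q => Complex.exp (Complex.I * (q.2.1 / ħ) * q.2.2 0) where
  differentiable := by
    have h : Differentiable ℂ fun q : (Fin 0 → ℂ) × ℂ × (Fin 1 → ℂ) => q.2.2 0 := by fun_prop
    intro q
    exact (((differentiableAt_div_const (differentiable_fst.comp differentiable_snd).differentiableAt _).const_mul
      _).mul (h q)).cexp
  eq y ε x := by simp [Psi]
  growth X κ hκ := by
    refine ⟨|X| / ħ, by positivity, fun y ε x hx => ?_⟩
    have hy : ‖y‖ = 0 := by rw [Subsingleton.elim y 0, norm_zero]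
    refine (Complex.norm_exp_le_exp_norm _).trans (Real.exp_le_exp.2 ?_)
    rw [norm_mul, norm_mul, Complex.norm_I, norm_div, Complex.norm_real, Real.norm_of_nonneg hħ.le, hy]
    have h1 : ‖x 0‖ ≤ |X| := (norm_le_pi_norm x 0).trans (hx.trans (le_abs_self X))
    have h2 : spread (fun k => (y k).im) = 0 := by simp [spread]
    have h3 : ‖ε‖ / ħ * ‖x 0‖ ≤ ‖ε‖ / ħ * |X| := by gcongr
    have h4 : 0 ≤ |X| / ħ := by positivity
    rw [h2]
    calc _ = ‖ε‖ / ħ * ‖x 0‖ := by ring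
      _ ≤ ‖ε‖ / ħ * |X| := h3
      _ ≤ |X| / ħ + ‖ε‖ / ħ * |X| := by linarith
      _ = _ := by ring

theorem uniformStripBounds_and_exists_isGoodExtension {ħ : ℝ} (hħ : 0 < ħ) (N : ℕ) :
    UniformStripBounds ħ N ∧ ∀ c : Chain N, ∃ F, IsGoodExtension ħ (Psi ħ c) F := by
  induction N using Nat.strong_induction_on with
  | _ N ih =>
  refine ⟨fun η => ?_, fun c => ?_⟩
  · have h : ∀ p : ℕ × ℕ, ∃ C₁ C₂ : ℝ, ∃ M : ℕ, 0 ≤ C₁ ∧ 0 ≤ C₂ ∧ (p.1 < N → p.2 < N →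
        ∀ α hα (left : Chain p.1) (right : Chain p.2),
          StripBound ħ (Psi ħ (.node α hα left right)) η C₁ C₂ M) := by
      intro p
      by_cases hp : p.1 < N ∧ p.2 < N
      · obtain ⟨C₁, C₂, M, h1, h2, h3⟩ := exists_stripBound_node hħ (ih _ hp.1).1 (ih _ hp.2).1 (ih _ hp.1).2
          (ih _ hp.2).2 η
        exact ⟨C₁, C₂, M, h1, h2, fun _ _ => h3⟩
      · exact ⟨0, 0, 0, le_rfl, le_rfl, fun h1 h2 => absurd ⟨h1, h2⟩ hp⟩
    choose C₁ C₂ M hC₁ hC₂ hb using h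
    set s := Finset.range N ×ˢ Finset.range N with hs
    have hS₁ : 0 ≤ ∑ p ∈ s, C₁ p := Finset.sum_nonneg fun p _ => hC₁ p
    have hS₂ : 0 ≤ ∑ p ∈ s, C₂ p := Finset.sum_nonneg fun p _ => hC₂ p
    refine ⟨1 + ∑ p ∈ s, C₁ p, |η| / ħ + ∑ p ∈ s, C₂ p, ∑ p ∈ s, M p, by positivity, by positivity, fun c => ?_⟩
    cases c with
    | leaf =>
      exact (stripBound_leaf hħ η).mono le_rfl zero_le_one (by linarith) (by linarith) (Nat.zero_le _)
    | @node m n α hα left right =>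
      have hp : (m, n) ∈ s := by simp only [hs, Finset.mem_product, Finset.mem_range]; omega
      have h1 := Finset.single_le_sum (f := C₁) (fun p _ => hC₁ p) hp
      have h2 := Finset.single_le_sum (f := C₂) (fun p _ => hC₂ p) hp
      have h3 := Finset.single_le_sum (f := M) (fun p _ => Nat.zero_le _) hp
      have : 0 ≤ |η| / ħ := by positivity
      exact (hb (m, n) (by dsimp only; omega) (by dsimp only; omega) α hα left right).mono le_rfl (hC₁ _) (by linarith)
        (by linarith) h3
  · cases c with
    | leaf => exact ⟨_, isGoodExtension_leaf hħ⟩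
    | @node m n α hα left right =>
      obtain ⟨u₁, e₁⟩ := ih m (by omega)
      obtain ⟨u₂, e₂⟩ := ih n (by omega)
      obtain ⟨F₁, hF₁⟩ := e₁ left
      obtain ⟨F₂, hF₂⟩ := e₂ right
      exact ⟨_, isGoodExtension_node hħ u₁ u₂ α hα hF₁ hF₂⟩

theorem converges {ħ : ℝ} (hħ : 0 < ħ) {N : ℕ} (c : Chain N) (y : Fin N → ℂ) (ε : ℂ) (x : Fin (N + 1) → ℝ) :
    Converges ħ c y ε x := by
  cases c with
  | leaf => simp [Converges]
  | @node m n α hα left right =>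
    obtain ⟨u₁, e₁⟩ := uniformStripBounds_and_exists_isGoodExtension hħ m
    obtain ⟨u₂, e₂⟩ := uniformStripBounds_and_exists_isGoodExtension hħ n
    obtain ⟨F₁, hF₁⟩ := e₁ left
    obtain ⟨F₂, hF₂⟩ := e₂ right
    rw [Converges]
    refine integrable_sum_pi _ ?_
    simp only [integrand_eq_kern]
    exact integrable_kern_flat hħ hF₁.differentiable_real hF₂.differentiable_real (u₁.hasStripBounds _)
      (u₂.hasStripBounds _) y ε x (hα y)

end Toda

end

theorem mainTheorem8 (ħ : ℝ) (hħ : 0 < ħ) (N : ℕ) :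
    (∀ η : ℝ, 0 < η → ∃ C₁ C₂ M : ℝ, ∀ (c : Toda.Chain N) (y : Fin N → ℂ) (ε : ℂ)
        (x : Fin (N + 1) → ℝ), (∀ k, |(y k).im| < η) → |ε.im| < η →
        ‖Toda.Psi ħ c y ε x‖ ≤
          C₁ * Real.exp (C₂ * ∑ a, |x a|) * (1 + ∑ a, ‖y a‖) ^ M *
            Real.exp (-(Real.pi / (2 * ħ)) * ∑ a, ∑ b ∈ Finset.Ioi a, |(y a - y b).re|)) ∧
      (∀ (c : Toda.Chain N) (y : Fin N → ℂ) (ε : ℂ) (x : Fin (N + 1) → ℝ),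
        Toda.Converges ħ c y ε x) ∧
      ∀ c : Toda.Chain N, ∃ F : (Fin N → ℂ) × ℂ × (Fin (N + 1) → ℂ) → ℂ,
        Differentiable ℂ F ∧
          ∀ (y : Fin N → ℂ) (ε : ℂ) (x : Fin (N + 1) → ℝ),
            F (y, ε, fun a => (x a : ℂ)) = Toda.Psi ħ c y ε x := by
  obtain ⟨u, e⟩ := Toda.uniformStripBounds_and_exists_isGoodExtension hħ N
  refine ⟨fun η _ => ?_, fun c y ε x => Toda.converges hħ c y ε x, fun c => ?_⟩
  · obtain ⟨C₁, C₂, M, _, _, h⟩ := u η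
    refine ⟨C₁, C₂, M, fun c y ε x hy hε => ?_⟩
    rw [Real.rpow_natCast, Toda.sum_Ioi_eq_half (fun a b => |(y a - y b).re|)
      (fun a b => by rw [← abs_neg, ← Complex.neg_re, neg_sub]) (by simp)]
    exact h c y ε x hy hε
  · obtain ⟨F, hF⟩ := e c
    exact ⟨F, hF.differentiable, hF.eq⟩
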